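/- Let $u\in C^2(\mathbb{R}^d)$, $h=\nabla u$, and assume that for some constants $L',l',A,b,L,l>0$ and $a\ge 1$, for all $x,y\in\mathbb{R}^d$, $$|h(x)-h(y)|\le L'(1+|x|+|y|)^{l'}|x-y|,\qquad \langle h(x),x\rangle\ge A|x|^a-b,\qquad \max\{|h(x)|,\|J_h(x)\|\}\le L(1+|x|^{2l}),$$ where $J_h$ is the Jacobian of $h$ and $\|\cdot\|$ the spectral norm. Let $\pi=e^{-u}/\int e^{-u}$. Put $R(x)=x/(1+|x|^2)^{1-a/2}$ and let $C^*$ be a constant with $\|J_R(x)\|\le C^*$ for all $x$. Let $$0<\lambda<\frac{1}{4(2AC^*+2L+1)^2},\qquad h_\lambda(x)=A R(x)+\frac{h(x)-A R(x)}{1+\sqrt{\lambda}\,|x|^{2l}} .$$ Let $\theta_0$ have a nondegenerate Gaussian law on $\mathbb{R}^d$, let $B$ be a standard $d$-dimensional Brownian motion independent of $\theta_0$, and let $(\theta_t)_{t\ge0}$ be the continuous-time interpolation of the wd-TULA scheme $\bar\theta_{n+1}=\bar\theta_n-\lambda h_\lambda(\bar\theta_n)+\sqrt{2\lambda}\,\xi_{n+1}$,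 $\bar\theta_0=\theta_0$, that is, $$\theta_t=\theta_{k\lambda}-(t-k\lambda)h_\lambda(\theta_{k\lambda})+\sqrt2\,(B_t-B_{k\lambda}),\qquad t\in[k\lambda,(k+1)\lambda],\ k\in\mathbb{N}$$ (so $\theta_{k\lambda}=\bar\theta_k$ with $\xi_{n}=(B_{n\lambda}-B_{(n-1)\lambda})/\sqrt\lambda$). Let $\hat\pi_t$ be the law of $\theta_t$, and for a probability measure $\nu\ll\pi$ with $f=d\nu/d\pi$ let $H_\pi(\nu)=\int f\log f\,d\pi$ and $I_\pi(\nu)=\int \frac{|\nabla f|^2}{f}\,d\pi$. Then for every $k\in\mathbb{N}$ and every $t\in[k\lambda,(k+1)\lambda]$ the quantities $H_\pi(\hat\pi_t)$, $I_\pi(\hat\pi_t)$ and $\mathbb{E}|h(\theta_t)-h_\lambda(\theta_{k\lambda})|^2$ are finite, $s\mapsto H_\pi(\hat\pi_s)$ is differentiable at $t$ on $[k\lambda,(k+1)\lambda]$ (one-sidedly at the two endpoints), and $$\frac{d}{dt}H_\pi(\hat\pi_t)\le-\frac34 I_\pi(\hat\pi_t)+\mathbb{E}\,|h(\theta_t)-h_\lambda(\theta_{k\lambda})|^2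 .$$ -/

import Mathlib

open MeasureTheory ProbabilityTheory Set
open scoped NNReal ENNReal

namespace TamedLangevin

noncomputable section

/-! ### Drift, target measure, tamed drift -/

/-- The assumptions on the drift `h`: polynomial Lipschitz continuity, weak dissipativity, and
polynomial growth of `h` and of its Jacobian (in operator norm). -/
structure DriftAssumption {d : ℕ} (h : EuclideanSpace ℝ (Fin d) → EuclideanSpace ℝ (Fin d))
    (L' l' A a b L l : ℝ) : Prop where
  L'_pos : 0 < L'
  l'_pos : 0 < l'
  A_pos : 0 < A
  one_le_a : 1 ≤ a
  b_pos : 0 < b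
  L_pos : 0 < L
  l_pos : 0 < l
  polyLipschitz : ∀ x y, ‖h x - h y‖ ≤ L' * (1 + ‖x‖ + ‖y‖) ^ l' * ‖x - y‖
  weakDissipative : ∀ x, A * ‖x‖ ^ a - b ≤ inner ℝ (h x) x
  polyJacobian : ∀ x, max ‖h x‖ ‖fderiv ℝ h x‖ ≤ L * (1 + ‖x‖ ^ (2 * l))

/-- The target measure `π = e^{-u} dx / ∫ e^{-u}`. -/
def target {d : ℕ} (u : EuclideanSpace ℝ (Fin d) → ℝ) : Measure (EuclideanSpace ℝ (Fin d)) :=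
  (volume : Measure (EuclideanSpace ℝ (Fin d))).tilted (fun x => - u x)

/-- The vector field `R(x) = x / (1 + |x|²)^{1 - a/2}`. -/
def radialField {d : ℕ} (a : ℝ) (x : EuclideanSpace ℝ (Fin d)) : EuclideanSpace ℝ (Fin d) :=
  ((1 + ‖x‖ ^ 2) ^ (1 - a / 2))⁻¹ • x

/-- The tamed drift `h_λ = A R + (h - A R) / (1 + √λ |x|^{2l})`. -/
def tamedDrift {d : ℕ} (h : EuclideanSpace ℝ (Fin d) → EuclideanSpace ℝ (Fin d))
    (A a l lam : ℝ) (x : EuclideanSpace ℝ (Fin d)) : EuclideanSpace ℝ (Fin d) :=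
  A • radialField a x + (1 + √lam * ‖x‖ ^ (2 * l))⁻¹ • (h x - A • radialField a x)

/-! ### Brownian motion, the scheme and its interpolation -/

/-- A standard `d`-dimensional Brownian motion: its coordinates are independent real standard
Brownian motions. -/
structure IsBrownianMotion {d : ℕ} {Ω : Type*} [MeasurableSpace Ω]
    (B : ℝ≥0 → Ω → EuclideanSpace ℝ (Fin d)) (P : Measure Ω) : Prop where
  coord : ∀ i : Fin d, IsBrownianReal (fun t ω => B t ω i) P
  indep : iIndepFun (fun (i : Fin d) (ω : Ω) (t : ℝ≥0) => B t ω i) P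

/-- The iterates `θ_{n+1} = θ_n - λ g(θ_n) + √(2λ) ξ_{n+1}`. With `g = h_λ` this is wd-TULA. -/
def iterates {d : ℕ} {Ω : Type*} (g : EuclideanSpace ℝ (Fin d) → EuclideanSpace ℝ (Fin d))
    (lam : ℝ) (θ₀ : Ω → EuclideanSpace ℝ (Fin d)) (ξ : ℕ → Ω → EuclideanSpace ℝ (Fin d)) :
    ℕ → Ω → EuclideanSpace ℝ (Fin d)
  | 0 => θ₀
  | n + 1 => fun ω => iterates g lam θ₀ ξ n ω - lam • g (iterates g lam θ₀ ξ n ω)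
      + √(2 * lam) • ξ (n + 1) ω

/-- The normalized increments `ξ_n = (B_{nλ} - B_{(n-1)λ}) / √λ` (`n ≥ 1`), which are i.i.d.
standard Gaussian vectors when `B` is a Brownian motion. -/
def noise {d : ℕ} {Ω : Type*} (lam : ℝ) (B : ℝ≥0 → Ω → EuclideanSpace ℝ (Fin d))
    (n : ℕ) (ω : Ω) : EuclideanSpace ℝ (Fin d) :=
  (√lam)⁻¹ • (B (n * lam).toNNReal ω - B (((n : ℝ) - 1) * lam).toNNReal ω)

/-- The continuous-time interpolation
`θ_t = θ_{kλ} - (t - kλ) g(θ_{kλ}) + √2 (B_t - B_{kλ})`, `k = ⌊t/λ⌋`, for `t ≥ 0`, where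
`θ_{kλ}` is the `k`-th iterate. -/
def interpolation {d : ℕ} {Ω : Type*} (g : EuclideanSpace ℝ (Fin d) → EuclideanSpace ℝ (Fin d))
    (lam : ℝ) (θ₀ : Ω → EuclideanSpace ℝ (Fin d)) (B : ℝ≥0 → Ω → EuclideanSpace ℝ (Fin d))
    (t : ℝ) (ω : Ω) : EuclideanSpace ℝ (Fin d) :=
  let k : ℕ := ⌊t / lam⌋₊
  iterates g lam θ₀ (noise lam B) k ω
    - (t - k * lam) • g (iterates g lam θ₀ (noise lam B) k ω)
    + √2 • (B t.toNNReal ω - B (k * lam).toNNReal ω)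

section interpolation

variable {d : ℕ} {Ω : Type*} {g : EuclideanSpace ℝ (Fin d) → EuclideanSpace ℝ (Fin d)}
  {lam : ℝ} {θ₀ : Ω → EuclideanSpace ℝ (Fin d)} {B : ℝ≥0 → Ω → EuclideanSpace ℝ (Fin d)}

/-- At grid times the interpolation is the scheme. -/
theorem interpolation_grid (hlam : 0 < lam) (k : ℕ) (ω : Ω) :
    interpolation g lam θ₀ B (k * lam) ω = iterates g lam θ₀ (noise lam B) k ω := by
  have hk : ⌊(k : ℝ) * lam / lam⌋₊ = k := by
    rw [mul_div_cancel_right₀ _ hlam.ne', Nat.floor_natCast]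
  simp [interpolation, hk]

/-- The interpolation formula holds on each closed step interval. -/
theorem interpolation_eq (hlam : 0 < lam) (k : ℕ) {t : ℝ}
    (ht : t ∈ Icc (k * lam) ((k + 1) * lam)) (ω : Ω) :
    interpolation g lam θ₀ B t ω = interpolation g lam θ₀ B (k * lam) ω
      - (t - k * lam) • g (interpolation g lam θ₀ B (k * lam) ω)
      + √2 • (B t.toNNReal ω - B (k * lam).toNNReal ω) := by
  rcases ht.2.eq_or_lt with rfl | hlt
  · have h1 := interpolation_grid (g := g) (θ₀ := θ₀) (B := B) hlam (k + 1) ω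
    push_cast at h1
    rw [h1, interpolation_grid hlam]
    have h2 : √(2 * lam) * (√lam)⁻¹ = √2 := by
      rw [Real.sqrt_mul (by norm_num), mul_assoc, mul_inv_cancel₀ (Real.sqrt_pos.2 hlam).ne',
        mul_one]
    have h3 : ((k : ℝ) + 1) * lam - k * lam = lam := by ring
    simp only [iterates, noise, smul_smul, h2, h3]
    push_cast
    rw [add_sub_cancel_right]
  · have hk : ⌊t / lam⌋₊ = k := by
      rw [Nat.floor_eq_iff (div_nonneg ((by positivity : (0 : ℝ) ≤ k * lam).trans ht.1) hlam.le)]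
      exact ⟨(le_div_iff₀ hlam).2 ht.1, (div_lt_iff₀ hlam).2 hlt⟩
    rw [interpolation_grid hlam]
    simp only [interpolation, hk]

end interpolation

/-! ### Relative entropy and relative Fisher information -/

/-- Relative entropy `H_π(ν) = ∫ (dν/dπ) log (dν/dπ) dπ`, for probability measures. -/
def relEntropy {α : Type*} [MeasurableSpace α] (π ν : Measure α) : ℝ≥0∞ :=
  InformationTheory.klDiv ν π

/-- `g` is a weak gradient of `f` on `ℝ^d`. -/
def IsWeakGradient {d : ℕ} (f : EuclideanSpace ℝ (Fin d) → ℝ)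
    (g : EuclideanSpace ℝ (Fin d) → EuclideanSpace ℝ (Fin d)) : Prop :=
  LocallyIntegrable f volume ∧ LocallyIntegrable g volume ∧
    ∀ φ : EuclideanSpace ℝ (Fin d) → ℝ, ContDiff ℝ (⊤ : ℕ∞) φ → HasCompactSupport φ →
      ∫ x, f x • gradient φ x = - ∫ x, φ x • g x

/-- Relative Fisher information `I_π(ν) = ∫ |∇f|² / f dπ`, `f = dν/dπ`, for a measure `π` with a
positive Lebesgue density; `∇f` is the weak gradient, which is unique almost everywhere, so that
the infimum only selects it. The value is `∞` if `ν` is not absolutely continuous with respect to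
`π` or `f` has no weak gradient. -/
def fisherInfo {d : ℕ} (π ν : Measure (EuclideanSpace ℝ (Fin d))) : ℝ≥0∞ :=
  ⨅ (g : EuclideanSpace ℝ (Fin d) → EuclideanSpace ℝ (Fin d))
    (_ : ν ≪ π ∧ IsWeakGradient (fun x => (ν.rnDeriv π x).toReal) g),
    ∫⁻ x, ENNReal.ofReal (‖g x‖ ^ 2) / ν.rnDeriv π x ∂π

end

end TamedLangevin

/-!
The proof works on one step of the scheme at a time. Let `X = θ_{kλ}` have law `μ`, let `g` be the
tamed drift, and put `s = t - kλ`. Brownian increments are Gaussian and independent of the past, so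
`(X, θ_t)` is distributed as `(X, X - s g(X) + √(2s) ξ)` with `ξ` a standard Gaussian vector
independent of `X` (`IsBrownianMotion.map_interpolation`). Taming gives `g` linear growth
(`driftGrowth_tamedDrift`), and this is the only property of `g` besides continuity that is used.

For `s > 0` the law of `θ_t` has the explicit density `p_s = ∫ K_s(z, ·) μ(dz)` with a Gaussian
kernel `K_s`. As a Gaussian mixture it is positive, `log p_s` grows at most quadratically and
`∇ log p_s` at most linearly (`exists_abs_log_gaussMix_le`, `exists_norm_gaussMixGrad_le`). Let
`J_s = ∫ K_s(z, ·) g(z) μ(dz)`. Computing the derivative of `E φ(X - s g(X) + √(2s) ξ)` in two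
ways, through the density and along the paths, yields the weak Fokker–Planck equation
`∫ ∂ₛp φ = -∫ ⟨∇φ, ∇p + J⟩` (`integral_eulerDensityDeriv_mul`) without integration by parts. With
`φ = log p + u + 1` it becomes the dissipation identity `d/ds H = -∫ ⟨S, ∇p + J⟩` for the relative
score `S = ∇ log p + h` (`hasDerivAt_entropy`). Since
`∇p + J = p S - E[h(θ_t) - g(X) | θ_t = ·] p`, Young's inequality inside the conditional
expectation bounds the right-hand side by `-3/4 ∫ p |S|² + E |h(θ_t) - g(X)|²`
(`neg_integral_inner_eulerScore_le`), and `∫ p |S|²` dominates the Fisher information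
(`fisherInfo_densityMeasure_le`).

At `s = 0` the kernel degenerates. There `μ` has a density `q` whose logarithmic gradient grows at
most linearly, because `μ` is itself the law after an Euler step: the previous one, or, for the
Gaussian initial law, a step with zero drift (`exists_density_interpolation_grid`). After the
substitution `z = x + √s w` the integrals defining `p_s`, `J_s` and `∇p_s` are dominated by
`q(x) exp (δ (1 + |x|)²)` times a Gaussian in `w`, with `δ` arbitrarily small for small `s`
(`exists_shortTime_domination`), and converge to `q`, `q g` and `∇q`. A Gaussian moment of `μ`
absorbs the exponential factor, so the entropy and its derivative converge as `s → 0`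
(`tendsto_integral_entropy`, `tendsto_integral_dissipation`). The one-sided derivative at `s = 0`
therefore exists and is given by the same formula (`hasDerivWithinAt_entropy_zero`).
-/

set_option linter.unusedSectionVars false

open Filter Topology

namespace TamedLangevin

section

variable {E : Type*} [NormedAddCommGroup E] [InnerProductSpace ℝ E]

/-! ### The heat kernel -/

/-- The heat kernel `(4πτ)^{-dim E / 2} exp(-|y|² / (4τ))`, the density of a centred Gaussian
vector with covariance `2τ` times the identity. -/
noncomputable def heatKernel (τ : ℝ) (y : E) : ℝ :=
  (4 * Real.pi * τ) ^ (-(Module.finrank ℝ E / 2 : ℝ)) * Real.exp (-(‖y‖ ^ 2) / (4 * τ))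

theorem pow_le_mul_exp_sq {b : ℝ} (hb : 0 < b) (M : ℕ) :
    ∃ C : ℝ, 0 < C ∧ ∀ t : ℝ, 0 ≤ t → (1 + t) ^ M ≤ C * Real.exp (b * t ^ 2) := by
  refine ⟨(2 * (1 + 1 / b)) ^ M * (M.factorial * Real.exp 1), by positivity, fun t ht => ?_⟩
  have h1 : (1 + t) ^ M ≤ ((2 * (1 + 1 / b)) * (1 + b * t ^ 2)) ^ M := by
    refine pow_le_pow_left₀ (by positivity) ?_ M
    have h2 : (2 * (1 + 1 / b)) * (1 + b * t ^ 2) = 2 + 2 * b * t ^ 2 + 2 / b + 2 * t ^ 2 := by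
      field_simp; ring
    rw [h2]
    have : 0 ≤ 2 / b := by positivity
    have : 0 ≤ 2 * b * t ^ 2 := by positivity
    nlinarith [sq_nonneg (t - 1)]
  have h3 : (1 + b * t ^ 2) ^ M ≤ M.factorial * (Real.exp 1 * Real.exp (b * t ^ 2)) := by
    have := Real.pow_div_factorial_le_exp (1 + b * t ^ 2) (by positivity) M
    rw [← Real.exp_add]
    rwa [div_le_iff₀' (by positivity)] at this
  calc (1 + t) ^ M ≤ (2 * (1 + 1 / b)) ^ M * (1 + b * t ^ 2) ^ M := by rw [← mul_pow]; exact h1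
    _ ≤ (2 * (1 + 1 / b)) ^ M * (M.factorial * (Real.exp 1 * Real.exp (b * t ^ 2))) := by gcongr
    _ = _ := by ring

theorem heatKernel_pos {τ : ℝ} (hτ : 0 < τ) (y : E) : 0 < heatKernel τ y := by
  unfold heatKernel; positivity

theorem heatKernel_le_zero {τ : ℝ} (hτ : 0 < τ) (y : E) :
    heatKernel τ y ≤ heatKernel τ (0 : E) := by
  unfold heatKernel
  gcongr
  simp

theorem continuous_heatKernel (τ : ℝ) : Continuous (heatKernel τ : E → ℝ) := by
  unfold heatKernel; fun_prop

theorem hasFDerivAt_heatKernel {τ : ℝ} (hτ : 0 < τ) (y : E) :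
    HasFDerivAt (heatKernel τ : E → ℝ) (innerSL ℝ (-(heatKernel τ y / (2 * τ)) • y)) y := by
  have h1 : HasFDerivAt (fun y : E => -(‖y‖ ^ 2) / (4 * τ))
      ((4 * τ)⁻¹ • -((2 : ℕ) • innerSL ℝ y) : E →L[ℝ] ℝ) y := by
    have := ((hasStrictFDerivAt_norm_sq y).hasFDerivAt.neg).const_smul ((4 * τ)⁻¹)
    refine this.congr_of_eventuallyEq (Eventually.of_forall fun z => ?_)
    simp [div_eq_inv_mul]
  have h2 := (h1.exp).const_mul ((4 * Real.pi * τ) ^ (-(Module.finrank ℝ E / 2 : ℝ)))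
  refine h2.congr_fderiv ?_
  ext v
  simp only [heatKernel, _root_.smul_apply, _root_.neg_apply, smul_eq_mul,
    innerSL_apply_apply, real_inner_smul_left, nsmul_eq_mul]
  field_simp
  norm_num

/-- The time derivative of the heat kernel at a point that moves with constant velocity. -/
theorem hasDerivAt_heatKernel_line (a v : E) {s : ℝ} (hs : 0 < s) :
    HasDerivAt (fun s : ℝ => heatKernel s (a + s • v))
      (heatKernel s (a + s • v) * (‖a + s • v‖ ^ 2 / (4 * s ^ 2)
        - Module.finrank ℝ E / (2 * s) - inner ℝ (a + s • v) v / (2 * s))) s := by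
  set D : ℝ := (Module.finrank ℝ E : ℝ)
  have h0 : HasDerivAt (fun s : ℝ => a + s • v) v s := by
    simpa using ((hasDerivAt_id s).smul_const v).const_add a
  have h1 : HasDerivAt (fun s : ℝ => -(‖a + s • v‖ ^ 2) / (4 * s))
      ((-(2 * inner ℝ (a + s • v) v) * (4 * s) - -(‖a + s • v‖ ^ 2) * (4 * 1)) / (4 * s) ^ 2) s :=
    (h0.norm_sq.neg).div ((hasDerivAt_id s).const_mul 4) (by positivity)
  have h2 : HasDerivAt (fun s : ℝ => (4 * Real.pi * s) ^ (-(D / 2)))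
      ((4 * Real.pi * 1) * (-(D / 2)) * (4 * Real.pi * s) ^ (-(D / 2) - 1)) s :=
    ((hasDerivAt_id s).const_mul (4 * Real.pi)).rpow_const (Or.inl (by positivity))
  have h3 := h2.mul h1.exp
  refine h3.congr_deriv ?_
  rw [Real.rpow_sub_one (by positivity)]
  simp only [heatKernel]
  field_simp
  ring

/-- Polynomial decay of the heat kernel, uniformly for times in a compact subset of `(0, ∞)`. -/
theorem heatKernel_mul_pow_le {s₁ : ℝ} (hs₁ : 0 < s₁) (s₂ : ℝ) (M : ℕ) :
    ∃ C : ℝ, 0 < C ∧ ∀ s ∈ Icc s₁ s₂, ∀ y : E, heatKernel s y * (1 + ‖y‖) ^ M ≤ C := by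
  rcases lt_or_ge s₂ s₁ with h | h
  · exact ⟨1, one_pos, fun s hs => absurd (hs.1.trans hs.2) h.not_ge⟩
  have hs₂ : 0 < s₂ := hs₁.trans_le h
  obtain ⟨C, hC, hCt⟩ := pow_le_mul_exp_sq (b := 1 / (4 * s₂)) (by positivity) M
  refine ⟨(4 * Real.pi * s₁) ^ (-(Module.finrank ℝ E / 2 : ℝ)) * C, by positivity,
    fun s hs y => ?_⟩
  have hs0 : 0 < s := hs₁.trans_le hs.1
  have h1 : heatKernel s y ≤ (4 * Real.pi * s₁) ^ (-(Module.finrank ℝ E / 2 : ℝ))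
      * Real.exp (-(1 / (4 * s₂) * ‖y‖ ^ 2)) := by
    unfold heatKernel
    refine mul_le_mul ?_ ?_ (by positivity) (by positivity)
    · refine Real.rpow_le_rpow_of_nonpos (by positivity) ?_ ?_
      · have := hs.1; gcongr
      · simp only [Left.neg_nonpos_iff]; positivity
    · refine Real.exp_le_exp.2 ?_
      rw [neg_div, neg_le_neg_iff, one_div_mul_eq_div]
      have := hs.2
      gcongr
  calc heatKernel s y * (1 + ‖y‖) ^ M
      ≤ ((4 * Real.pi * s₁) ^ (-(Module.finrank ℝ E / 2 : ℝ))
        * Real.exp (-(1 / (4 * s₂) * ‖y‖ ^ 2))) * (C * Real.exp (1 / (4 * s₂) * ‖y‖ ^ 2)) := by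
        gcongr
        exact hCt _ (norm_nonneg _)
    _ = (4 * Real.pi * s₁) ^ (-(Module.finrank ℝ E / 2 : ℝ)) * C := by
        rw [Real.exp_neg]
        field_simp

/-- Parabolic scaling of the heat kernel. -/
theorem heatKernel_scale {r : ℝ} (hr : 0 < r) (w : E) :
    heatKernel (r ^ 2) (r • w) = (r ^ Module.finrank ℝ E)⁻¹ * heatKernel 1 w := by
  unfold heatKernel
  rw [norm_smul, mul_pow, Real.norm_eq_abs, sq_abs, Real.mul_rpow (by positivity) (by positivity)]
  have h1 : (r ^ 2) ^ (-(Module.finrank ℝ E / 2 : ℝ)) = (r ^ Module.finrank ℝ E)⁻¹ := by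
    rw [← Real.rpow_natCast r 2, ← Real.rpow_mul hr.le, ← Real.rpow_natCast r (Module.finrank ℝ E),
      ← Real.rpow_neg hr.le]
    congr 1
    push_cast
    ring
  have h2 : -(r ^ 2 * ‖w‖ ^ 2) / (4 * r ^ 2) = -‖w‖ ^ 2 / (4 * 1) := by
    field_simp
  rw [h1, h2]
  ring_nf

theorem exists_norm_heatKernel_smul_le {τ : ℝ} (hτ : 0 < τ) :
    ∃ C : ℝ, ∀ v : E, ‖(-(heatKernel τ v / (2 * τ))) • v‖ ≤ C := by
  obtain ⟨C, -, h⟩ := heatKernel_mul_pow_le (E := E) hτ τ 1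
  refine ⟨C / (2 * τ), fun v => ?_⟩
  rw [norm_smul, norm_neg,
    Real.norm_of_nonneg (div_nonneg (heatKernel_pos hτ _).le (by positivity)),
    div_mul_eq_mul_div]
  gcongr
  refine le_trans ?_ (h τ (by simp) v)
  have := (heatKernel_pos hτ v).le
  gcongr
  linarith

theorem continuous_heatKernel_smul (τ : ℝ) :
    Continuous fun v : E => (-(heatKernel τ v / (2 * τ))) • v := by
  have := continuous_heatKernel (E := E) τ
  fun_prop

variable [FiniteDimensional ℝ E] [MeasurableSpace E] [BorelSpace E]

theorem integrable_heatKernel {τ : ℝ} (hτ : 0 < τ) : Integrable (heatKernel τ : E → ℝ) := by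
  unfold heatKernel
  have := GaussianFourier.integrable_cexp_neg_mul_sq_norm_add (V := E) (b := (1 / (4 * τ) : ℝ))
    (by simpa using hτ) 0 0
  refine Integrable.const_mul ?_ _
  refine this.norm.congr (Eventually.of_forall fun y => ?_)
  simp only [Complex.norm_exp, zero_mul, add_zero]
  congr 1
  norm_cast
  ring

theorem integral_heatKernel {τ : ℝ} (hτ : 0 < τ) : ∫ y : E, heatKernel τ y = 1 := by
  have h := GaussianFourier.integral_rexp_neg_mul_sq_norm (V := E) (b := 1 / (4 * τ))
    (by positivity)
  have h2 : ∀ y : E, heatKernel τ y = (4 * Real.pi * τ) ^ (-(Module.finrank ℝ E / 2 : ℝ)) *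
      Real.exp (-(1 / (4 * τ)) * ‖y‖ ^ 2) := fun y => by
    unfold heatKernel; congr 2; ring
  simp_rw [h2]
  rw [integral_const_mul, h, Real.rpow_neg (by positivity)]
  rw [show Real.pi / (1 / (4 * τ)) = 4 * Real.pi * τ by field_simp]
  exact inv_mul_cancel₀ (by positivity)

theorem isProbabilityMeasure_heatKernel {τ : ℝ} (hτ : 0 < τ) :
    IsProbabilityMeasure ((volume : Measure E).withDensity
      fun x => ENNReal.ofReal (heatKernel τ x)) := by
  refine ⟨?_⟩
  rw [withDensity_apply _ MeasurableSet.univ, Measure.restrict_univ,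
    ← ofReal_integral_eq_lintegral_ofReal (integrable_heatKernel hτ)
      (Eventually.of_forall fun y => (heatKernel_pos hτ y).le), integral_heatKernel hτ,
    ENNReal.ofReal_one]

/-- The heat kernel at time `τ` is the density of `√(2τ) ξ` with `ξ` standard Gaussian. -/
theorem map_stdGaussian_eq_withDensity {τ : ℝ} (hτ : 0 < τ) :
    (stdGaussian E).map (fun ξ => √(2 * τ) • ξ)
      = (volume : Measure E).withDensity fun x => ENNReal.ofReal (heatKernel τ x) := by
  have := isProbabilityMeasure_heatKernel (E := E) hτ
  have : IsProbabilityMeasure ((stdGaussian E).map (fun ξ => √(2 * τ) • ξ)) :=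
    Measure.isProbabilityMeasure_map (by fun_prop)
  refine Measure.ext_of_charFun ?_
  ext t
  rw [charFun_map_smul, charFun_stdGaussian, charFun_apply,
    integral_withDensity_eq_integral_toReal_smul
      (continuous_heatKernel τ).measurable.ennreal_ofReal (by simp)]
  have h1 : ∀ x : E,
      (ENNReal.ofReal (heatKernel τ x)).toReal • Complex.exp (inner ℝ x t * Complex.I)
      = ((4 * Real.pi * τ) ^ (-(Module.finrank ℝ E / 2 : ℝ)) : ℝ) *
        Complex.exp (-((1 / (4 * τ) : ℝ) : ℂ) * ‖x‖ ^ 2 + Complex.I * inner ℝ t x) := fun x => by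
    rw [ENNReal.toReal_ofReal (heatKernel_pos hτ x).le, heatKernel, Complex.real_smul]
    push_cast
    rw [mul_assoc, ← Complex.exp_add, real_inner_comm]
    congr 2
    field_simp
  simp_rw [h1]
  rw [integral_const_mul, GaussianFourier.integral_cexp_neg_mul_sq_norm_add (by simpa using hτ)]
  have h2 : ((Real.pi : ℂ) / ((1 / (4 * τ) : ℝ) : ℂ)) ^ (Module.finrank ℝ E / 2 : ℂ)
      = ((4 * Real.pi * τ) ^ (Module.finrank ℝ E / 2 : ℝ) : ℝ) := by
    rw [Complex.ofReal_cpow (by positivity)]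
    push_cast
    congr 1
    field_simp
  rw [h2, ← mul_assoc, ← Complex.ofReal_mul, Real.rpow_neg (by positivity),
    inv_mul_cancel₀ (by positivity), Complex.ofReal_one, one_mul]
  congr 1
  rw [norm_smul, ← Complex.ofReal_pow, mul_pow, Real.norm_eq_abs, sq_abs,
    Real.sq_sqrt (by positivity), Complex.I_sq]
  push_cast
  have : (τ : ℂ) ≠ 0 := by exact_mod_cast hτ.ne'
  field_simp

theorem map_add_smul_stdGaussian {τ : ℝ} (hτ : 0 < τ) (m : E) :
    (stdGaussian E).map (fun ξ => m + √(2 * τ) • ξ)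
      = (volume : Measure E).withDensity fun x => ENNReal.ofReal (heatKernel τ (x - m)) := by
  have h1 : (fun ξ : E => m + √(2 * τ) • ξ) = (fun x => m + x) ∘ fun ξ : E => √(2 * τ) • ξ := rfl
  rw [h1, ← Measure.map_map (by fun_prop) (by fun_prop), map_stdGaussian_eq_withDensity hτ]
  ext A hA
  have hc := (continuous_heatKernel (E := E) τ)
  rw [Measure.map_apply (by fun_prop) hA, withDensity_apply _ hA,
    withDensity_apply _ (measurable_const_add m hA), ← lintegral_indicator hA,
    ← lintegral_indicator (measurable_const_add m hA),
    ← lintegral_add_left_eq_self (A.indicator _) m]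
  refine lintegral_congr fun x => ?_
  by_cases h : m + x ∈ A
  · rw [indicator_of_mem (show x ∈ (fun x => m + x) ⁻¹' A from h), indicator_of_mem h,
      add_sub_cancel_left]
  · rw [indicator_of_notMem (show x ∉ (fun x => m + x) ⁻¹' A from h), indicator_of_notMem h]

end

section

variable {E : Type*} [NormedAddCommGroup E] [InnerProductSpace ℝ E]
  [MeasurableSpace E] [BorelSpace E]

/-! ### Gaussian mixtures -/

/-- The density of the convolution of `ν` with the centred Gaussian law of covariance `2τ` times the
identity. -/
noncomputable def gaussMix (τ : ℝ) (ν : Measure E) (x : E) : ℝ :=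
  ∫ y, heatKernel τ (x - y) ∂ν

/-- The gradient of `gaussMix τ ν`. -/
noncomputable def gaussMixGrad (τ : ℝ) (ν : Measure E) (x : E) : E :=
  ∫ y, (-(heatKernel τ (x - y) / (2 * τ))) • (x - y) ∂ν

variable {τ : ℝ} {ν : Measure E}

theorem integrable_heatKernel_sub [IsFiniteMeasure ν] (hτ : 0 < τ) (x : E) :
    Integrable (fun y => heatKernel τ (x - y)) ν := by
  refine Integrable.of_bound
    ((continuous_heatKernel τ).comp (by fun_prop : Continuous fun y => x - y)).aestronglyMeasurable
    (heatKernel τ (0 : E)) (Eventually.of_forall fun y => ?_)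
  rw [Real.norm_of_nonneg (heatKernel_pos hτ _).le]
  exact heatKernel_le_zero hτ _

variable [FiniteDimensional ℝ E]

theorem integrable_heatKernel_smul_sub [IsFiniteMeasure ν] (hτ : 0 < τ) (x : E) :
    Integrable (fun y => (-(heatKernel τ (x - y) / (2 * τ))) • (x - y)) ν := by
  obtain ⟨C, hC⟩ := exists_norm_heatKernel_smul_le (E := E) hτ
  exact Integrable.of_bound ((continuous_heatKernel_smul τ).comp
    (by fun_prop : Continuous fun y => x - y)).aestronglyMeasurable C
    (Eventually.of_forall fun y => hC _)

theorem continuous_gaussMix [IsFiniteMeasure ν] (hτ : 0 < τ) : Continuous (gaussMix τ ν) := by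
  have hk := continuous_heatKernel (E := E) τ
  refine continuous_of_dominated (bound := fun _ => heatKernel τ (0 : E))
    (fun x => (integrable_heatKernel_sub hτ x).aestronglyMeasurable)
    (fun x => Eventually.of_forall fun y => ?_) (integrable_const _)
    (Eventually.of_forall fun y => by fun_prop)
  rw [Real.norm_of_nonneg (heatKernel_pos hτ _).le]
  exact heatKernel_le_zero hτ _

theorem continuous_gaussMixGrad [IsFiniteMeasure ν] (hτ : 0 < τ) :
    Continuous (gaussMixGrad τ ν) := by
  obtain ⟨C, hC⟩ := exists_norm_heatKernel_smul_le (E := E) hτ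
  exact continuous_of_dominated (bound := fun _ => C)
    (fun x => (integrable_heatKernel_smul_sub hτ x).aestronglyMeasurable)
    (fun x => Eventually.of_forall fun y => hC _) (integrable_const _)
    (Eventually.of_forall fun y => (continuous_heatKernel_smul τ).comp (by fun_prop))

theorem hasFDerivAt_gaussMix [IsFiniteMeasure ν] (hτ : 0 < τ) (x : E) :
    HasFDerivAt (gaussMix τ ν) (innerSL ℝ (gaussMixGrad τ ν x)) x := by
  obtain ⟨C, hC⟩ := exists_norm_heatKernel_smul_le (E := E) hτ
  have h := hasFDerivAt_integral_of_dominated_of_fderiv_le (μ := ν) (x₀ := x) (s := univ)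
    (F := fun x y => heatKernel τ (x - y))
    (F' := fun x y => innerSL ℝ ((-(heatKernel τ (x - y) / (2 * τ))) • (x - y)))
    (bound := fun _ => C) univ_mem
    (Eventually.of_forall fun x => (integrable_heatKernel_sub hτ x).aestronglyMeasurable)
    (integrable_heatKernel_sub hτ x)
    (((innerSL ℝ).integrable_comp (integrable_heatKernel_smul_sub hτ x)).aestronglyMeasurable)
    (Eventually.of_forall fun y z _ => by
      rw [innerSL_apply_norm]
      exact hC _)
    (integrable_const _)
    (Eventually.of_forall fun y z _ => by
      exact (hasFDerivAt_heatKernel hτ (z - y)).comp z ((hasFDerivAt_id z).sub_const y))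
  rw [(innerSL ℝ).integral_comp_comm (integrable_heatKernel_smul_sub hτ x)] at h
  exact h

theorem gaussMix_le [IsProbabilityMeasure ν] (hτ : 0 < τ) (x : E) :
    gaussMix τ ν x ≤ heatKernel τ (0 : E) := by
  have := integral_mono (integrable_heatKernel_sub (ν := ν) hτ x) (integrable_const _)
    (fun y => heatKernel_le_zero hτ (x - y))
  simpa [gaussMix] using this

/-- A Gaussian mixture is bounded below by a Gaussian, through the part of the mixing measure in a
ball that carries half of its mass. -/
theorem gaussMix_ge [IsProbabilityMeasure ν] (hτ : 0 < τ) {R : ℝ}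
    (hν : 1 / 2 ≤ ν.real (Metric.closedBall 0 R)) (x : E) :
    1 / 2 * (heatKernel τ (0 : E) * Real.exp (-(‖x‖ + R) ^ 2 / (4 * τ))) ≤ gaussMix τ ν x := by
  set c : ℝ := heatKernel τ (0 : E) * Real.exp (-(‖x‖ + R) ^ 2 / (4 * τ)) with hc
  have hc0 : 0 ≤ c := mul_nonneg (heatKernel_pos hτ _).le (Real.exp_pos _).le
  have h1 : ∫ y, (Metric.closedBall (0 : E) R).indicator (fun _ => c) y ∂ν ≤ gaussMix τ ν x := by
    refine integral_mono ((integrable_const _).indicator Metric.isClosed_closedBall.measurableSet)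
      (integrable_heatKernel_sub hτ x) fun y => ?_
    by_cases hy : y ∈ Metric.closedBall (0 : E) R
    · rw [indicator_of_mem hy, hc]
      simp only [heatKernel, norm_zero, ne_eq, OfNat.ofNat_ne_zero, not_false_eq_true, zero_pow,
        neg_zero, zero_div, Real.exp_zero, mul_one]
      rw [mem_closedBall_zero_iff] at hy
      have := (norm_sub_le x y).trans (add_le_add_right hy _)
      gcongr
    · rw [indicator_of_notMem hy]
      exact (heatKernel_pos hτ _).le
  rw [integral_indicator_const _ Metric.isClosed_closedBall.measurableSet, smul_eq_mul] at h1
  exact (mul_le_mul_of_nonneg_right hν hc0).trans h1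

theorem exists_half_le_measureReal_closedBall {E : Type*} [NormedAddCommGroup E]
    [MeasurableSpace E] (ν : Measure E) [IsProbabilityMeasure ν] :
    ∃ R : ℝ, 0 ≤ R ∧ 1 / 2 ≤ ν.real (Metric.closedBall 0 R) := by
  have h := tendsto_measure_iUnion_atTop (μ := ν)
    (s := fun n : ℕ => Metric.closedBall (0 : E) n)
    (fun m n hmn => Metric.closedBall_subset_closedBall (by exact_mod_cast hmn))
  rw [Metric.iUnion_closedBall_nat, measure_univ] at h
  have h2 := (ENNReal.tendsto_toReal ENNReal.one_ne_top).comp h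
  have h3 : ∀ᶠ n : ℕ in atTop, (1 / 2 : ℝ) < ν.real (Metric.closedBall (0 : E) n) := by
    refine h2.eventually (lt_mem_nhds ?_)
    norm_num
  obtain ⟨n, hn⟩ := h3.exists
  exact ⟨n, by positivity, hn.le⟩

theorem gaussMix_pos [IsProbabilityMeasure ν] (hτ : 0 < τ) (x : E) : 0 < gaussMix τ ν x := by
  obtain ⟨R, -, hR⟩ := exists_half_le_measureReal_closedBall ν
  refine lt_of_lt_of_le ?_ (gaussMix_ge hτ hR x)
  have := heatKernel_pos hτ (0 : E)
  positivity

/-- The logarithm of a Gaussian mixture grows at most quadratically; the constant depends on the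
mixing measure only through a radius that carries half of its mass. -/
theorem exists_abs_log_gaussMix_le {s₁ : ℝ} (hs₁ : 0 < s₁) (s₂ : ℝ) {R : ℝ} (hR0 : 0 ≤ R) :
    ∃ C : ℝ, 0 < C ∧ ∀ s ∈ Icc s₁ s₂, ∀ ν : Measure E, IsProbabilityMeasure ν →
      1 / 2 ≤ ν.real (Metric.closedBall 0 R) → ∀ x,
      |Real.log (gaussMix s ν x)| ≤ C * (1 + ‖x‖) ^ 2 := by
  have hcont : ContinuousOn (fun s : ℝ => Real.log (heatKernel s (0 : E))) (Icc s₁ s₂) := by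
    refine ContinuousOn.log ?_ fun s hs => (heatKernel_pos (hs₁.trans_le hs.1) _).ne'
    intro s hs
    have h := (hasDerivAt_heatKernel_line (0 : E) 0 (hs₁.trans_le hs.1)).continuousAt
    simp only [smul_zero, add_zero] at h
    exact h.continuousWithinAt
  obtain ⟨K, hK⟩ := isCompact_Icc.exists_bound_of_continuousOn hcont
  refine ⟨|K| + 1 + (1 + R) ^ 2 / (4 * s₁), by positivity, fun s hs ν _ hR x => ?_⟩
  have hs0 := hs₁.trans_le hs.1
  have hk := heatKernel_pos hs0 (0 : E)
  have hpos := gaussMix_pos (ν := ν) hs0 x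
  have hKs := (hK s hs).trans (le_abs_self K)
  rw [Real.norm_eq_abs, abs_le] at hKs
  have hx := norm_nonneg x
  have hx1 : 1 ≤ (1 + ‖x‖) ^ 2 := by nlinarith
  have hK1 : |K| ≤ |K| * (1 + ‖x‖) ^ 2 := le_mul_of_one_le_right (abs_nonneg _) hx1
  have hub : Real.log (gaussMix s ν x) ≤ |K| :=
    (Real.log_le_log hpos (gaussMix_le hs0 x)).trans hKs.2
  have hlb : -(1 + |K| + (1 + R) ^ 2 / (4 * s₁) * (1 + ‖x‖) ^ 2) ≤ Real.log (gaussMix s ν x) := by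
    refine le_trans ?_ (Real.log_le_log (by positivity) (gaussMix_ge hs0 hR x))
    rw [Real.log_mul (by norm_num) (by positivity), Real.log_mul hk.ne' (by positivity),
      Real.log_exp]
    have h2 : -1 ≤ Real.log (1 / 2) := by
      have := Real.one_sub_inv_le_log_of_pos (x := 1 / 2) (by norm_num)
      norm_num at this ⊢
      exact this
    have h3 : (‖x‖ + R) ^ 2 / (4 * s) ≤ (1 + R) ^ 2 / (4 * s₁) * (1 + ‖x‖) ^ 2 := by
      rw [div_mul_eq_mul_div, ← mul_pow]
      have := hs.1
      gcongr
      nlinarith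
    rw [neg_div]
    linarith [hKs.1]
  have h4 : 0 ≤ (1 + R) ^ 2 / (4 * s₁) * (1 + ‖x‖) ^ 2 := by positivity
  rw [abs_le]
  constructor <;> nlinarith

/-- The score `∇ log` of a Gaussian mixture grows at most linearly: only points at distance
`O(1 + |x|)` contribute to the posterior mean, because the density is at least of order
`exp(-(|x| + R)² / (4τ))`. -/
theorem exists_norm_gaussMixGrad_le (hτ : 0 < τ) (ν : Measure E) [IsProbabilityMeasure ν] :
    ∃ C : ℝ, 0 < C ∧ ∀ x, ‖gaussMixGrad τ ν x‖ ≤ C * (1 + ‖x‖) * gaussMix τ ν x := by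
  obtain ⟨R, hR0, hR⟩ := exists_half_le_measureReal_closedBall ν
  obtain ⟨C₁, hC₁, hC⟩ := pow_le_mul_exp_sq (b := 1 / (8 * τ)) (by positivity) 1
  refine ⟨(2 * τ)⁻¹ * (2 * (1 + R) + 2 * C₁), by positivity, fun x => ?_⟩
  set p := gaussMix τ ν x
  have hp : 0 < p := gaussMix_pos hτ x
  set k := heatKernel τ (0 : E)
  have hk : 0 < k := heatKernel_pos hτ _
  set e := Real.exp (-(‖x‖ + R) ^ 2 / (4 * τ)) with he
  have hlow : k * e ≤ 2 * p := by have := gaussMix_ge hτ hR x; linarith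
  have hx := norm_nonneg x
  have hpt : ∀ y, ‖(-(heatKernel τ (x - y) / (2 * τ))) • (x - y)‖
      ≤ (2 * τ)⁻¹ * (2 * (‖x‖ + R) * heatKernel τ (x - y) + C₁ * (k * e)) := fun y => by
    set v := x - y
    have hv := heatKernel_pos hτ v
    rw [norm_smul, norm_neg, Real.norm_of_nonneg (by positivity), div_eq_inv_mul, mul_assoc]
    gcongr
    -- Far from `x` half of the Gaussian exponent absorbs the factor `‖v‖`, and the other half is
    -- at most `e`.
    rcases le_or_gt ‖v‖ (2 * (‖x‖ + R)) with h | h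
    · have : 0 ≤ C₁ * (k * e) := by positivity
      nlinarith
    · have h1 : heatKernel τ v = k * Real.exp (-(‖v‖ ^ 2) / (4 * τ)) := by
        simp [heatKernel, k]
      have h2 : ‖v‖ ≤ C₁ * Real.exp (1 / (8 * τ) * ‖v‖ ^ 2) := by
        have := hC ‖v‖ (norm_nonneg _)
        linarith
      have h3 : Real.exp (-(‖v‖ ^ 2) / (4 * τ)) * Real.exp (1 / (8 * τ) * ‖v‖ ^ 2) ≤ e := by
        rw [← Real.exp_add, he, Real.exp_le_exp]
        have h4 : -(‖v‖ ^ 2) / (4 * τ) + 1 / (8 * τ) * ‖v‖ ^ 2 = -(‖v‖ ^ 2 / 2) / (4 * τ) := by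
          field_simp; ring
        rw [h4]
        gcongr
        nlinarith [add_nonneg hx hR0]
      have h5 : heatKernel τ v * ‖v‖ ≤ C₁ * (k * e) := by
        calc heatKernel τ v * ‖v‖
            ≤ (k * Real.exp (-(‖v‖ ^ 2) / (4 * τ))) * (C₁ * Real.exp (1 / (8 * τ) * ‖v‖ ^ 2)) := by
              rw [h1]; gcongr
          _ = C₁ * (k * (Real.exp (-(‖v‖ ^ 2) / (4 * τ)) * Real.exp (1 / (8 * τ) * ‖v‖ ^ 2))) := by
              ring
          _ ≤ _ := by gcongr
      have : 0 ≤ 2 * (‖x‖ + R) * heatKernel τ v := by positivity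
      linarith
  have hi := integrable_heatKernel_sub (ν := ν) hτ x
  calc ‖gaussMixGrad τ ν x‖
      ≤ ∫ y, (2 * τ)⁻¹ * (2 * (‖x‖ + R) * heatKernel τ (x - y) + C₁ * (k * e)) ∂ν :=
        norm_integral_le_of_norm_le (((hi.const_mul _).add (integrable_const _)).const_mul _)
          (Eventually.of_forall hpt)
    _ = (2 * τ)⁻¹ * (2 * (‖x‖ + R) * p + C₁ * (k * e)) := by
        rw [integral_const_mul, integral_add (hi.const_mul _) (integrable_const _),
          integral_const_mul]
        simp [p, gaussMix]
    _ ≤ (2 * τ)⁻¹ * (2 * ((1 + R) * (1 + ‖x‖)) * p + C₁ * (2 * p) * (1 + ‖x‖)) := by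
        have h1 : C₁ * (k * e) ≤ C₁ * (2 * p) * (1 + ‖x‖) := by
          calc C₁ * (k * e) ≤ C₁ * (2 * p) := by gcongr
            _ ≤ _ := le_mul_of_one_le_right (by positivity) (by linarith)
        gcongr
        nlinarith
    _ = _ := by ring

end

section

variable {E : Type*} [NormedAddCommGroup E] [InnerProductSpace ℝ E]

/-! ### One Euler step from a general initial law -/

/-- A continuous vector field of at most linear growth. -/
structure DriftGrowth (g : E → E) (K : ℝ) : Prop where
  cont : Continuous g
  bound : ∀ x, ‖g x‖ ≤ K * (1 + ‖x‖)

/-- The density at `x` of `z - s g(z) + √(2s) ξ` with `ξ` standard Gaussian. -/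
noncomputable def eulerKernel (g : E → E) (s : ℝ) (z x : E) : ℝ :=
  heatKernel s (x - (z - s • g z))

/-- The derivative of `eulerKernel` in the step size `s`. -/
noncomputable def eulerKernelDeriv (g : E → E) (s : ℝ) (z x : E) : ℝ :=
  eulerKernel g s z x * (‖x - (z - s • g z)‖ ^ 2 / (4 * s ^ 2) - Module.finrank ℝ E / (2 * s)
    - inner ℝ (x - (z - s • g z)) (g z) / (2 * s))

variable {g : E → E} {K : ℝ} {s : ℝ}

theorem DriftGrowth.nonneg (hg : DriftGrowth g K) : 0 ≤ K := by
  have := (norm_nonneg _).trans (hg.bound 0)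
  simpa using this

theorem eulerKernel_pos (hs : 0 < s) (z x : E) : 0 < eulerKernel g s z x := heatKernel_pos hs _

theorem continuous_eulerKernel (hg : DriftGrowth g K) (s : ℝ) :
    Continuous fun w : E × E => eulerKernel g s w.1 w.2 := by
  have := continuous_heatKernel (E := E) s
  have := hg.cont
  unfold eulerKernel
  fun_prop

theorem continuous_eulerKernelDeriv (hg : DriftGrowth g K) (s : ℝ) :
    Continuous fun w : E × E => eulerKernelDeriv g s w.1 w.2 := by
  have := continuous_eulerKernel hg s
  have := hg.cont
  unfold eulerKernelDeriv
  fun_prop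

theorem hasDerivAt_eulerKernel (hs : 0 < s) (z x : E) :
    HasDerivAt (fun s => eulerKernel g s z x) (eulerKernelDeriv g s z x) s := by
  have h := hasDerivAt_heatKernel_line (x - z) (g z) hs
  have e : ∀ r : ℝ, x - (z - r • g z) = x - z + r • g z := fun r => by abel
  simpa only [eulerKernel, eulerKernelDeriv, e] using h

theorem DriftGrowth.one_add_norm_step_le (hg : DriftGrowth g K) {s s₂ : ℝ} (hs : 0 ≤ s)
    (hs₂ : s ≤ s₂) (z v : E) :
    1 + ‖z - s • g z + v‖ ≤ (1 + s₂ * K) * ((1 + ‖z‖) * (1 + ‖v‖)) := by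
  have hK := hg.nonneg
  have h1 : ‖s • g z‖ ≤ s₂ * (K * (1 + ‖z‖)) := by
    rw [norm_smul, Real.norm_of_nonneg hs]
    exact mul_le_mul hs₂ (hg.bound z) (norm_nonneg _) (hs.trans hs₂)
  have h2 : ‖z - s • g z + v‖ ≤ ‖z‖ + ‖s • g z‖ + ‖v‖ :=
    (norm_add_le _ _).trans (add_le_add_left (norm_sub_le _ _) _)
  have h3 : 0 ≤ s₂ * K * ((1 + ‖z‖) * ‖v‖) := by
    have := hs.trans hs₂
    positivity
  nlinarith [mul_nonneg (norm_nonneg z) (norm_nonneg v)]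

theorem DriftGrowth.one_add_norm_displacement_le (hg : DriftGrowth g K) {s s₂ : ℝ} (hs : 0 ≤ s)
    (hs₂ : s ≤ s₂) (z x : E) :
    1 + ‖x - (z - s • g z)‖ ≤ (1 + s₂ * K) * ((1 + ‖z‖) * (1 + ‖x‖)) := by
  have := hg.one_add_norm_step_le hs hs₂ z (-x)
  rwa [norm_neg, ← sub_eq_add_neg, norm_sub_rev] at this

/-- Powers of the arrival point are controlled by powers of the starting point, uniformly for times
in a compact subset of `(0, ∞)`. -/
theorem exists_eulerKernel_mul_pow_le (hg : DriftGrowth g K) {s₁ : ℝ} (hs₁ : 0 < s₁) (s₂ : ℝ)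
    (M : ℕ) : ∃ C : ℝ, 0 < C ∧ ∀ s ∈ Icc s₁ s₂, ∀ z x : E,
      eulerKernel g s z x * (1 + ‖x‖) ^ M ≤ C * (1 + ‖z‖) ^ M := by
  rcases lt_or_ge s₂ s₁ with h | h
  · exact ⟨1, one_pos, fun s hs => absurd (hs.1.trans hs.2) h.not_ge⟩
  obtain ⟨C, hC, hCs⟩ := heatKernel_mul_pow_le (E := E) hs₁ s₂ M
  have hK := hg.nonneg
  have hs₂ : 0 < s₂ := hs₁.trans_le h
  refine ⟨C * (1 + s₂ * K) ^ M, by positivity, fun s hs z x => ?_⟩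
  have hs0 := hs₁.trans_le hs.1
  have hk := eulerKernel_pos (g := g) hs0 z x
  have h1 := hg.one_add_norm_step_le hs0.le hs.2 z (x - (z - s • g z))
  rw [add_sub_cancel] at h1
  calc eulerKernel g s z x * (1 + ‖x‖) ^ M
      ≤ eulerKernel g s z x * ((1 + s₂ * K) * ((1 + ‖z‖) * (1 + ‖x - (z - s • g z)‖))) ^ M := by
        gcongr
    _ = (heatKernel s (x - (z - s • g z)) * (1 + ‖x - (z - s • g z)‖) ^ M) *
          ((1 + s₂ * K) ^ M * (1 + ‖z‖) ^ M) := by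
        rw [eulerKernel, mul_pow, mul_pow]; ring
    _ ≤ C * ((1 + s₂ * K) ^ M * (1 + ‖z‖) ^ M) := by
        gcongr
        exact hCs s hs _
    _ = _ := by ring

theorem exists_eulerKernelDeriv_mul_pow_le (hg : DriftGrowth g K) {s₁ : ℝ} (hs₁ : 0 < s₁)
    (s₂ : ℝ) (M : ℕ) : ∃ C : ℝ, 0 < C ∧ ∀ s ∈ Icc s₁ s₂, ∀ z x : E,
      |eulerKernelDeriv g s z x| * (1 + ‖x‖) ^ M ≤ C * (1 + ‖z‖) ^ (M + 5) := by
  rcases lt_or_ge s₂ s₁ with h | h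
  · exact ⟨1, one_pos, fun s hs => absurd (hs.1.trans hs.2) h.not_ge⟩
  obtain ⟨C, hC, hCs⟩ := exists_eulerKernel_mul_pow_le hg hs₁ s₂ (M + 2)
  have hK := hg.nonneg
  have hs₂ : 0 < s₂ := hs₁.trans_le h
  set D : ℝ := (Module.finrank ℝ E : ℝ) with hD
  set B : ℝ := 1 / (4 * s₁ ^ 2) + D / (2 * s₁) + K / (2 * s₁) with hB
  set A : ℝ := (1 + s₂ * K) ^ 2 * B with hA
  have hD0 : 0 ≤ D := by positivity
  refine ⟨C * A, by positivity, fun s hs z x => ?_⟩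
  have hs0 := hs₁.trans_le hs.1
  have hk := eulerKernel_pos (g := g) hs0 z x
  set y := x - (z - s • g z) with hy
  -- The logarithmic time derivative of the kernel is polynomial in the starting and arrival points.
  have hfac : |‖y‖ ^ 2 / (4 * s ^ 2) - D / (2 * s) - inner ℝ y (g z) / (2 * s)|
      ≤ A * ((1 + ‖z‖) ^ 3 * (1 + ‖x‖) ^ 2) := by
    have h1 : |inner ℝ y (g z)| ≤ (1 + ‖y‖) ^ 2 * (K * (1 + ‖z‖)) := by
      refine (abs_real_inner_le_norm _ _).trans ?_
      refine mul_le_mul ?_ (hg.bound z) (norm_nonneg _) (by positivity)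
      nlinarith [norm_nonneg y]
    have hz : 1 ≤ 1 + ‖z‖ := by linarith [norm_nonneg z]
    have hy1 : 1 ≤ (1 + ‖y‖) ^ 2 := one_le_pow₀ (by linarith [norm_nonneg y])
    have h2 : ‖y‖ ^ 2 / (4 * s ^ 2) ≤ 1 / (4 * s₁ ^ 2) * ((1 + ‖y‖) ^ 2 * (1 + ‖z‖)) := by
      rw [one_div_mul_eq_div]
      have := hs.1
      gcongr
      calc ‖y‖ ^ 2 ≤ (1 + ‖y‖) ^ 2 := by gcongr; linarith
        _ ≤ _ := le_mul_of_one_le_right (by positivity) hz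
    have h3 : D / (2 * s) ≤ D / (2 * s₁) * ((1 + ‖y‖) ^ 2 * (1 + ‖z‖)) := by
      have := hs.1
      calc D / (2 * s) ≤ D / (2 * s₁) := by gcongr
        _ ≤ _ := le_mul_of_one_le_right (by positivity) (one_le_mul_of_one_le_of_one_le hy1 hz)
    have h4 : |inner ℝ y (g z) / (2 * s)| ≤ K / (2 * s₁) * ((1 + ‖y‖) ^ 2 * (1 + ‖z‖)) := by
      rw [abs_div, abs_of_pos (by positivity : 0 < 2 * s)]
      have := hs.1
      calc |inner ℝ y (g z)| / (2 * s) ≤ ((1 + ‖y‖) ^ 2 * (K * (1 + ‖z‖))) / (2 * s₁) := by gcongr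
        _ = _ := by ring
    have h5 : |‖y‖ ^ 2 / (4 * s ^ 2) - D / (2 * s) - inner ℝ y (g z) / (2 * s)|
        ≤ B * ((1 + ‖y‖) ^ 2 * (1 + ‖z‖)) := by
      have h6 : 0 ≤ ‖y‖ ^ 2 / (4 * s ^ 2) := by positivity
      have h7 : 0 ≤ D / (2 * s) := by positivity
      rw [abs_le] at h4 ⊢
      constructor <;> rw [hB] <;> nlinarith [h4.1, h4.2]
    refine h5.trans ?_
    have h8 := hg.one_add_norm_displacement_le hs0.le hs.2 z x
    rw [← hy] at h8
    calc B * ((1 + ‖y‖) ^ 2 * (1 + ‖z‖))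
        ≤ B * (((1 + s₂ * K) * ((1 + ‖z‖) * (1 + ‖x‖))) ^ 2 * (1 + ‖z‖)) := by gcongr
      _ = _ := by rw [hA]; ring
  rw [eulerKernelDeriv, abs_mul, abs_of_pos hk]
  calc eulerKernel g s z x * |‖y‖ ^ 2 / (4 * s ^ 2) - D / (2 * s) - inner ℝ y (g z) / (2 * s)|
        * (1 + ‖x‖) ^ M
      ≤ eulerKernel g s z x * (A * ((1 + ‖z‖) ^ 3 * (1 + ‖x‖) ^ 2)) * (1 + ‖x‖) ^ M := by gcongr
    _ = (eulerKernel g s z x * (1 + ‖x‖) ^ (M + 2)) * (A * (1 + ‖z‖) ^ 3) := by ring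
    _ ≤ (C * (1 + ‖z‖) ^ (M + 2)) * (A * (1 + ‖z‖) ^ 3) := by
        exact mul_le_mul_of_nonneg_right (hCs s hs z x) (by positivity)
    _ = _ := by ring

variable [FiniteDimensional ℝ E] [MeasurableSpace E] [BorelSpace E] {μ : Measure E}

theorem integrable_inv_one_add_norm_pow :
    Integrable (fun x : E => ((1 + ‖x‖) ^ (Module.finrank ℝ E + 1))⁻¹) := by
  refine (integrable_one_add_norm (E := E) (μ := volume) (r := (Module.finrank ℝ E + 1 : ℕ))
    (by push_cast; linarith)).congr (Eventually.of_forall fun x => ?_)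
  simp only
  rw [Real.rpow_neg (by positivity), Real.rpow_natCast]

/-- Functions of polynomial growth are integrable against one Euler step from a law with finite
moments. -/
theorem integrable_eulerKernel_smul {F : Type*} [NormedAddCommGroup F] [NormedSpace ℝ F]
    (hg : DriftGrowth g K) [SFinite μ] (hμ : ∀ M : ℕ, Integrable (fun z => (1 + ‖z‖) ^ M) μ)
    (hs : 0 < s) {Φ : E × E → F} (hΦ : AEStronglyMeasurable Φ (μ.prod volume)) {C : ℝ} {N : ℕ}
    (hC : ∀ z x, ‖Φ (z, x)‖ ≤ C * ((1 + ‖z‖) ^ N * (1 + ‖x‖) ^ N)) :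
    Integrable (fun w : E × E => eulerKernel g s w.1 w.2 • Φ w) (μ.prod volume) := by
  set D := Module.finrank ℝ E
  obtain ⟨C₁, hC₁, h⟩ := exists_eulerKernel_mul_pow_le hg hs s (N + (D + 1))
  have hdom := ((hμ (N + (N + (D + 1)))).mul_prod
    (integrable_inv_one_add_norm_pow (E := E))).const_mul (C * C₁)
  refine hdom.mono' ((continuous_eulerKernel hg s).aestronglyMeasurable.smul hΦ)
    (Eventually.of_forall fun w => ?_)
  obtain ⟨z, x⟩ := w
  have hk := eulerKernel_pos (g := g) hs z x
  have hC0 : 0 ≤ C := by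
    have := (norm_nonneg _).trans (hC 0 0)
    simpa using this
  rw [norm_smul, Real.norm_of_nonneg hk.le]
  simp only
  calc eulerKernel g s z x * ‖Φ (z, x)‖
      ≤ eulerKernel g s z x * (C * ((1 + ‖z‖) ^ N * (1 + ‖x‖) ^ N)) := by gcongr; exact hC z x
    _ = C * (1 + ‖z‖) ^ N * ((eulerKernel g s z x * (1 + ‖x‖) ^ (N + (D + 1)))
          * ((1 + ‖x‖) ^ (D + 1))⁻¹) := by
        rw [pow_add]; field_simp
    _ ≤ C * (1 + ‖z‖) ^ N * ((C₁ * (1 + ‖z‖) ^ (N + (D + 1))) * ((1 + ‖x‖) ^ (D + 1))⁻¹) := by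
        refine mul_le_mul_of_nonneg_left (mul_le_mul_of_nonneg_right (h s (by simp) z x)
          (by positivity)) (by positivity)
    _ = _ := by ring

/-- The joint law of the starting point and the result of one Euler step. -/
theorem map_euler_eq_withDensity (hg : DriftGrowth g K) [SFinite μ] (hs : 0 < s) :
    (μ.prod (stdGaussian E)).map (fun w : E × E => (w.1, w.1 - s • g w.1 + √(2 * s) • w.2))
      = (μ.prod volume).withDensity
          fun w : E × E => ENNReal.ofReal (eulerKernel g s w.1 w.2) := by
  have hgc := hg.cont
  have hK := (continuous_eulerKernel hg s)
  have hm : Measurable (fun w : E × E => (w.1, w.1 - s • g w.1 + √(2 * s) • w.2)) :=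
    Continuous.measurable (by fun_prop)
  have hKm : Measurable (fun w : E × E => ENNReal.ofReal (eulerKernel g s w.1 w.2)) :=
    hK.measurable.ennreal_ofReal
  ext A hA
  rw [Measure.map_apply hm hA, Measure.prod_apply (hm hA), withDensity_apply _ hA,
    ← lintegral_indicator hA, lintegral_prod _ (hKm.indicator hA).aemeasurable]
  refine lintegral_congr fun z => ?_
  have h1 : Prod.mk z ⁻¹' ((fun w : E × E => (w.1, w.1 - s • g w.1 + √(2 * s) • w.2)) ⁻¹' A)
      = (fun ξ => (z - s • g z) + √(2 * s) • ξ) ⁻¹' (Prod.mk z ⁻¹' A) := rfl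
  have hA' : MeasurableSet (Prod.mk z ⁻¹' A) := measurable_prodMk_left hA
  rw [h1, ← Measure.map_apply (by fun_prop) hA', map_add_smul_stdGaussian hs,
    withDensity_apply _ hA', ← lintegral_indicator hA']
  rfl

theorem integrable_euler_iff {F : Type*} [NormedAddCommGroup F] [NormedSpace ℝ F]
    (hg : DriftGrowth g K) [SFinite μ] (hs : 0 < s) {Φ : E × E → F} (hΦ : Continuous Φ) :
    Integrable (fun w : E × E => Φ (w.1, w.1 - s • g w.1 + √(2 * s) • w.2))
        (μ.prod (stdGaussian E))
      ↔ Integrable (fun w : E × E => eulerKernel g s w.1 w.2 • Φ w) (μ.prod volume) := by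
  have hgc := hg.cont
  have hK := (continuous_eulerKernel hg s)
  have hm : Measurable (fun w : E × E => (w.1, w.1 - s • g w.1 + √(2 * s) • w.2)) :=
    Continuous.measurable (by fun_prop)
  have h1 := integrable_map_measure (μ := μ.prod (stdGaussian E)) (f := fun w : E × E =>
    (w.1, w.1 - s • g w.1 + √(2 * s) • w.2)) (g := Φ) hΦ.aestronglyMeasurable hm.aemeasurable
  rw [map_euler_eq_withDensity hg hs] at h1
  rw [show (fun w : E × E => Φ (w.1, w.1 - s • g w.1 + √(2 * s) • w.2))
    = Φ ∘ fun w : E × E => (w.1, w.1 - s • g w.1 + √(2 * s) • w.2) from rfl, ← h1,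
    integrable_withDensity_iff_integrable_smul' hK.measurable.ennreal_ofReal (by simp)]
  simp only [ENNReal.toReal_ofReal (eulerKernel_pos (g := g) hs _ _).le]

theorem integral_euler {F : Type*} [NormedAddCommGroup F] [NormedSpace ℝ F]
    (hg : DriftGrowth g K) [SFinite μ] (hs : 0 < s) {Φ : E × E → F} (hΦ : Continuous Φ) :
    ∫ w, Φ (w.1, w.1 - s • g w.1 + √(2 * s) • w.2) ∂(μ.prod (stdGaussian E))
      = ∫ w, eulerKernel g s w.1 w.2 • Φ w ∂(μ.prod volume) := by
  have hgc := hg.cont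
  have hK := (continuous_eulerKernel hg s)
  have hm : Measurable (fun w : E × E => (w.1, w.1 - s • g w.1 + √(2 * s) • w.2)) :=
    Continuous.measurable (by fun_prop)
  rw [← integral_map (f := Φ) hm.aemeasurable hΦ.aestronglyMeasurable,
    map_euler_eq_withDensity hg hs,
    integral_withDensity_eq_integral_toReal_smul hK.measurable.ennreal_ofReal (by simp)]
  simp only [ENNReal.toReal_ofReal (eulerKernel_pos (g := g) hs _ _).le]

end

section

variable {E : Type*} [NormedAddCommGroup E] [InnerProductSpace ℝ E] [FiniteDimensional ℝ E]
  [MeasurableSpace E] [BorelSpace E] {g : E → E} {K s : ℝ} {μ : Measure E}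

/-! ### The density after one Euler step -/

/-- The density of `X - s g(X) + √(2s) ξ`, where `X` has law `μ` and `ξ` is an independent standard
Gaussian vector. -/
noncomputable def eulerDensity (g : E → E) (μ : Measure E) (s : ℝ) (x : E) : ℝ :=
  ∫ z, eulerKernel g s z x ∂μ

/-- The gradient of `eulerDensity`. -/
noncomputable def eulerGrad (g : E → E) (μ : Measure E) (s : ℝ) (x : E) : E :=
  ∫ z, (-(eulerKernel g s z x / (2 * s))) • (x - (z - s • g z)) ∂μ

/-- The conditional expectation of `g(X)` given `X - s g(X) + √(2s) ξ = x`, times the density at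
`x`. -/
noncomputable def eulerFlux (g : E → E) (μ : Measure E) (s : ℝ) (x : E) : E :=
  ∫ z, eulerKernel g s z x • g z ∂μ

/-- The derivative of `eulerDensity` in the step size `s`. -/
noncomputable def eulerDensityDeriv (g : E → E) (μ : Measure E) (s : ℝ) (x : E) : ℝ :=
  ∫ z, eulerKernelDeriv g s z x ∂μ

theorem eulerDensity_eq_gaussMix (hg : DriftGrowth g K) (s : ℝ) :
    eulerDensity g μ s = gaussMix s (μ.map fun z => z - s • g z) := by
  have hgc := hg.cont
  have hk := continuous_heatKernel (E := E) s
  ext x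
  rw [gaussMix, integral_map (Continuous.aemeasurable (by fun_prop))
    (Continuous.aestronglyMeasurable (by fun_prop))]
  rfl

theorem eulerGrad_eq_gaussMixGrad (hg : DriftGrowth g K) (s : ℝ) :
    eulerGrad g μ s = gaussMixGrad s (μ.map fun z => z - s • g z) := by
  have hgc := hg.cont
  have hk := continuous_heatKernel (E := E) s
  ext x
  rw [gaussMixGrad, integral_map (Continuous.aemeasurable (by fun_prop))
    (Continuous.aestronglyMeasurable (by fun_prop))]
  rfl

theorem isProbabilityMeasure_map_step (hg : DriftGrowth g K) (μ : Measure E)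
    [IsProbabilityMeasure μ] (s : ℝ) : IsProbabilityMeasure (μ.map fun z => z - s • g z) := by
  have hgc := hg.cont
  exact Measure.isProbabilityMeasure_map (Continuous.aemeasurable (by fun_prop))

section fixedTime

variable [IsProbabilityMeasure μ] (hg : DriftGrowth g K) (hs : 0 < s)
include hg hs

theorem eulerDensity_pos (x : E) : 0 < eulerDensity g μ s x := by
  have := isProbabilityMeasure_map_step hg μ s
  rw [eulerDensity_eq_gaussMix hg]
  exact gaussMix_pos hs x

theorem continuous_eulerDensity : Continuous (eulerDensity g μ s) := by
  have := isProbabilityMeasure_map_step hg μ s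
  rw [eulerDensity_eq_gaussMix hg]
  exact continuous_gaussMix hs

theorem continuous_eulerGrad : Continuous (eulerGrad g μ s) := by
  have := isProbabilityMeasure_map_step hg μ s
  rw [eulerGrad_eq_gaussMixGrad hg]
  exact continuous_gaussMixGrad hs

theorem hasFDerivAt_eulerDensity (x : E) :
    HasFDerivAt (eulerDensity g μ s) (innerSL ℝ (eulerGrad g μ s x)) x := by
  have := isProbabilityMeasure_map_step hg μ s
  rw [eulerDensity_eq_gaussMix hg, eulerGrad_eq_gaussMixGrad hg]
  exact hasFDerivAt_gaussMix hs x

theorem exists_norm_eulerGrad_le :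
    ∃ C : ℝ, 0 < C ∧ ∀ x, ‖eulerGrad g μ s x‖ ≤ C * (1 + ‖x‖) * eulerDensity g μ s x := by
  have := isProbabilityMeasure_map_step hg μ s
  rw [eulerDensity_eq_gaussMix hg, eulerGrad_eq_gaussMixGrad hg]
  exact exists_norm_gaussMixGrad_le hs _

theorem integrable_eulerKernel (x : E) : Integrable (fun z => eulerKernel g s z x) μ := by
  refine Integrable.of_bound ((continuous_eulerKernel hg s).comp
    (by fun_prop : Continuous fun z => (z, x))).aestronglyMeasurable
    (heatKernel s (0 : E)) (Eventually.of_forall fun y => ?_)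
  exact (Real.norm_of_nonneg (eulerKernel_pos (g := g) hs y x).le).le.trans
    (heatKernel_le_zero hs _)

theorem integrable_eulerKernel_smul_displacement (x : E) :
    Integrable (fun z => (-(eulerKernel g s z x / (2 * s))) • (x - (z - s • g z))) μ := by
  obtain ⟨C, hC⟩ := exists_norm_heatKernel_smul_le (E := E) hs
  have hgc := hg.cont
  exact Integrable.of_bound ((continuous_heatKernel_smul s).comp
    (by fun_prop : Continuous fun z => x - (z - s • g z))).aestronglyMeasurable C
    (Eventually.of_forall fun y => hC _)

end fixedTime

/-- The logarithm of the density grows at most quadratically, uniformly for times in a compact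
subset of `(0, ∞)`: one ball carries half of the mass of all the laws of `X - s g(X)`. -/
theorem exists_abs_log_eulerDensity_le [IsProbabilityMeasure μ] (hg : DriftGrowth g K) {s₁ : ℝ}
    (hs₁ : 0 < s₁) (s₂ : ℝ) :
    ∃ C : ℝ, 0 < C ∧ ∀ s ∈ Icc s₁ s₂, ∀ x,
      |Real.log (eulerDensity g μ s x)| ≤ C * (1 + ‖x‖) ^ 2 := by
  rcases lt_or_ge s₂ s₁ with h | h
  · exact ⟨1, one_pos, fun s hs => absurd (hs.1.trans hs.2) h.not_ge⟩
  have hs₂ : 0 < s₂ := hs₁.trans_le h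
  have hK := hg.nonneg
  obtain ⟨R, hR0, hR⟩ := exists_half_le_measureReal_closedBall μ
  obtain ⟨C, hC, hlog⟩ := exists_abs_log_gaussMix_le (E := E) hs₁ s₂
    (R := (1 + s₂ * K) * (1 + R)) (by positivity)
  refine ⟨C, hC, fun s hs x => ?_⟩
  have hgc := hg.cont
  rw [eulerDensity_eq_gaussMix hg]
  refine hlog s hs _ (isProbabilityMeasure_map_step hg μ s) (hR.trans ?_) x
  rw [map_measureReal_apply (Continuous.measurable (by fun_prop))
    Metric.isClosed_closedBall.measurableSet]
  refine measureReal_mono fun z hz => ?_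
  rw [mem_closedBall_zero_iff] at hz
  rw [mem_preimage, mem_closedBall_zero_iff]
  have h1 := hg.one_add_norm_step_le (hs₁.le.trans hs.1) hs.2 z 0
  simp only [add_zero, norm_zero, mul_one] at h1
  have h2 : (1 + s₂ * K) * (1 + ‖z‖) ≤ (1 + s₂ * K) * (1 + R) := by gcongr
  linarith

section moments

variable (hg : DriftGrowth g K) (hμ : ∀ M : ℕ, Integrable (fun z => (1 + ‖z‖) ^ M) μ)
include hg hμ

theorem integrable_drift : Integrable g μ := by
  refine ((hμ 1).const_mul K).mono' hg.cont.aestronglyMeasurable (Eventually.of_forall fun z => ?_)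
  simpa using hg.bound z

theorem integrable_eulerKernel_smul_drift [IsProbabilityMeasure μ] (hs : 0 < s) (x : E) :
    Integrable (fun z => eulerKernel g s z x • g z) μ := by
  refine (integrable_drift hg hμ).bdd_smul (heatKernel s (0 : E))
    (integrable_eulerKernel hg hs x).aestronglyMeasurable (Eventually.of_forall fun z => ?_)
  rw [Real.norm_of_nonneg (eulerKernel_pos hs _ _).le]
  exact heatKernel_le_zero hs _

theorem exists_eulerDensity_mul_pow_le {s₁ : ℝ} (hs₁ : 0 < s₁) (s₂ : ℝ) (M : ℕ) :
    ∃ C : ℝ, ∀ s ∈ Icc s₁ s₂, ∀ x, |eulerDensity g μ s x| * (1 + ‖x‖) ^ M ≤ C := by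
  obtain ⟨C, hC, h⟩ := exists_eulerKernel_mul_pow_le hg hs₁ s₂ M
  refine ⟨∫ z, C * (1 + ‖z‖) ^ M ∂μ, fun s hs x => ?_⟩
  rw [← abs_of_nonneg (by positivity : 0 ≤ (1 + ‖x‖) ^ M), ← abs_mul, eulerDensity,
    ← integral_mul_const, ← Real.norm_eq_abs]
  refine norm_integral_le_of_norm_le ((hμ M).const_mul C) (Eventually.of_forall fun z => ?_)
  rw [Real.norm_of_nonneg (mul_nonneg (eulerKernel_pos (hs₁.trans_le hs.1) _ _).le (by positivity))]
  exact h s hs z x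

theorem integrable_eulerKernelDeriv (hs : 0 < s) (x : E) :
    Integrable (fun z => eulerKernelDeriv g s z x) μ := by
  obtain ⟨C, hC, h⟩ := exists_eulerKernelDeriv_mul_pow_le hg hs s 0
  refine ((hμ 5).const_mul C).mono' ((continuous_eulerKernelDeriv hg s).comp
    (by fun_prop : Continuous fun z => (z, x))).aestronglyMeasurable
    (Eventually.of_forall fun z => ?_)
  simpa using h s (by simp) z x

theorem exists_eulerDensityDeriv_mul_pow_le {s₁ : ℝ} (hs₁ : 0 < s₁) (s₂ : ℝ) (M : ℕ) :
    ∃ C : ℝ, ∀ s ∈ Icc s₁ s₂, ∀ x, |eulerDensityDeriv g μ s x| * (1 + ‖x‖) ^ M ≤ C := by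
  obtain ⟨C, hC, h⟩ := exists_eulerKernelDeriv_mul_pow_le hg hs₁ s₂ M
  refine ⟨∫ z, C * (1 + ‖z‖) ^ (M + 5) ∂μ, fun s hs x => ?_⟩
  rw [← abs_of_nonneg (by positivity : 0 ≤ (1 + ‖x‖) ^ M), ← abs_mul, eulerDensityDeriv,
    ← integral_mul_const, ← Real.norm_eq_abs]
  refine norm_integral_le_of_norm_le ((hμ _).const_mul C) (Eventually.of_forall fun z => ?_)
  rw [Real.norm_eq_abs, abs_mul, abs_of_nonneg (by positivity : 0 ≤ (1 + ‖x‖) ^ M)]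
  exact h s hs z x

theorem hasDerivAt_eulerDensity [IsFiniteMeasure μ] (hs : 0 < s) (x : E) :
    HasDerivAt (fun s => eulerDensity g μ s x) (eulerDensityDeriv g μ s x) s := by
  obtain ⟨C, hC, h⟩ := exists_eulerKernelDeriv_mul_pow_le hg (half_pos hs) (2 * s) 0
  have hmeas : ∀ s, AEStronglyMeasurable (fun z => eulerKernel g s z x) μ := fun s =>
    ((continuous_eulerKernel hg s).comp
      (by fun_prop : Continuous fun z => (z, x))).aestronglyMeasurable
  refine (hasDerivAt_integral_of_dominated_loc_of_deriv_le (s := Ioo (s / 2) (2 * s))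
    (F := fun s z => eulerKernel g s z x)
    (Ioo_mem_nhds (by linarith) (by linarith)) (Eventually.of_forall hmeas) ?_
    (integrable_eulerKernelDeriv hg hμ hs x).aestronglyMeasurable
    (bound := fun z => C * (1 + ‖z‖) ^ 5)
    (Eventually.of_forall fun z r hr => ?_) ((hμ 5).const_mul C)
    (Eventually.of_forall fun z r hr => hasDerivAt_eulerKernel (by linarith [hr.1]) z x)).2
  · refine Integrable.of_bound (hmeas s) (heatKernel s (0 : E)) (Eventually.of_forall fun y => ?_)
    exact (Real.norm_of_nonneg (eulerKernel_pos (g := g) hs y x).le).le.trans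
      (heatKernel_le_zero hs _)
  · simpa using h r (Ioo_subset_Icc_self hr) z x

theorem integrable_eulerDensity_mul [IsProbabilityMeasure μ] (hs : 0 < s) {φ : E → ℝ}
    (hφ : AEStronglyMeasurable φ) {C : ℝ} {N : ℕ} (hC : ∀ x, |φ x| ≤ C * (1 + ‖x‖) ^ N) :
    Integrable (fun x => eulerDensity g μ s x * φ x) := by
  set D := Module.finrank ℝ E
  obtain ⟨C₁, h⟩ := exists_eulerDensity_mul_pow_le hg hμ hs s (N + (D + 1))
  refine ((integrable_inv_one_add_norm_pow (E := E)).const_mul (C * C₁)).mono'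
    ((continuous_eulerDensity hg hs).aestronglyMeasurable.mul hφ) (Eventually.of_forall fun x => ?_)
  have hC0 : 0 ≤ C := by
    have := (abs_nonneg _).trans (hC 0)
    simpa using this
  rw [norm_mul, Real.norm_eq_abs, Real.norm_eq_abs]
  calc |eulerDensity g μ s x| * |φ x| ≤ |eulerDensity g μ s x| * (C * (1 + ‖x‖) ^ N) := by
        gcongr; exact hC x
    _ = C * (|eulerDensity g μ s x| * (1 + ‖x‖) ^ (N + (D + 1))) * ((1 + ‖x‖) ^ (D + 1))⁻¹ := by
        rw [pow_add]; field_simp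
    _ ≤ C * C₁ * ((1 + ‖x‖) ^ (D + 1))⁻¹ := by
        gcongr; exact h s (by simp) x

/-- Differentiation under the integral sign for functionals of the density. -/
theorem hasDerivAt_integral_of_eulerDensity [IsProbabilityMeasure μ] (hs : 0 < s)
    {f : ℝ → E → ℝ} {f' : ℝ → E → ℝ} {C : ℝ} {N : ℕ}
    (hf_meas : ∀ r, 0 < r → AEStronglyMeasurable (f r)) (hf_int : Integrable (f s))
    (hf'_meas : AEStronglyMeasurable (fun x => eulerDensityDeriv g μ s x * f' s x))
    (hf' : ∀ r ∈ Icc (s / 2) (2 * s), ∀ x, |f' r x| ≤ C * (1 + ‖x‖) ^ N)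
    (hderiv : ∀ r, 0 < r → ∀ x,
      HasDerivAt (fun r => f r x) (eulerDensityDeriv g μ r x * f' r x) r) :
    HasDerivAt (fun r => ∫ x, f r x) (∫ x, eulerDensityDeriv g μ s x * f' s x) s := by
  set D := Module.finrank ℝ E
  obtain ⟨C₁, h⟩ := exists_eulerDensityDeriv_mul_pow_le hg hμ (half_pos hs) (2 * s) (N + (D + 1))
  refine (hasDerivAt_integral_of_dominated_loc_of_deriv_le (s := Ioo (s / 2) (2 * s)) (F := f)
    (F' := fun r x => eulerDensityDeriv g μ r x * f' r x)
    (Ioo_mem_nhds (by linarith) (by linarith))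
    ((lt_mem_nhds hs).mono fun r hr => hf_meas r hr) hf_int hf'_meas
    (bound := fun x => C * C₁ * ((1 + ‖x‖) ^ (D + 1))⁻¹)
    (Eventually.of_forall fun x r hr => ?_)
    ((integrable_inv_one_add_norm_pow (E := E)).const_mul (C * C₁))
    (Eventually.of_forall fun x r hr => hderiv r (by linarith [hr.1]) x)).2
  have hr' := Ioo_subset_Icc_self hr
  have hC0 : 0 ≤ C := by
    have := (abs_nonneg _).trans (hf' r hr' 0)
    simpa using this
  rw [norm_mul, Real.norm_eq_abs, Real.norm_eq_abs]
  calc |eulerDensityDeriv g μ r x| * |f' r x|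
      ≤ |eulerDensityDeriv g μ r x| * (C * (1 + ‖x‖) ^ N) := by
        gcongr; exact hf' r hr' x
    _ = C * (|eulerDensityDeriv g μ r x| * (1 + ‖x‖) ^ (N + (D + 1)))
          * ((1 + ‖x‖) ^ (D + 1))⁻¹ := by
        rw [pow_add]; field_simp
    _ ≤ C * C₁ * ((1 + ‖x‖) ^ (D + 1))⁻¹ := by
        gcongr; exact h r hr' x

end moments

end

section

variable {E : Type*} [NormedAddCommGroup E] [InnerProductSpace ℝ E] [FiniteDimensional ℝ E]
  [MeasurableSpace E] [BorelSpace E] {g : E → E} {K s : ℝ} {μ : Measure E}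

/-! ### Entropy dissipation at positive times -/

/-- `h` is the continuous gradient of `u`, and both grow at most polynomially. -/
structure PolyPotential (u : E → ℝ) (h : E → E) (C : ℝ) (N : ℕ) : Prop where
  hasFDerivAt : ∀ x, HasFDerivAt u (innerSL ℝ (h x)) x
  cont : Continuous h
  abs_le : ∀ x, |u x| ≤ C * (1 + ‖x‖) ^ N
  norm_le : ∀ x, ‖h x‖ ≤ C * (1 + ‖x‖) ^ N

theorem PolyPotential.continuous {u : E → ℝ} {h : E → E} {C : ℝ} {N : ℕ}
    (hu : PolyPotential u h C N) : Continuous u :=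
  continuous_iff_continuousAt.2 fun x => (hu.hasFDerivAt x).continuousAt

theorem PolyPotential.nonneg {u : E → ℝ} {h : E → E} {C : ℝ} {N : ℕ}
    (hu : PolyPotential u h C N) : 0 ≤ C := by
  have := (abs_nonneg _).trans (hu.abs_le 0)
  simpa using this

theorem integrable_one_add_norm_pow_of_exp_sq {c : ℝ} (hc : 0 < c)
    (h : Integrable (fun x => Real.exp (c * ‖x‖ ^ 2)) μ) (M : ℕ) :
    Integrable (fun x => (1 + ‖x‖) ^ M) μ := by
  obtain ⟨C, hC, hle⟩ := pow_le_mul_exp_sq hc M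
  refine (h.const_mul C).mono' (Continuous.aestronglyMeasurable (by fun_prop))
    (Eventually.of_forall fun x => ?_)
  rw [Real.norm_of_nonneg (by positivity)]
  exact hle _ (norm_nonneg x)

theorem integrable_one_add_norm_pow_stdGaussian (M : ℕ) :
    Integrable (fun x => (1 + ‖x‖) ^ M) (stdGaussian E) := by
  obtain ⟨c, hc, h⟩ := IsGaussian.exists_integrable_exp_sq (stdGaussian E)
  exact integrable_one_add_norm_pow_of_exp_sq hc h M

theorem aestronglyMeasurable_eulerDensityDeriv [SFinite μ] (hg : DriftGrowth g K) (s : ℝ) :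
    AEStronglyMeasurable (eulerDensityDeriv g μ s) :=
  ((continuous_eulerKernelDeriv hg s).stronglyMeasurable.integral_prod_left
    (f := fun z x => eulerKernelDeriv g s z x)).aestronglyMeasurable

theorem aestronglyMeasurable_eulerFlux [SFinite μ] (hg : DriftGrowth g K) (s : ℝ) :
    AEStronglyMeasurable (eulerFlux g μ s) := by
  have h1 := continuous_eulerKernel hg s
  have h2 := hg.cont
  exact (Continuous.stronglyMeasurable (by fun_prop :
    Continuous fun w : E × E => eulerKernel g s w.1 w.2 • g w.1)).integral_prod_left
    (f := fun z x => eulerKernel g s z x • g z) |>.aestronglyMeasurable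

section

variable [IsProbabilityMeasure μ] (hg : DriftGrowth g K)
  (hμ : ∀ M : ℕ, Integrable (fun z => (1 + ‖z‖) ^ M) μ) (hs : 0 < s)
  {φ : E → ℝ} {dφ : E → E} {C : ℝ} {N : ℕ} (hφ : PolyPotential φ dφ C N)
include hg hμ hs hφ

theorem integral_eulerDensity_mul :
    ∫ x, eulerDensity g μ s x * φ x
      = ∫ w, φ (w.1 - s • g w.1 + √(2 * s) • w.2) ∂(μ.prod (stdGaussian E)) := by
  have hφc := hφ.continuous
  have h1 : Integrable (fun w : E × E => eulerKernel g s w.1 w.2 • φ w.2) (μ.prod volume) := by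
    refine integrable_eulerKernel_smul hg hμ hs (Φ := fun w => φ w.2) (C := C) (N := N)
      (Continuous.aestronglyMeasurable (by fun_prop)) fun z x => (hφ.abs_le x).trans ?_
    have := hφ.nonneg
    gcongr
    exact le_mul_of_one_le_left (by positivity) (one_le_pow₀ (by linarith [norm_nonneg z]))
  rw [integral_euler hg hs (Φ := fun w => φ w.2) (by fun_prop), integral_prod_symm _ h1]
  simp only [smul_eq_mul, integral_mul_const, eulerDensity]

/-- Differentiation of `s ↦ E φ(X - s g(X) + √(2s) ξ)` along the paths, with `X` and `ξ` fixed. -/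
theorem hasDerivAt_integral_euler :
    HasDerivAt (fun r => ∫ w, φ (w.1 - r • g w.1 + √(2 * r) • w.2) ∂(μ.prod (stdGaussian E)))
      (∫ w, inner ℝ (dφ (w.1 - s • g w.1 + √(2 * s) • w.2)) (-g w.1 + (√(2 * s))⁻¹ • w.2)
        ∂(μ.prod (stdGaussian E))) s := by
  have hφc := hφ.continuous
  have hdc := hφ.cont
  have hgc := hg.cont
  have hK := hg.nonneg
  have hC := hφ.nonneg
  set B : ℝ := √(4 * s)
  set b : ℝ := (√s)⁻¹
  set A : ℝ := (1 + 2 * s * K) * (1 + B)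
  have hint : Integrable (fun w : E × E => φ (w.1 - s • g w.1 + √(2 * s) • w.2))
      (μ.prod (stdGaussian E)) := by
    rw [integrable_euler_iff hg hs (Φ := fun w => φ w.2) (by fun_prop)]
    refine integrable_eulerKernel_smul hg hμ hs (Φ := fun w => φ w.2) (C := C) (N := N)
      (Continuous.aestronglyMeasurable (by fun_prop)) fun z x => (hφ.abs_le x).trans ?_
    gcongr
    exact le_mul_of_one_le_left (by positivity) (one_le_pow₀ (by linarith [norm_nonneg z]))
  refine (hasDerivAt_integral_of_dominated_loc_of_deriv_le (s := Ioo (s / 2) (2 * s))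
    (F := fun r (w : E × E) => φ (w.1 - r • g w.1 + √(2 * r) • w.2))
    (F' := fun r (w : E × E) =>
      inner ℝ (dφ (w.1 - r • g w.1 + √(2 * r) • w.2)) (-g w.1 + (√(2 * r))⁻¹ • w.2))
    (Ioo_mem_nhds (by linarith) (by linarith))
    (Eventually.of_forall fun r => Continuous.aestronglyMeasurable (by fun_prop)) hint
    (Continuous.aestronglyMeasurable (by fun_prop))
    (bound := fun w => C * A ^ N * (K + b) * ((1 + ‖w.1‖) ^ (N + 1) * (1 + ‖w.2‖) ^ (N + 1)))
    (Eventually.of_forall fun w r hr => ?_)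
    (((hμ (N + 1)).mul_prod (integrable_one_add_norm_pow_stdGaussian (N + 1))).const_mul _)
    (Eventually.of_forall fun w r hr => ?_)).2
  · have hr0 : 0 < r := by linarith [hr.1]
    have h1 := hg.one_add_norm_step_le hr0.le hr.2.le w.1 (√(2 * r) • w.2)
    have hB : √(2 * r) ≤ B := Real.sqrt_le_sqrt (by linarith [hr.2])
    have hb : (√(2 * r))⁻¹ ≤ b := by
      refine inv_anti₀ (Real.sqrt_pos.2 hs) (Real.sqrt_le_sqrt (by linarith [hr.1]))
    have h2 : 1 + ‖√(2 * r) • w.2‖ ≤ (1 + B) * (1 + ‖w.2‖) := by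
      rw [norm_smul, Real.norm_of_nonneg (Real.sqrt_nonneg _)]
      have := norm_nonneg w.2
      have := Real.sqrt_nonneg (2 * r)
      nlinarith
    have h3 : 1 + ‖w.1 - r • g w.1 + √(2 * r) • w.2‖ ≤ A * ((1 + ‖w.1‖) * (1 + ‖w.2‖)) := by
      refine h1.trans ?_
      calc (1 + 2 * s * K) * ((1 + ‖w.1‖) * (1 + ‖√(2 * r) • w.2‖))
          ≤ (1 + 2 * s * K) * ((1 + ‖w.1‖) * ((1 + B) * (1 + ‖w.2‖))) := by gcongr
        _ = _ := by ring
    have h4 : ‖-g w.1 + (√(2 * r))⁻¹ • w.2‖ ≤ (K + b) * ((1 + ‖w.1‖) * (1 + ‖w.2‖)) := by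
      refine (norm_add_le _ _).trans ?_
      rw [norm_neg, norm_smul, Real.norm_of_nonneg (by positivity)]
      have h5 := hg.bound w.1
      have h6 : (√(2 * r))⁻¹ * ‖w.2‖ ≤ b * ‖w.2‖ := by gcongr
      have hb0 : 0 ≤ b := by positivity
      have h7 := norm_nonneg w.1
      have h8 := norm_nonneg w.2
      have h9 : 0 ≤ K * ((1 + ‖w.1‖) * ‖w.2‖) := by positivity
      have h10 : 0 ≤ b * (‖w.1‖ * (1 + ‖w.2‖)) := by positivity
      nlinarith
    refine (abs_real_inner_le_norm _ _).trans ?_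
    calc _ ≤ (C * (1 + ‖w.1 - r • g w.1 + √(2 * r) • w.2‖) ^ N)
          * ((K + b) * ((1 + ‖w.1‖) * (1 + ‖w.2‖))) := by gcongr; exact hφ.norm_le _
      _ ≤ (C * (A * ((1 + ‖w.1‖) * (1 + ‖w.2‖))) ^ N)
          * ((K + b) * ((1 + ‖w.1‖) * (1 + ‖w.2‖))) := by gcongr
      _ = _ := by rw [mul_pow A, mul_pow (1 + ‖w.1‖)]; ring
  · have hr0 : 0 < r := by linarith [hr.1]
    have h1 : HasDerivAt (fun r : ℝ => √(2 * r)) ((√(2 * r))⁻¹) r := by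
      have := ((hasDerivAt_id r).const_mul 2).sqrt (by simpa using hr0.ne')
      refine this.congr_deriv ?_
      simp only [id]
      field_simp
    have h2 : HasDerivAt (fun r : ℝ => w.1 - r • g w.1 + √(2 * r) • w.2)
        (-g w.1 + (√(2 * r))⁻¹ • w.2) r := by
      have := (((hasDerivAt_id r).smul_const (g w.1)).const_sub w.1).add (h1.smul_const w.2)
      exact this.congr_deriv (by simp)
    exact (hφ.hasFDerivAt _).comp_hasDerivAt r h2

/-- Integrability behind the interchange of the integrals over the start and the end of an Euler
step. -/
theorem integrable_inner_euler :
    Integrable (fun w : E × E => eulerKernel g s w.1 w.2 •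
      (inner ℝ (dφ w.2) (-g w.1 + (2 * s)⁻¹ • (w.2 - (w.1 - s • g w.1))) : ℝ)) (μ.prod volume) := by
  have hdc := hφ.cont
  have hgc := hg.cont
  have hK := hg.nonneg
  have hC := hφ.nonneg
  refine integrable_eulerKernel_smul hg hμ hs (C := C * (K + (2 * s)⁻¹ * (1 + s * K)))
    (N := N + 1) (Continuous.aestronglyMeasurable (by fun_prop)) fun z x => ?_
  refine (abs_real_inner_le_norm _ _).trans ?_
  have h1 := hg.one_add_norm_displacement_le hs.le le_rfl z x
  have h4 : ‖-g z + (2 * s)⁻¹ • (x - (z - s • g z))‖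
      ≤ (K + (2 * s)⁻¹ * (1 + s * K)) * ((1 + ‖z‖) * (1 + ‖x‖)) := by
    refine (norm_add_le _ _).trans ?_
    rw [norm_neg, norm_smul, Real.norm_of_nonneg (by positivity), add_mul]
    refine add_le_add ((hg.bound z).trans ?_) ?_
    · have : 0 ≤ K * ((1 + ‖z‖) * ‖x‖) := by positivity
      linarith
    · rw [mul_assoc]
      gcongr
      linarith
  calc _ ≤ (C * (1 + ‖x‖) ^ N) * ((K + (2 * s)⁻¹ * (1 + s * K)) * ((1 + ‖z‖) * (1 + ‖x‖))) := by
        gcongr; exact hφ.norm_le _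
    _ ≤ (C * ((1 + ‖z‖) ^ N * (1 + ‖x‖) ^ N))
          * ((K + (2 * s)⁻¹ * (1 + s * K)) * ((1 + ‖z‖) * (1 + ‖x‖))) := by
        gcongr
        exact le_mul_of_one_le_left (by positivity) (one_le_pow₀ (by linarith [norm_nonneg z]))
    _ = _ := by ring

/-- The weak form of the Fokker–Planck equation `∂ₛ p = div (∇p + p E[g(X) | x])`. It is read off
from two expressions for the derivative of `s ↦ E φ(X - s g(X) + √(2s) ξ)`: through the density,
and along the paths. -/
theorem integral_eulerDensityDeriv_mul :
    ∫ x, eulerDensityDeriv g μ s x * φ x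
      = - ∫ x, inner ℝ (dφ x) (eulerGrad g μ s x + eulerFlux g μ s x) := by
  have hφc := hφ.continuous
  have hdc := hφ.cont
  have hgc := hg.cont
  -- The derivative through the density.
  have hA : HasDerivAt (fun r => ∫ x, eulerDensity g μ r x * φ x)
      (∫ x, eulerDensityDeriv g μ s x * φ x) s := by
    refine hasDerivAt_integral_of_eulerDensity hg hμ hs (f' := fun _ x => φ x) (C := C) (N := N)
      (fun r hr => (continuous_eulerDensity hg hr).aestronglyMeasurable.mul
        hφc.aestronglyMeasurable)
      (integrable_eulerDensity_mul hg hμ hs hφc.aestronglyMeasurable hφ.abs_le)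
      ((aestronglyMeasurable_eulerDensityDeriv hg s).mul hφc.aestronglyMeasurable)
      (fun r _ x => hφ.abs_le x)
      (fun r hr x => (hasDerivAt_eulerDensity hg hμ hr x).mul_const (φ x))
  -- The same function of time written along the paths.
  have hB : (fun r => ∫ w, φ (w.1 - r • g w.1 + √(2 * r) • w.2) ∂(μ.prod (stdGaussian E)))
      =ᶠ[𝓝 s] fun r => ∫ x, eulerDensity g μ r x * φ x := by
    filter_upwards [lt_mem_nhds hs] with r hr
    exact (integral_eulerDensity_mul hg hμ hr hφ).symm
  have hC := (hasDerivAt_integral_euler hg hμ hs hφ).congr_of_eventuallyEq hB.symm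
  rw [hA.unique hC]
  -- The noise is the displacement divided by `√(2s)`, so the integrand is a function of both end
  -- points.
  have hD : ∀ w : E × E,
      (inner ℝ (dφ (w.1 - s • g w.1 + √(2 * s) • w.2)) (-g w.1 + (√(2 * s))⁻¹ • w.2) : ℝ)
      = inner ℝ (dφ (w.1 - s • g w.1 + √(2 * s) • w.2)) (-g w.1 + (2 * s)⁻¹ •
        ((w.1 - s • g w.1 + √(2 * s) • w.2) - (w.1 - s • g w.1))) := fun w => by
    rw [add_sub_cancel_left, smul_smul]
    congr 3
    have := Real.mul_self_sqrt (by positivity : 0 ≤ 2 * s)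
    have h0 : 0 < √(2 * s) := Real.sqrt_pos.2 (by positivity)
    nth_rewrite 2 [← this]
    field_simp
  simp_rw [hD]
  rw [integral_euler hg hs (Φ := fun w : E × E =>
      (inner ℝ (dφ w.2) (-g w.1 + (2 * s)⁻¹ • (w.2 - (w.1 - s • g w.1))) : ℝ)) (by fun_prop),
    integral_prod_symm _ (integrable_inner_euler hg hμ hs hφ), ← integral_neg]
  refine integral_congr_ae (Eventually.of_forall fun x => ?_)
  simp only
  have hi1 := integrable_eulerKernel_smul_displacement (μ := μ) hg hs x
  have hi2 := integrable_eulerKernel_smul_drift hg hμ hs x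
  have hi3 := integral_inner (𝕜 := ℝ) (hi1.add hi2) (dφ x)
  simp only [Pi.add_apply] at hi3
  rw [eulerGrad, eulerFlux, ← integral_add hi1 hi2, ← hi3, ← integral_neg]
  refine integral_congr_ae (Eventually.of_forall fun z => ?_)
  simp only [smul_eq_mul]
  rw [← real_inner_smul_right, ← inner_neg_right]
  congr 1
  rw [smul_add, smul_smul, neg_add, smul_neg, neg_smul, neg_neg, ← div_eq_mul_inv, add_comm]

end

/-- The score `∇ log (p_s / e^{-u})` of the density after an Euler step relative to `e^{-u}`. -/
noncomputable def eulerScore (g : E → E) (μ : Measure E) (h : E → E) (s : ℝ) (x : E) : E :=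
  (eulerDensity g μ s x)⁻¹ • eulerGrad g μ s x + h x

section

variable [IsProbabilityMeasure μ] (hg : DriftGrowth g K)
  (hμ : ∀ M : ℕ, Integrable (fun z => (1 + ‖z‖) ^ M) μ) (hs : 0 < s)
  {u : E → ℝ} {h : E → E} {C : ℝ} {N : ℕ} (hu : PolyPotential u h C N)
include hg hs hu

/-- The derivative `log p + u + 1` of the entropy integrand in the density is an admissible test
function in the weak Fokker–Planck equation, and its gradient is the score. -/
theorem exists_polyPotential_log_eulerDensity :
    ∃ C' : ℝ, PolyPotential (fun x => Real.log (eulerDensity g μ s x) + u x + 1)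
      (eulerScore g μ h s) C' (N + 2) := by
  obtain ⟨C₁, hC₁, h1⟩ := exists_abs_log_eulerDensity_le (μ := μ) hg hs s
  obtain ⟨C₂, hC₂, h2⟩ := exists_norm_eulerGrad_le (μ := μ) hg hs
  have hC := hu.nonneg
  have hpw : ∀ (x : E) (n : ℕ), n ≤ N + 2 → (1 + ‖x‖) ^ n ≤ (1 + ‖x‖) ^ (N + 2) := fun x n hn =>
    pow_le_pow_right₀ (by linarith [norm_nonneg x]) hn
  refine ⟨C₁ + C₂ + C + 1, fun x => ?_, ?_, fun x => ?_, fun x => ?_⟩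
  · have := (((hasFDerivAt_eulerDensity (μ := μ) hg hs x).log
      (eulerDensity_pos hg hs x).ne').add (hu.hasFDerivAt x)).add_const 1
    rw [eulerScore, map_add, map_smul]
    exact this
  · exact ((continuous_eulerDensity hg hs).inv₀ fun x => (eulerDensity_pos hg hs x).ne').smul
      (continuous_eulerGrad hg hs) |>.add hu.cont
  · have h3 := h1 s (by simp) x
    have h4 := hu.abs_le x
    have h5 := abs_add_le (Real.log (eulerDensity g μ s x) + u x) 1
    have h6 := abs_add_le (Real.log (eulerDensity g μ s x)) (u x)
    rw [abs_one] at h5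
    have h7 : C₁ * (1 + ‖x‖) ^ 2 ≤ C₁ * (1 + ‖x‖) ^ (N + 2) := by
      gcongr C₁ * ?_; exact hpw x 2 (by omega)
    have h8 : C * (1 + ‖x‖) ^ N ≤ C * (1 + ‖x‖) ^ (N + 2) := by
      gcongr C * ?_; exact hpw x N (by omega)
    have h9 := hpw x 0 (by omega)
    have h10 : 0 ≤ C₂ * (1 + ‖x‖) ^ (N + 2) := by positivity
    rw [pow_zero] at h9
    linarith
  · have hp := eulerDensity_pos (μ := μ) hg hs x
    have h3 : ‖(eulerDensity g μ s x)⁻¹ • eulerGrad g μ s x‖ ≤ C₂ * (1 + ‖x‖) := by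
      rw [norm_smul, Real.norm_of_nonneg (by positivity), inv_mul_le_iff₀ hp, mul_comm]
      exact h2 x
    have h4 := hu.norm_le x
    have h5 := norm_add_le ((eulerDensity g μ s x)⁻¹ • eulerGrad g μ s x) (h x)
    have h7 : C₂ * (1 + ‖x‖) ≤ C₂ * (1 + ‖x‖) ^ (N + 2) := by
      gcongr C₂ * ?_; simpa using hpw x 1 (by omega)
    have h8 : C * (1 + ‖x‖) ^ N ≤ C * (1 + ‖x‖) ^ (N + 2) := by
      gcongr C * ?_; exact hpw x N (by omega)
    have h10 : 0 ≤ (C₁ + 1) * (1 + ‖x‖) ^ (N + 2) := by positivity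
    rw [eulerScore]
    linarith

include hμ

theorem integrable_eulerDensity_mul_log :
    Integrable fun x => eulerDensity g μ s x * (Real.log (eulerDensity g μ s x) + u x) := by
  obtain ⟨C', hC'⟩ := exists_polyPotential_log_eulerDensity (μ := μ) hg hs hu
  have h1 := integrable_eulerDensity_mul hg hμ hs hC'.continuous.aestronglyMeasurable hC'.abs_le
  have h2 := integrable_eulerDensity_mul (φ := fun _ => 1) (C := 1) (N := 0) hg hμ hs
    aestronglyMeasurable_const (fun x => by simp)
  refine (h1.sub h2).congr (Eventually.of_forall fun x => ?_)
  simp only [Pi.sub_apply]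
  ring

theorem integrable_eulerDensity_mul_norm_eulerScore_sq :
    Integrable fun x => eulerDensity g μ s x * ‖eulerScore g μ h s x‖ ^ 2 := by
  obtain ⟨C', hC'⟩ := exists_polyPotential_log_eulerDensity (μ := μ) hg hs hu
  have hc := hC'.cont
  refine integrable_eulerDensity_mul (C := C' ^ 2) (N := (N + 2) * 2) hg hμ hs
    (Continuous.aestronglyMeasurable (by fun_prop)) fun x => ?_
  rw [abs_of_nonneg (by positivity), pow_mul, ← mul_pow]
  gcongr
  exact hC'.norm_le x

/-- **Entropy dissipation** along the interpolation, at positive times. Differentiation under the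
integral sign produces `∫ ∂ₛp (log p + u + 1)`, and the weak Fokker–Planck equation is applied with
the test function `log p + u + 1` frozen at the time of interest. -/
theorem hasDerivAt_entropy :
    HasDerivAt (fun r => ∫ x, eulerDensity g μ r x * (Real.log (eulerDensity g μ r x) + u x))
      (-∫ x, inner ℝ (eulerScore g μ h s x) (eulerGrad g μ s x + eulerFlux g μ s x)) s := by
  obtain ⟨C', hC'⟩ := exists_polyPotential_log_eulerDensity (μ := μ) hg hs hu
  obtain ⟨C₁, hC₁, h1⟩ := exists_abs_log_eulerDensity_le (μ := μ) hg (half_pos hs) (2 * s)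
  have hC := hu.nonneg
  have huc := hu.continuous
  rw [← integral_eulerDensityDeriv_mul hg hμ hs hC']
  refine hasDerivAt_integral_of_eulerDensity hg hμ hs
    (f' := fun r x => Real.log (eulerDensity g μ r x) + u x + 1) (C := C₁ + C + 1) (N := N + 2)
    (fun r hr => ?_) (integrable_eulerDensity_mul_log hg hμ hs hu)
    ((aestronglyMeasurable_eulerDensityDeriv hg s).mul hC'.continuous.aestronglyMeasurable)
    (fun r hr x => ?_) (fun r hr x => ?_)
  · have := continuous_eulerDensity (μ := μ) hg hr
    refine Continuous.aestronglyMeasurable (this.mul ((this.log fun x => ?_).add huc))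
    exact (eulerDensity_pos hg hr x).ne'
  · have hpw : ∀ n : ℕ, n ≤ N + 2 → (1 + ‖x‖) ^ n ≤ (1 + ‖x‖) ^ (N + 2) := fun n hn =>
      pow_le_pow_right₀ (by linarith [norm_nonneg x]) hn
    have h3 := h1 r hr x
    have h4 := hu.abs_le x
    have h5 := abs_add_le (Real.log (eulerDensity g μ r x) + u x) 1
    have h6 := abs_add_le (Real.log (eulerDensity g μ r x)) (u x)
    rw [abs_one] at h5
    have h7 : C₁ * (1 + ‖x‖) ^ 2 ≤ C₁ * (1 + ‖x‖) ^ (N + 2) := by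
      gcongr C₁ * ?_; exact hpw 2 (by omega)
    have h8 : C * (1 + ‖x‖) ^ N ≤ C * (1 + ‖x‖) ^ (N + 2) := by
      gcongr C * ?_; exact hpw N (by omega)
    have h9 := hpw 0 (by omega)
    rw [pow_zero] at h9
    linarith
  · have hd := hasDerivAt_eulerDensity hg hμ hr x
    have hp := eulerDensity_pos (μ := μ) hg hr x
    refine (hd.mul ((hd.log hp.ne').add_const (u x))).congr_deriv ?_
    field_simp

end

end

section

variable {E : Type*} [NormedAddCommGroup E] [InnerProductSpace ℝ E]

/-! ### Short-time estimates for one Euler step -/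

/-- `q` is positive with continuous gradient `dq`, and its logarithmic gradient `dq / q` grows at
most linearly. No normalization is required. -/
structure LogLipschitzDensity (q : E → ℝ) (dq : E → E) (C : ℝ) : Prop where
  pos : ∀ x, 0 < q x
  hasFDerivAt : ∀ x, HasFDerivAt q (innerSL ℝ (dq x)) x
  cont : Continuous dq
  norm_le : ∀ x, ‖dq x‖ ≤ C * (1 + ‖x‖) * q x

variable {q : E → ℝ} {dq : E → E} {C : ℝ} {g : E → E} {K : ℝ}

theorem LogLipschitzDensity.continuous (hq : LogLipschitzDensity q dq C) : Continuous q :=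
  continuous_iff_continuousAt.2 fun x => (hq.hasFDerivAt x).continuousAt

theorem LogLipschitzDensity.nonneg (hq : LogLipschitzDensity q dq C) : 0 ≤ C := by
  have h1 := (norm_nonneg _).trans (hq.norm_le 0)
  have h2 := hq.pos 0
  simp only [norm_zero, add_zero, mul_one] at h1
  exact nonneg_of_mul_nonneg_left h1 h2

/-- The mean value inequality for `log q` on the ball of radius `|v|` about `x`. -/
theorem LogLipschitzDensity.abs_log_sub_log_le (hq : LogLipschitzDensity q dq C) (x v : E) :
    |Real.log (q (x + v)) - Real.log (q x)| ≤ C * (1 + ‖x‖ + ‖v‖) * ‖v‖ := by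
  have hC := hq.nonneg
  have h := (convex_closedBall x ‖v‖).norm_image_sub_le_of_norm_hasFDerivWithin_le
    (f := fun y => Real.log (q y)) (f' := fun y => (q y)⁻¹ • innerSL ℝ (dq y))
    (C := C * (1 + ‖x‖ + ‖v‖)) (x := x) (y := x + v)
    (fun y _ => ((hq.hasFDerivAt y).log (hq.pos y).ne').hasFDerivWithinAt) (fun y hy => ?_)
    (Metric.mem_closedBall_self (norm_nonneg v)) (by simp)
  · simpa using h
  · have hp := hq.pos y
    rw [norm_smul, innerSL_apply_norm, Real.norm_of_nonneg (by positivity), inv_mul_le_iff₀ hp,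
      mul_comm (q y)]
    refine (hq.norm_le y).trans ?_
    have h1 : ‖y‖ ≤ ‖x‖ + ‖v‖ := by
      rw [mem_closedBall_iff_norm] at hy
      have := norm_le_norm_add_norm_sub' y x
      linarith
    have h2 : 1 + ‖y‖ ≤ 1 + ‖x‖ + ‖v‖ := by linarith
    have h3 := hp.le
    gcongr

theorem LogLipschitzDensity.exists_abs_log_le (hq : LogLipschitzDensity q dq C) :
    ∃ C' : ℝ, 0 < C' ∧ ∀ x, |Real.log (q x)| ≤ C' * (1 + ‖x‖) ^ 2 := by
  have hC := hq.nonneg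
  refine ⟨|Real.log (q 0)| + C + 1, by positivity, fun x => ?_⟩
  have h := hq.abs_log_sub_log_le 0 x
  rw [zero_add, norm_zero, add_zero] at h
  have h1 := abs_sub_abs_le_abs_sub (Real.log (q x)) (Real.log (q 0))
  have hx := norm_nonneg x
  have h2 : (1 : ℝ) ≤ (1 + ‖x‖) ^ 2 := one_le_pow₀ (by linarith)
  have h3 : |Real.log (q 0)| ≤ |Real.log (q 0)| * (1 + ‖x‖) ^ 2 :=
    le_mul_of_one_le_right (abs_nonneg _) h2
  have h4 : C * (1 + ‖x‖) * ‖x‖ ≤ C * (1 + ‖x‖) ^ 2 := by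
    rw [mul_assoc, pow_two]
    gcongr
    linarith
  nlinarith

/-- The exponent of a Gaussian in `w` shifted by `v`, in terms of `t = |w|`, `V = |v|` and
`i = ⟨w, v⟩`, for a shift of size at most `ρ (a + t)` with `ρ` small. -/
theorem shift_sq_bounds {ρ δ a t V i : ℝ} (hρ : 0 ≤ ρ) (hρ8 : ρ ≤ 1 / 8) (hρ2 : ρ ^ 2 ≤ δ)
    (ht : 0 ≤ t) (hV : 0 ≤ V) (hVle : V ≤ ρ * (a + t)) (hi : |i| ≤ t * V) :
    t ^ 2 / 8 - δ * a ^ 2 ≤ (t ^ 2 - 2 * i + V ^ 2) / 4 ∧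
      (t ^ 2 - 2 * i + V ^ 2) / 4 ≤ t ^ 2 + δ * a ^ 2 := by
  rw [abs_le] at hi
  have h1 : t * V ≤ t * (ρ * (a + t)) := by gcongr
  have h2 : ρ * t ^ 2 ≤ 1 / 8 * t ^ 2 := by gcongr
  have h3 : ρ ^ 2 * a ^ 2 ≤ δ * a ^ 2 := by gcongr
  constructor
  · have h4 := sq_nonneg (t / 4 - ρ * a)
    have h5 := sq_nonneg V
    linarith
  · have h5 : V ^ 2 ≤ (ρ * (a + t)) ^ 2 := by gcongr
    have h6 : ρ ^ 2 * t ^ 2 ≤ (1 / 8) ^ 2 * t ^ 2 := by gcongr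
    have h7 := sq_nonneg (t - V)
    have h8 := sq_nonneg (ρ * a - ρ * t)
    have h9 := sq_nonneg t
    linarith

/-- At scale `r`, a log-Lipschitz density and a Gaussian shifted by `O(r)` change by at most a
factor `exp (δ (1 + |x|)²)` with `δ → 0` as `r → 0`, up to a fraction of the Gaussian exponent. -/
theorem exists_shortTime_bounds (hq : LogLipschitzDensity q dq C) (hK : 0 ≤ K) {δ : ℝ}
    (hδ : 0 < δ) :
    ∃ r₀ : ℝ, 0 < r₀ ∧ r₀ ≤ 1 ∧ ∀ r, |r| ≤ r₀ → ∀ x w : E,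
      q (x + r • w) ≤ q x * Real.exp (δ * (1 + ‖x‖) ^ 2 + ‖w‖ ^ 2 / 16) ∧
      q x * Real.exp (-(δ * (1 + ‖x‖) ^ 2 + ‖w‖ ^ 2 / 16)) ≤ q (x + r • w) ∧
      ∀ v : E, ‖v‖ ≤ |r| * (K * (1 + ‖x‖ + ‖w‖)) →
        ‖w‖ ^ 2 / 8 - δ * (1 + ‖x‖) ^ 2 ≤ ‖w - v‖ ^ 2 / 4 ∧
        ‖w - v‖ ^ 2 / 4 ≤ ‖w‖ ^ 2 + δ * (1 + ‖x‖) ^ 2 := by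
  have hC := hq.nonneg
  -- The smallness of `r` needed to absorb the quadratic terms in `w` into the Gaussian exponent.
  have hev : ∀ᶠ r : ℝ in 𝓝[>] 0, r ≤ 1 ∧ r ^ 2 * (C ^ 2 / (4 * δ) + C) ≤ 1 / 16 ∧
      8 * r * K ≤ 1 ∧ r ^ 2 * K ^ 2 ≤ δ ∧ 0 < r := by
    have c1 : ContinuousAt (fun r : ℝ => r ^ 2 * (C ^ 2 / (4 * δ) + C)) 0 := by fun_prop
    have c2 : ContinuousAt (fun r : ℝ => 8 * r * K) 0 := by fun_prop
    have c3 : ContinuousAt (fun r : ℝ => r ^ 2 * K ^ 2) 0 := by fun_prop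
    have e1 := c1.eventually_lt_const (u := 1 / 16) (by norm_num)
    have e2 := c2.eventually_lt_const (u := 1) (by norm_num)
    have e3 := c3.eventually_lt_const (u := δ) (by simpa using hδ)
    filter_upwards [nhdsWithin_le_nhds e1, nhdsWithin_le_nhds e2, nhdsWithin_le_nhds e3,
      nhdsWithin_le_nhds (eventually_lt_nhds (one_pos : (0 : ℝ) < 1)), self_mem_nhdsWithin]
      with r h1 h2 h3 h4 h5
    exact ⟨h4.le, h1.le, h2.le, h3.le, h5⟩
  obtain ⟨r₀, hr1, hr2, hr3, hr4, hr0⟩ := hev.exists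
  refine ⟨r₀, hr0, hr1, fun r hr x w => ?_⟩
  set a := 1 + ‖x‖ with ha
  set t := ‖w‖
  have ht : 0 ≤ t := norm_nonneg w
  have ha1 : 1 ≤ a := by have := norm_nonneg x; linarith
  have hr' : 0 ≤ |r| := abs_nonneg r
  have hsq : |r| ^ 2 ≤ r₀ ^ 2 := by gcongr
  have key : C * (1 + ‖x‖ + ‖r • w‖) * ‖r • w‖ ≤ δ * a ^ 2 + t ^ 2 / 16 := by
    rw [norm_smul, Real.norm_eq_abs, ← ha]
    change C * (a + |r| * t) * (|r| * t) ≤ _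
    -- The mixed term is split by the weighted arithmetic-geometric mean inequality.
    have h1 : C * a * (|r| * t) ≤ δ * a ^ 2 + C ^ 2 / (4 * δ) * (|r| ^ 2 * t ^ 2) := by
      have h2 : 0 ≤ (2 * δ * a - C * (|r| * t)) ^ 2 / (4 * δ) := by positivity
      have h3 : (2 * δ * a - C * (|r| * t)) ^ 2 / (4 * δ)
          = δ * a ^ 2 + C ^ 2 / (4 * δ) * (|r| ^ 2 * t ^ 2) - C * a * (|r| * t) := by
        field_simp; ring
      linarith
    have h4 : |r| ^ 2 * (C ^ 2 / (4 * δ) + C) ≤ 1 / 16 :=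
      (mul_le_mul_of_nonneg_right hsq (by positivity)).trans hr2
    have h5 := mul_le_mul_of_nonneg_right h4 (sq_nonneg t)
    linarith
  have hlog := (hq.abs_log_sub_log_le x (r • w)).trans key
  rw [abs_le] at hlog
  have hqx := hq.pos x
  have hqy := hq.pos (x + r • w)
  refine ⟨?_, ?_, fun v hv => ?_⟩
  · rw [← Real.log_le_log_iff hqy (by positivity), Real.log_mul hqx.ne' (by positivity),
      Real.log_exp]
    linarith [hlog.2]
  · rw [← Real.log_le_log_iff (by positivity) hqy, Real.log_mul hqx.ne' (by positivity),
      Real.log_exp]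
    linarith [hlog.1]
  · have hrK : |r| * K ≤ 1 / 8 := by
      have := mul_le_mul_of_nonneg_right hr hK
      linarith
    have hrK2 : (|r| * K) ^ 2 ≤ δ := by
      rw [mul_pow]
      exact (mul_le_mul_of_nonneg_right hsq (by positivity)).trans hr4
    rw [norm_sub_sq_real]
    exact shift_sq_bounds (by positivity) hrK hrK2 ht (norm_nonneg v)
      (hv.trans_eq (by rw [ha]; ring)) (abs_real_inner_le_norm w v)

/-- `-∇` of the heat kernel at time `1`. -/
noncomputable def unitScore (v : E) : E := (heatKernel 1 v / 2) • v

/-- The derivative of `unitScore` at `w` in the direction `v`. -/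
noncomputable def unitScoreDeriv (w v : E) : E :=
  (heatKernel 1 w / 2) • v - (heatKernel 1 w / 4 * inner ℝ w v) • w

theorem continuous_unitScore : Continuous (unitScore : E → E) := by
  have := continuous_heatKernel (E := E) 1
  unfold unitScore
  fun_prop

theorem hasDerivAt_unitScore {c : ℝ → E} {c' : E} {r : ℝ} (hc : HasDerivAt c c' r) :
    HasDerivAt (fun r => unitScore (c r)) (unitScoreDeriv (c r) c') r := by
  have h1 := (hasFDerivAt_heatKernel one_pos (c r)).comp_hasDerivAt r hc
  have h2 := (h1.div_const 2).smul hc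
  refine h2.congr_deriv ?_
  simp only [unitScoreDeriv, innerSL_apply_apply, real_inner_smul_left, Function.comp]
  rw [sub_eq_add_neg, ← neg_smul]
  congr 2
  ring

theorem norm_unitScoreDeriv_le (w v : E) :
    ‖unitScoreDeriv w v‖ ≤ heatKernel 1 w * (1 + ‖w‖) ^ 2 * ‖v‖ := by
  have hk := heatKernel_pos one_pos w
  refine (norm_sub_le _ _).trans ?_
  rw [norm_smul, norm_smul, norm_mul, Real.norm_of_nonneg (by positivity),
    Real.norm_of_nonneg (by positivity), Real.norm_eq_abs]
  have h1 := abs_real_inner_le_norm w v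
  have hw := norm_nonneg w
  have hv := norm_nonneg v
  calc heatKernel 1 w / 2 * ‖v‖ + heatKernel 1 w / 4 * |inner ℝ w v| * ‖w‖
      ≤ heatKernel 1 w / 2 * ‖v‖ + heatKernel 1 w / 4 * (‖w‖ * ‖v‖) * ‖w‖ := by gcongr
    _ = heatKernel 1 w * (1 / 2 + ‖w‖ ^ 2 / 4) * ‖v‖ := by ring
    _ ≤ _ := by
      gcongr
      nlinarith

theorem heatKernel_one_eq (y : E) :
    heatKernel 1 y = heatKernel 1 (0 : E) * Real.exp (-(‖y‖ ^ 2 / 4)) := by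
  simp [heatKernel, neg_div]

/-- The domination behind the short-time limits: after rescaling `z = x + r w`, the product of the
initial density and the Euler kernel, and the difference quotient in `r` of the rescaled gradient,
are Gaussian in `w` and comparable to the initial density up to `exp (2 δ (1 + |x|)²)`. -/
theorem exists_shortTime_domination (hq : LogLipschitzDensity q dq C) (hg : DriftGrowth g K) :
    ∃ C' : ℝ, 0 < C' ∧ ∀ δ : ℝ, 0 < δ → ∃ r₀ : ℝ, 0 < r₀ ∧ ∀ r, |r| ≤ r₀ → ∀ x w : E,
      q (x + r • w) * heatKernel 1 (w - r • g (x + r • w))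
        ≤ C' * q x * Real.exp (2 * δ * (1 + ‖x‖) ^ 2) * Real.exp (-(‖w‖ ^ 2 / 16)) ∧
      q x * Real.exp (-(2 * δ * (1 + ‖x‖) ^ 2)) * (heatKernel 1 (0 : E) * Real.exp (-(2 * ‖w‖ ^ 2)))
        ≤ q (x + r • w) * heatKernel 1 (w - r • g (x + r • w)) ∧
      ‖g (x + r • w)‖ ≤ C' * (1 + ‖x‖) * (1 + ‖w‖) ∧
      ‖q (x + r • w) • unitScore (w - r • g (x + r • w)) - q x • unitScore w‖
        ≤ (C' * q x * ((1 + ‖x‖) ^ 3 * Real.exp (2 * δ * (1 + ‖x‖) ^ 2)) *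
          ((1 + ‖w‖) ^ 3 * Real.exp (-(‖w‖ ^ 2 / 16)))) * |r| := by
  have hC := hq.nonneg
  have hK := hg.nonneg
  set k : ℝ := heatKernel 1 (0 : E) with hk_def
  have hk : 0 < k := heatKernel_pos one_pos _
  refine ⟨k + K + C * (1 + K) * k + k * K * (1 + K) ^ 2, by positivity, fun δ hδ => ?_⟩
  obtain ⟨r₀, hr0, hr1, H⟩ := exists_shortTime_bounds hq hK hδ
  refine ⟨r₀, hr0, fun r hr x w => ?_⟩
  obtain ⟨hup, hlow, hgau⟩ := H r hr x w
  set W := (1 + ‖x‖) ^ 2 with hW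
  set t := ‖w‖ with ht_def
  set a := 1 + ‖x‖ with ha_def
  have ht : 0 ≤ t := norm_nonneg w
  have ha : 1 ≤ a := by have := norm_nonneg x; linarith
  have hr1' : |r| ≤ 1 := hr.trans hr1
  have hqx := hq.pos x
  have hat : a + t ≤ a * (1 + t) := by nlinarith
  have hgb' : ‖g (x + r • w)‖ ≤ K * (a + t) := by
    refine (hg.bound _).trans ?_
    have h1 : ‖x + r • w‖ ≤ ‖x‖ + t := by
      refine (norm_add_le _ _).trans ?_
      rw [norm_smul, Real.norm_eq_abs]
      have := mul_le_of_le_one_left ht hr1'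
      linarith
    have h2 : 1 + ‖x + r • w‖ ≤ a + t := by linarith
    gcongr
  have hgb : ‖g (x + r • w)‖ ≤ K * (a * (1 + t)) := hgb'.trans (by gcongr)
  set v := r • g (x + r • w) with hv_def
  have hv : ‖v‖ ≤ |r| * (K * (a + t)) := by
    rw [hv_def, norm_smul, Real.norm_eq_abs]
    gcongr
  have hv2 : ‖v‖ ≤ |r| * (K * (a * (1 + t))) := hv.trans (by gcongr)
  have hv3 : ‖v‖ ≤ K * (a * (1 + t)) :=
    hv2.trans (mul_le_of_le_one_left (by positivity) hr1')
  -- The kernel bound is needed along the whole segment from `w` to `w - v`, for the mean value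
  -- inequality.
  have hker : ∀ v' : E, ‖v'‖ ≤ ‖v‖ →
      heatKernel 1 (w - v') ≤ k * Real.exp (δ * W - t ^ 2 / 8) := fun v' hv' => by
    rw [heatKernel_one_eq, ← hk_def]
    have := (hgau v' (hv'.trans hv)).1
    gcongr
    linarith
  have hnorm : ∀ v' : E, ‖v'‖ ≤ ‖v‖ → 1 + ‖w - v'‖ ≤ (1 + K) * (a * (1 + t)) := fun v' hv' => by
    have h1 := norm_sub_le w v'
    have h2 := hv'.trans hv3
    nlinarith
  have hexp1 : Real.exp (δ * W + t ^ 2 / 16) * Real.exp (δ * W - t ^ 2 / 8)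
      = Real.exp (2 * δ * W) * Real.exp (-(t ^ 2 / 16)) := by
    rw [← Real.exp_add, ← Real.exp_add]; congr 1; ring
  have hexp2 : Real.exp (δ * W - t ^ 2 / 8) ≤ Real.exp (2 * δ * W) * Real.exp (-(t ^ 2 / 16)) := by
    rw [← Real.exp_add, Real.exp_le_exp]
    have : 0 ≤ δ * W := by positivity
    nlinarith [sq_nonneg t]
  set e := Real.exp (2 * δ * W) * Real.exp (-(t ^ 2 / 16)) with he_def
  have he : 0 < e := by positivity
  have hkv := hker v le_rfl
  refine ⟨?_, ?_, ?_, ?_⟩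
  · have h0 : q (x + r • w) * heatKernel 1 (w - v) ≤ k * q x * e := by
      calc q (x + r • w) * heatKernel 1 (w - v)
          ≤ (q x * Real.exp (δ * W + t ^ 2 / 16)) * (k * Real.exp (δ * W - t ^ 2 / 8)) :=
            mul_le_mul hup hkv (heatKernel_pos one_pos _).le (by positivity)
        _ = k * q x * (Real.exp (δ * W + t ^ 2 / 16) * Real.exp (δ * W - t ^ 2 / 8)) := by ring
        _ = _ := by rw [hexp1]
    refine h0.trans ?_
    rw [mul_assoc _ (Real.exp _), ← he_def]
    gcongr
    have : 0 ≤ K + C * (1 + K) * k + k * K * (1 + K) ^ 2 := by positivity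
    linarith
  · have h1 := (hgau v hv).2
    rw [heatKernel_one_eq (w - v), ← hk_def]
    calc q x * Real.exp (-(2 * δ * W)) * (k * Real.exp (-(2 * t ^ 2)))
        = q x * k * Real.exp (-(2 * δ * W) + -(2 * t ^ 2)) := by rw [Real.exp_add]; ring
      _ ≤ q x * k * Real.exp (-(δ * W + t ^ 2 / 16) + -(‖w - v‖ ^ 2 / 4)) := by
          refine mul_le_mul_of_nonneg_left (Real.exp_le_exp.2 ?_) (by positivity)
          linarith [sq_nonneg t]
      _ = (q x * Real.exp (-(δ * W + t ^ 2 / 16))) * (k * Real.exp (-(‖w - v‖ ^ 2 / 4))) := by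
          rw [Real.exp_add]; ring
      _ ≤ _ := by gcongr
  · refine hgb.trans ?_
    rw [mul_assoc]
    gcongr
    have : 0 ≤ k + C * (1 + K) * k + k * K * (1 + K) ^ 2 := by positivity
    linarith
  -- The difference is split into the increment of `q` and the increment of `unitScore`.
  · have hT0 : q (x + r • w) • unitScore (w - v) - q x • unitScore w
        = (q (x + r • w) - q x) • unitScore (w - v)
          + q x • (unitScore (w - v) - unitScore w) := by
      rw [sub_smul, smul_sub]; abel
    have hq1 : |q (x + r • w) - q x|
        ≤ C * (a * (1 + t)) * (q x * Real.exp (δ * W + t ^ 2 / 16)) * (|r| * t) := by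
      have h := (convex_segment x (x + r • w)).norm_image_sub_le_of_norm_hasFDerivWithin_le
        (f := q) (f' := fun y => innerSL ℝ (dq y))
        (C := C * (a * (1 + t)) * (q x * Real.exp (δ * W + t ^ 2 / 16)))
        (fun y _ => (hq.hasFDerivAt y).hasFDerivWithinAt) (fun y hy => ?_)
        (left_mem_segment ℝ x (x + r • w)) (right_mem_segment ℝ x (x + r • w))
      · simpa [norm_smul] using h
      · rw [segment_eq_image'] at hy
        obtain ⟨σ, hσ, rfl⟩ := hy
        simp only [add_sub_cancel_left, smul_smul]
        have hσr : |σ * r| ≤ r₀ := by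
          rw [abs_mul, abs_of_nonneg hσ.1]
          exact (mul_le_of_le_one_left (abs_nonneg r) hσ.2).trans hr
        rw [innerSL_apply_norm]
        refine (hq.norm_le _).trans ?_
        have h1 : 1 + ‖x + (σ * r) • w‖ ≤ a * (1 + t) := by
          have h2 : ‖x + (σ * r) • w‖ ≤ ‖x‖ + t := by
            refine (norm_add_le _ _).trans ?_
            rw [norm_smul, Real.norm_eq_abs]
            have := mul_le_of_le_one_left ht (hσr.trans hr1)
            linarith
          linarith
        exact mul_le_mul (by gcongr) (H _ hσr x w).1 (hq.pos _).le (by positivity)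
    have hs1 : ‖unitScore (w - v)‖
        ≤ (k * Real.exp (δ * W - t ^ 2 / 8)) * ((1 + K) * (a * (1 + t))) := by
      have hkp := heatKernel_pos one_pos (w - v)
      rw [unitScore, norm_smul, Real.norm_of_nonneg (by positivity)]
      have := hnorm v le_rfl
      exact mul_le_mul (by linarith) (by linarith) (norm_nonneg _) (by positivity)
    have hs2 : ‖unitScore (w - v) - unitScore w‖
        ≤ (k * Real.exp (δ * W - t ^ 2 / 8)) * ((1 + K) * (a * (1 + t))) ^ 2 * ‖v‖ := by
      have hder : ∀ σ : ℝ, HasDerivAt (fun σ : ℝ => unitScore (w - σ • v))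
          (unitScoreDeriv (w - σ • v) (-v)) σ := fun σ => by
        refine hasDerivAt_unitScore ?_
        have := ((hasDerivAt_id σ).smul_const v).const_sub w
        simpa using this
      have h := (convex_Icc (0 : ℝ) 1).norm_image_sub_le_of_norm_hasDerivWithin_le
        (f := fun σ : ℝ => unitScore (w - σ • v)) (x := 0) (y := 1)
        (C := (k * Real.exp (δ * W - t ^ 2 / 8)) * ((1 + K) * (a * (1 + t))) ^ 2 * ‖v‖)
        (fun σ _ => (hder σ).hasDerivWithinAt) (fun σ hσ => ?_) (by simp) (by simp)
      · simpa using h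
      · refine (norm_unitScoreDeriv_le _ _).trans ?_
        rw [norm_neg]
        have hσv : ‖σ • v‖ ≤ ‖v‖ := by
          rw [norm_smul, Real.norm_of_nonneg hσ.1]
          exact mul_le_of_le_one_left (norm_nonneg v) hσ.2
        have h1 := hker _ hσv
        have h2 := hnorm _ hσv
        have := (heatKernel_pos one_pos (w - σ • v)).le
        gcongr
    have hA : C * (1 + K) * k * (a ^ 2 * (1 + t) ^ 2 * t)
        ≤ C * (1 + K) * k * (a ^ 3 * (1 + t) ^ 3) := by
      have h1 : a ^ 2 ≤ a ^ 3 := pow_le_pow_right₀ ha (by norm_num)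
      have h2 : (1 + t) ^ 2 * t ≤ (1 + t) ^ 3 := by
        rw [pow_succ (1 + t) 2]; gcongr; linarith
      rw [mul_assoc (a ^ 2)]
      gcongr
    rw [hT0]
    calc ‖(q (x + r • w) - q x) • unitScore (w - v) + q x • (unitScore (w - v) - unitScore w)‖
        ≤ |q (x + r • w) - q x| * ‖unitScore (w - v)‖
          + q x * ‖unitScore (w - v) - unitScore w‖ := by
          refine (norm_add_le _ _).trans ?_
          rw [norm_smul, norm_smul, Real.norm_eq_abs, Real.norm_of_nonneg hqx.le]
      _ ≤ (C * (a * (1 + t)) * (q x * Real.exp (δ * W + t ^ 2 / 16)) * (|r| * t))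
            * ((k * Real.exp (δ * W - t ^ 2 / 8)) * ((1 + K) * (a * (1 + t))))
          + q x * ((k * Real.exp (δ * W - t ^ 2 / 8)) * ((1 + K) * (a * (1 + t))) ^ 2
            * (|r| * (K * (a * (1 + t))))) := by
          gcongr
          exact hs2.trans (by gcongr)
      _ = (C * (1 + K) * k * (a ^ 2 * (1 + t) ^ 2 * t)) *
            (q x * (Real.exp (δ * W + t ^ 2 / 16) * Real.exp (δ * W - t ^ 2 / 8)) * |r|)
          + k * K * (1 + K) ^ 2 * (a ^ 3 * (1 + t) ^ 3)
            * (q x * Real.exp (δ * W - t ^ 2 / 8) * |r|) := by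
          ring
      _ ≤ (C * (1 + K) * k * (a ^ 3 * (1 + t) ^ 3)) * (q x * e * |r|)
          + k * K * (1 + K) ^ 2 * (a ^ 3 * (1 + t) ^ 3) * (q x * e * |r|) := by
          rw [hexp1]
          gcongr
      _ = (C * (1 + K) * k + k * K * (1 + K) ^ 2)
            * (a ^ 3 * (1 + t) ^ 3 * (q x * e * |r|)) := by ring
      _ ≤ (k + K + C * (1 + K) * k + k * K * (1 + K) ^ 2)
            * (a ^ 3 * (1 + t) ^ 3 * (q x * e * |r|)) := by
          gcongr
          linarith
      _ = _ := by rw [he_def]; ring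

end

section

variable {E : Type*} [NormedAddCommGroup E] [InnerProductSpace ℝ E] [FiniteDimensional ℝ E]
  [MeasurableSpace E] [BorelSpace E] {g : E → E} {K : ℝ} {q : E → ℝ} {dq : E → E} {C : ℝ}

/-! ### Short-time limits of the density, the flux and the gradient -/

theorem integrable_pow_mul_exp_neg_sq (M : ℕ) {b : ℝ} (hb : 0 < b) :
    Integrable fun w : E => (1 + ‖w‖) ^ M * Real.exp (-(b * ‖w‖ ^ 2)) := by
  set D := Module.finrank ℝ E
  obtain ⟨C, hC, h⟩ := pow_le_mul_exp_sq hb (M + (D + 1))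
  refine ((integrable_inv_one_add_norm_pow (E := E)).const_mul C).mono'
    (Continuous.aestronglyMeasurable (by fun_prop)) (Eventually.of_forall fun w => ?_)
  have h1 := h ‖w‖ (norm_nonneg w)
  rw [Real.norm_of_nonneg (by positivity), Real.exp_neg, ← div_eq_mul_inv, ← div_eq_mul_inv,
    div_le_div_iff₀ (by positivity) (by positivity), ← pow_add]
  exact h1

/-- The second moments of the heat kernel at time `1`. -/
theorem integral_heatKernel_mul_inner_mul_inner (a b : E) :
    ∫ w : E, heatKernel 1 w * (inner ℝ a w * inner ℝ b w) = 2 * inner ℝ a b := by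
  have : CompleteSpace E := FiniteDimensional.complete ℝ E
  have hk := continuous_heatKernel (E := E) 1
  have h1 := integral_withDensity_eq_integral_toReal_smul (μ := (volume : Measure E))
    hk.measurable.ennreal_ofReal (by simp) (fun w : E => (inner ℝ a w * inner ℝ b w : ℝ))
  rw [← map_stdGaussian_eq_withDensity one_pos, integral_map (by fun_prop)
    (Continuous.aestronglyMeasurable (by fun_prop))] at h1
  simp only [ENNReal.toReal_ofReal (heatKernel_pos one_pos _).le, smul_eq_mul,
    real_inner_smul_right] at h1
  rw [← h1]
  have h2 := covarianceBilin_apply (μ := stdGaussian E) IsGaussian.memLp_two_id a b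
  simp only [id, integral_id_stdGaussian, sub_zero, covarianceBilin_stdGaussian] at h2
  rw [← innerSL_apply_apply ℝ, h2, ← integral_const_mul]
  refine integral_congr_ae (Eventually.of_forall fun w => ?_)
  have h3 : √(2 * 1) * √(2 * 1) = (2 : ℝ) := by rw [Real.mul_self_sqrt] <;> norm_num
  simp only
  linear_combination (inner ℝ a w * inner ℝ b w) * h3

theorem integrable_pow_mul_heatKernel_one (M : ℕ) :
    Integrable fun w : E => (1 + ‖w‖) ^ M * heatKernel 1 w := by
  refine ((integrable_pow_mul_exp_neg_sq (E := E) M (b := 1 / 4) (by norm_num)).const_mul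
    (heatKernel 1 (0 : E))).congr (Eventually.of_forall fun w => ?_)
  simp only
  rw [heatKernel_one_eq w, one_div_mul_eq_div]
  ring

theorem integrable_unitScore : Integrable (unitScore : E → E) := by
  refine (integrable_pow_mul_heatKernel_one (E := E) 1).mono'
    continuous_unitScore.aestronglyMeasurable (Eventually.of_forall fun w => ?_)
  have hp := heatKernel_pos one_pos w
  rw [unitScore, norm_smul, Real.norm_of_nonneg (by positivity)]
  nlinarith [norm_nonneg w, mul_nonneg hp.le (norm_nonneg w)]

/-- The integral over `w` of the derivative at `r = 0` of
`q(x + r w) unitScore (w - r g(x + r w))`, with `a` the gradient of `q`, `b = -g(x)` and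
`c = q(x)`. The drift term integrates to zero, and the Gaussian second moments turn the first term
into `a`. -/
theorem integral_unitScore_terms (a b : E) (c : ℝ) :
    ∫ w : E, (inner ℝ a w • unitScore w + c • unitScoreDeriv w b) = a := by
  have : CompleteSpace E := FiniteDimensional.complete ℝ E
  have hk := continuous_heatKernel (E := E) 1
  have hs := continuous_unitScore (E := E)
  have hw := integrable_pow_mul_heatKernel_one (E := E)
  have hi1 : Integrable fun w : E => (inner ℝ a w : ℝ) • unitScore w := by
    refine ((hw 2).const_mul ‖a‖).mono' (Continuous.aestronglyMeasurable (by fun_prop))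
      (Eventually.of_forall fun w => ?_)
    have hp := heatKernel_pos one_pos w
    rw [unitScore, norm_smul, norm_smul, Real.norm_eq_abs,
      Real.norm_of_nonneg (by positivity : 0 ≤ heatKernel 1 w / 2)]
    have h1 := abs_real_inner_le_norm a w
    have hn := norm_nonneg w
    calc |inner ℝ a w| * (heatKernel 1 w / 2 * ‖w‖) ≤ ‖a‖ * ‖w‖ * (heatKernel 1 w / 2 * ‖w‖) := by
          gcongr
      _ = ‖a‖ * (‖w‖ ^ 2 / 2 * heatKernel 1 w) := by ring
      _ ≤ _ := by gcongr; nlinarith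
  have hi2 : Integrable fun w : E => c • unitScoreDeriv w b := by
    refine Integrable.smul c ?_
    refine ((hw 2).mul_const ‖b‖).mono' ?_ (Eventually.of_forall fun w => ?_)
    · unfold unitScoreDeriv
      exact Continuous.aestronglyMeasurable (by fun_prop)
    · refine (norm_unitScoreDeriv_le w b).trans_eq ?_
      ring
  have hi := hi1.add hi2
  have hsq : ∀ a' b' : E, Integrable fun w : E =>
      heatKernel 1 w * (inner ℝ a' w * inner ℝ b' w) := by
    intro a' b'
    refine ((hw 2).const_mul (‖a'‖ * ‖b'‖)).mono' (Continuous.aestronglyMeasurable (by fun_prop))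
      (Eventually.of_forall fun w => ?_)
    have hp := heatKernel_pos one_pos w
    rw [norm_mul, norm_mul, Real.norm_of_nonneg hp.le]
    have h1 := abs_real_inner_le_norm a' w
    have h2 := abs_real_inner_le_norm b' w
    have hn := norm_nonneg w
    calc heatKernel 1 w * (|inner ℝ a' w| * |inner ℝ b' w|)
        ≤ heatKernel 1 w * ((‖a'‖ * ‖w‖) * (‖b'‖ * ‖w‖)) := by gcongr
      _ = ‖a'‖ * ‖b'‖ * (‖w‖ ^ 2 * heatKernel 1 w) := by ring
      _ ≤ _ := by gcongr; linarith
  refine ext_inner_left ℝ fun e => ?_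
  have hi' := integral_inner (𝕜 := ℝ) hi e
  simp only [Pi.add_apply] at hi'
  rw [← hi']
  have hpt : ∀ w : E, (inner ℝ e (inner ℝ a w • unitScore w + c • unitScoreDeriv w b) : ℝ)
      = 1 / 2 * (heatKernel 1 w * (inner ℝ a w * inner ℝ e w))
        + c * (inner ℝ e b / 2 * heatKernel 1 w
          - 1 / 4 * (heatKernel 1 w * (inner ℝ b w * inner ℝ e w))) := fun w => by
    simp only [unitScore, unitScoreDeriv, inner_add_right, inner_sub_right, real_inner_smul_right]
    rw [real_inner_comm b w]
    ring
  simp_rw [hpt]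
  have hk1 := integrable_heatKernel (E := E) one_pos
  have hi3 : Integrable fun w : E => inner ℝ e b / 2 * heatKernel 1 w := hk1.const_mul _
  have hi4 : Integrable fun w : E => 1 / 4 * (heatKernel 1 w * (inner ℝ b w * inner ℝ e w)) :=
    (hsq b e).const_mul _
  have hi5 : Integrable fun w : E => c * (inner ℝ e b / 2 * heatKernel 1 w
      - 1 / 4 * (heatKernel 1 w * (inner ℝ b w * inner ℝ e w))) := (hi3.sub hi4).const_mul c
  rw [integral_add ((hsq a e).const_mul _) hi5, integral_const_mul, integral_const_mul,
    integral_sub hi3 hi4,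
    integral_const_mul, integral_const_mul, integral_heatKernel one_pos,
    integral_heatKernel_mul_inner_mul_inner, integral_heatKernel_mul_inner_mul_inner,
    real_inner_comm e a, real_inner_comm e b]
  ring

theorem integral_unitScore : ∫ w : E, unitScore w = 0 := by
  have h := integral_neg_eq_self (μ := (volume : Measure E)) (unitScore : E → E)
  have h2 : ∀ w : E, unitScore (-w) = -unitScore w := fun w => by
    simp [unitScore, heatKernel]
  simp_rw [h2, integral_neg] at h
  have h3 : (2 : ℝ) • ∫ w : E, unitScore w = 0 := by
    rw [two_smul]; nth_rewrite 1 [← h]; simp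
  simpa using h3

/-- The measure with density `q` with respect to Lebesgue measure. -/
noncomputable def densityMeasure (q : E → ℝ) : Measure E :=
  volume.withDensity fun x => ENNReal.ofReal (q x)

theorem integral_densityMeasure {F : Type*} [NormedAddCommGroup F] [NormedSpace ℝ F]
    (hq : LogLipschitzDensity q dq C) (f : E → F) :
    ∫ z, f z ∂(densityMeasure q) = ∫ z, q z • f z := by
  rw [densityMeasure, integral_withDensity_eq_integral_toReal_smul
    hq.continuous.measurable.ennreal_ofReal (by simp)]
  simp only [ENNReal.toReal_ofReal (hq.pos _).le]

theorem integrable_densityMeasure {F : Type*} [NormedAddCommGroup F] [NormedSpace ℝ F]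
    (hq : LogLipschitzDensity q dq C) {f : E → F} :
    Integrable f (densityMeasure q) ↔ Integrable fun z => q z • f z := by
  rw [densityMeasure, integrable_withDensity_iff_integrable_smul'
    hq.continuous.measurable.ennreal_ofReal (by simp)]
  simp only [ENNReal.toReal_ofReal (hq.pos _).le]

/-- The substitution `z = x + r w` in integrals against the Euler kernel at time `r²`. -/
theorem integral_eulerKernel_smul_rescale {F : Type*} [NormedAddCommGroup F] [NormedSpace ℝ F]
    (hq : LogLipschitzDensity q dq C) {r : ℝ} (hr : 0 < r) (x : E) (f : E → F) :
    ∫ z, eulerKernel g (r ^ 2) z x • f z ∂(densityMeasure q)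
      = ∫ w, (q (x + r • w) * heatKernel 1 (w - r • g (x + r • w))) • f (x + r • w) := by
  rw [integral_densityMeasure hq]
  have h1 := integral_add_left_eq_self (μ := (volume : Measure E))
    (fun z => q z • eulerKernel g (r ^ 2) z x • f z) x
  have h2 := Measure.integral_comp_smul_of_nonneg (volume : Measure E)
    (fun w => q (x + w) • eulerKernel g (r ^ 2) (x + w) x • f (x + w)) r (hR := hr.le)
  have hrD : r ^ Module.finrank ℝ E ≠ 0 := by positivity
  rw [eq_inv_smul_iff₀ hrD] at h2
  rw [← h1, ← h2, ← integral_smul]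
  refine integral_congr_ae (Eventually.of_forall fun w => ?_)
  have h3 : eulerKernel g (r ^ 2) (x + r • w) x
      = (r ^ Module.finrank ℝ E)⁻¹ * heatKernel 1 (w - r • g (x + r • w)) := by
    rw [eulerKernel, show x - (x + r • w - r ^ 2 • g (x + r • w))
      = r • -(w - r • g (x + r • w)) by module, heatKernel_scale hr, heatKernel,
      norm_neg, ← heatKernel]
  simp only
  rw [h3, smul_smul, smul_smul]
  congr 1
  field_simp

theorem tendsto_of_tendsto_comp_sq {α : Type*} {F : ℝ → α} {l : Filter α}
    (h : Tendsto (fun r : ℝ => F (r ^ 2)) (𝓝[>] 0) l) : Tendsto F (𝓝[>] 0) l := by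
  have h1 : Tendsto (fun s : ℝ => √s) (𝓝[>] 0) (𝓝[>] 0) := by
    refine tendsto_nhdsWithin_iff.2 ⟨?_, ?_⟩
    · simpa using (Real.continuous_sqrt.tendsto 0).mono_left nhdsWithin_le_nhds
    · filter_upwards [self_mem_nhdsWithin] with s hs using Real.sqrt_pos.2 hs
  refine (h.comp h1).congr' ?_
  filter_upwards [self_mem_nhdsWithin] with s hs
  simp only [Function.comp, Real.sq_sqrt (le_of_lt hs)]

theorem eventually_abs_le_nhdsGT_zero {r₀ : ℝ} (hr : 0 < r₀) : ∀ᶠ r : ℝ in 𝓝[>] 0, |r| ≤ r₀ := by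
  filter_upwards [Ioc_mem_nhdsGT hr] with r h
  rw [abs_of_pos h.1]
  exact h.2

section

variable (hq : LogLipschitzDensity q dq C) (hg : DriftGrowth g K)
include hq

theorem eulerDensity_rescale {r : ℝ} (hr : 0 < r) (x : E) :
    eulerDensity g (densityMeasure q) (r ^ 2) x
      = ∫ w, q (x + r • w) * heatKernel 1 (w - r • g (x + r • w)) := by
  have := integral_eulerKernel_smul_rescale (g := g) hq hr x (fun _ => (1 : ℝ))
  simpa [eulerDensity] using this

theorem eulerFlux_rescale {r : ℝ} (hr : 0 < r) (x : E) :
    eulerFlux g (densityMeasure q) (r ^ 2) x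
      = ∫ w, (q (x + r • w) * heatKernel 1 (w - r • g (x + r • w))) • g (x + r • w) :=
  integral_eulerKernel_smul_rescale hq hr x g

/-- The gradient of the density in the rescaled variable; the factor `r⁻¹` makes it a difference
quotient. -/
theorem eulerGrad_rescale {r : ℝ} (hr : 0 < r) (x : E) :
    eulerGrad g (densityMeasure q) (r ^ 2) x
      = r⁻¹ • ∫ w, q (x + r • w) • unitScore (w - r • g (x + r • w)) := by
  have := integral_eulerKernel_smul_rescale (g := g) hq hr x
    (fun z => (-(2 * r ^ 2)⁻¹) • (x - (z - r ^ 2 • g z)))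
  rw [eulerGrad, ← integral_smul]
  convert! this using 1
  · refine integral_congr_ae (Eventually.of_forall fun z => ?_)
    simp only [smul_smul]
    congr 1
    ring
  · refine integral_congr_ae (Eventually.of_forall fun w => ?_)
    simp only [unitScore, smul_smul]
    rw [show x - (x + r • w - r ^ 2 • g (x + r • w))
      = (-r) • (w - r • g (x + r • w)) by module, smul_smul]
    congr 1
    field_simp

include hg

/-- Uniform short-time bounds: the density, the flux and the gradient after a short Euler step are
comparable to the initial density up to `exp (2 δ (1 + |x|)²)`. -/
theorem exists_eulerDensity_shortTime_bounds :
    ∃ C' : ℝ, 0 < C' ∧ ∀ δ : ℝ, 0 < δ → ∃ s₀ : ℝ, 0 < s₀ ∧ ∀ s ∈ Ioc 0 s₀, ∀ x : E,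
      C'⁻¹ * q x * Real.exp (-(2 * δ * (1 + ‖x‖) ^ 2)) ≤ eulerDensity g (densityMeasure q) s x ∧
      eulerDensity g (densityMeasure q) s x ≤ C' * q x * Real.exp (2 * δ * (1 + ‖x‖) ^ 2) ∧
      ‖eulerFlux g (densityMeasure q) s x‖
        ≤ C' * q x * ((1 + ‖x‖) ^ 3 * Real.exp (2 * δ * (1 + ‖x‖) ^ 2)) ∧
      ‖eulerGrad g (densityMeasure q) s x‖
        ≤ C' * q x * ((1 + ‖x‖) ^ 3 * Real.exp (2 * δ * (1 + ‖x‖) ^ 2)) := by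
  obtain ⟨C₁, hC₁, H⟩ := exists_shortTime_domination hq hg
  have hqc := hq.continuous
  have hgc := hg.cont
  have hkc := continuous_heatKernel (E := E) 1
  have hI := fun M : ℕ => integrable_pow_mul_exp_neg_sq (E := E) M (b := 1 / 16) (by norm_num)
  simp only [one_div_mul_eq_div] at hI
  have hI2 := integrable_pow_mul_exp_neg_sq (E := E) 0 (b := 2) (by norm_num)
  simp only [pow_zero, one_mul] at hI2
  set I3 : ℝ := ∫ w : E, (1 + ‖w‖) ^ 3 * Real.exp (-(‖w‖ ^ 2 / 16)) with hI3
  set J : ℝ := ∫ w : E, heatKernel 1 (0 : E) * Real.exp (-(2 * ‖w‖ ^ 2)) with hJ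
  have hI3pos : 0 ≤ I3 := integral_nonneg fun w => by positivity
  have hk0 := heatKernel_pos one_pos (0 : E)
  have hJpos : 0 < J := by
    rw [hJ, integral_const_mul]
    refine mul_pos hk0 ?_
    have := GaussianFourier.integral_rexp_neg_mul_sq_norm (V := E) (b := 2) (by norm_num)
    simp only [neg_mul] at this
    rw [this]
    positivity
  have hle : ∀ M : ℕ, M ≤ 3 → ∫ w : E, (1 + ‖w‖) ^ M * Real.exp (-(‖w‖ ^ 2 / 16)) ≤ I3 :=
    fun M hM => integral_mono (hI M) (hI 3) fun w => by
      have : (1 + ‖w‖) ^ M ≤ (1 + ‖w‖) ^ 3 :=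
        pow_le_pow_right₀ (by linarith [norm_nonneg w]) hM
      simp only
      gcongr
  refine ⟨C₁ * I3 + C₁ * C₁ * I3 + J⁻¹, by positivity, fun δ hδ => ?_⟩
  set C' := C₁ * I3 + C₁ * C₁ * I3 + J⁻¹ with hC'
  have hJi : 0 < J⁻¹ := inv_pos.2 hJpos
  have hC'1 : C₁ * I3 ≤ C' := by have : 0 ≤ C₁ * C₁ * I3 := by positivity
                                 linarith
  have hC'2 : C₁ * C₁ * I3 ≤ C' := by have : 0 ≤ C₁ * I3 := by positivity
                                      linarith
  have hC'3 : C'⁻¹ ≤ J := by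
    refine inv_le_of_inv_le₀ hJpos ?_
    have : 0 ≤ C₁ * I3 := by positivity
    have : 0 ≤ C₁ * C₁ * I3 := by positivity
    linarith
  obtain ⟨r₀, hr0, Hr⟩ := H δ hδ
  refine ⟨r₀ ^ 2, by positivity, fun s hs x => ?_⟩
  -- In the variable `r = √s` the Euler kernel becomes a perturbation of the heat kernel at time
  -- `1`.
  obtain ⟨r, hr, hrs⟩ : ∃ r : ℝ, 0 < r ∧ r ^ 2 = s :=
    ⟨√s, Real.sqrt_pos.2 hs.1, Real.sq_sqrt hs.1.le⟩
  subst hrs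
  have hrr : |r| ≤ r₀ := by
    rw [abs_of_pos hr]
    exact (pow_le_pow_iff_left₀ hr.le hr0.le two_ne_zero).1 hs.2
  have hx : 1 ≤ 1 + ‖x‖ := by linarith [norm_nonneg x]
  have hqx := hq.pos x
  set e := Real.exp (2 * δ * (1 + ‖x‖) ^ 2) with he
  have he0 : 0 < e := Real.exp_pos _
  have hp1 : ∀ w : E, 0 < q (x + r • w) * heatKernel 1 (w - r • g (x + r • w)) := fun w =>
    mul_pos (hq.pos _) (heatKernel_pos one_pos _)
  have hpint : Integrable fun w : E => q (x + r • w) * heatKernel 1 (w - r • g (x + r • w)) := by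
    refine ((hI 0).const_mul (C₁ * q x * e)).mono' (Continuous.aestronglyMeasurable (by fun_prop))
      (Eventually.of_forall fun w => ?_)
    rw [Real.norm_of_nonneg (hp1 w).le]
    simpa using (Hr r hrr x w).1
  have hx3 : 1 + ‖x‖ ≤ (1 + ‖x‖) ^ 3 := le_self_pow₀ hx (by norm_num)
  refine ⟨?_, ?_, ?_, ?_⟩
  · rw [eulerDensity_rescale hq hr]
    calc C'⁻¹ * q x * Real.exp (-(2 * δ * (1 + ‖x‖) ^ 2))
        ≤ J * q x * Real.exp (-(2 * δ * (1 + ‖x‖) ^ 2)) := by gcongr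
      _ = ∫ w : E, q x * Real.exp (-(2 * δ * (1 + ‖x‖) ^ 2))
            * (heatKernel 1 (0 : E) * Real.exp (-(2 * ‖w‖ ^ 2))) := by
          rw [integral_const_mul]; ring
      _ ≤ _ := integral_mono ((hI2.const_mul _).const_mul _) hpint fun w => (Hr r hrr x w).2.1
  · rw [eulerDensity_rescale hq hr]
    calc ∫ w, q (x + r • w) * heatKernel 1 (w - r • g (x + r • w))
        ≤ ∫ w : E, C₁ * q x * e * ((1 + ‖w‖) ^ 0 * Real.exp (-(‖w‖ ^ 2 / 16))) :=
          integral_mono hpint ((hI 0).const_mul _) fun w => by simpa using (Hr r hrr x w).1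
      _ ≤ C₁ * q x * e * I3 := by
          rw [integral_const_mul]
          gcongr
          exact hle 0 (by norm_num)
      _ = C₁ * I3 * q x * e := by ring
      _ ≤ _ := by gcongr
  · rw [eulerFlux_rescale hq hr]
    calc ‖∫ w, (q (x + r • w) * heatKernel 1 (w - r • g (x + r • w))) • g (x + r • w)‖
        ≤ ∫ w : E, C₁ * q x * e * (C₁ * (1 + ‖x‖))
            * ((1 + ‖w‖) ^ 1 * Real.exp (-(‖w‖ ^ 2 / 16))) := by
          refine norm_integral_le_of_norm_le ((hI 1).const_mul _) (Eventually.of_forall fun w => ?_)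
          obtain ⟨h1, -, h3, -⟩ := Hr r hrr x w
          rw [norm_smul, Real.norm_of_nonneg (hp1 w).le]
          calc _ ≤ (C₁ * q x * e * Real.exp (-(‖w‖ ^ 2 / 16)))
                * (C₁ * (1 + ‖x‖) * (1 + ‖w‖)) :=
                mul_le_mul h1 h3 (norm_nonneg _) (by positivity)
            _ = _ := by ring
      _ ≤ C₁ * q x * e * (C₁ * (1 + ‖x‖)) * I3 := by
          rw [integral_const_mul]
          gcongr
          exact hle 1 (by norm_num)
      _ = C₁ * C₁ * I3 * q x * ((1 + ‖x‖) * e) := by ring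
      _ ≤ _ := by gcongr
  -- `unitScore` has mean zero, so subtracting its value at `r = 0` cancels the singular factor
  -- `r⁻¹`.
  · have h0 : ∫ w : E, q x • unitScore w = 0 := by rw [integral_smul, integral_unitScore, smul_zero]
    have hus := continuous_unitScore (E := E)
    have hd : ∀ w : E, ‖q (x + r • w) • unitScore (w - r • g (x + r • w)) - q x • unitScore w‖
        ≤ C₁ * q x * ((1 + ‖x‖) ^ 3 * e) * |r| *
          ((1 + ‖w‖) ^ 3 * Real.exp (-(‖w‖ ^ 2 / 16))) := fun w =>
      ((Hr r hrr x w).2.2.2).trans_eq (by ring)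
    have hdi : Integrable fun w : E =>
        q (x + r • w) • unitScore (w - r • g (x + r • w)) - q x • unitScore w :=
      ((hI 3).const_mul _).mono' (Continuous.aestronglyMeasurable (by fun_prop))
        (Eventually.of_forall hd)
    have h1 : ∫ w : E, q (x + r • w) • unitScore (w - r • g (x + r • w))
        = ∫ w : E, (q (x + r • w) • unitScore (w - r • g (x + r • w)) - q x • unitScore w) := by
      have h2 : Integrable fun w : E => q x • unitScore w := integrable_unitScore.smul (q x)
      have h3 : Integrable fun w : E => q (x + r • w) • unitScore (w - r • g (x + r • w)) :=
        (hdi.add h2).congr (Eventually.of_forall fun w => by simp)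
      rw [integral_sub h3 h2, h0, sub_zero]
    rw [eulerGrad_rescale hq hr, h1, norm_smul, norm_inv, Real.norm_eq_abs,
      inv_mul_le_iff₀ (by positivity)]
    refine (norm_integral_le_of_norm_le ((hI 3).const_mul _) (Eventually.of_forall hd)).trans ?_
    rw [integral_const_mul, ← hI3]
    calc C₁ * q x * ((1 + ‖x‖) ^ 3 * e) * |r| * I3
        = |r| * (C₁ * I3 * q x * ((1 + ‖x‖) ^ 3 * e)) := by ring
      _ ≤ _ := by gcongr

theorem tendsto_eulerDensity (x : E) :
    Tendsto (fun s => eulerDensity g (densityMeasure q) s x) (𝓝[>] 0) (𝓝 (q x)) := by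
  obtain ⟨C₁, hC₁, H⟩ := exists_shortTime_domination hq hg
  obtain ⟨r₀, hr0, Hr⟩ := H 1 one_pos
  have hqc := hq.continuous
  have hgc := hg.cont
  have hkc := continuous_heatKernel (E := E) 1
  have hI := integrable_pow_mul_exp_neg_sq (E := E) 0 (b := 1 / 16) (by norm_num)
  simp only [one_div_mul_eq_div] at hI
  refine tendsto_of_tendsto_comp_sq ?_
  have hlim : ∫ w : E, q x * heatKernel 1 w = q x := by
    rw [integral_const_mul, integral_heatKernel one_pos, mul_one]
  rw [← hlim]
  refine (tendsto_integral_filter_of_dominated_convergence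
    (F := fun (r : ℝ) w => q (x + r • w) * heatKernel 1 (w - r • g (x + r • w))) _
    (Eventually.of_forall fun r => Continuous.aestronglyMeasurable (by fun_prop)) ?_
    (hI.const_mul (C₁ * q x * Real.exp (2 * 1 * (1 + ‖x‖) ^ 2)))
    (Eventually.of_forall fun w => ?_)).congr' ?_
  · filter_upwards [eventually_abs_le_nhdsGT_zero hr0] with r hr
    refine Eventually.of_forall fun w => ?_
    rw [Real.norm_of_nonneg (mul_pos (hq.pos _) (heatKernel_pos one_pos _)).le]
    simpa using (Hr r hr x w).1
  · have h : Continuous fun r : ℝ => q (x + r • w) * heatKernel 1 (w - r • g (x + r • w)) := by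
      fun_prop
    simpa using (h.tendsto 0).mono_left nhdsWithin_le_nhds
  · filter_upwards [self_mem_nhdsWithin] with r hr
    exact (eulerDensity_rescale hq hr x).symm

theorem tendsto_eulerFlux (x : E) :
    Tendsto (fun s => eulerFlux g (densityMeasure q) s x) (𝓝[>] 0) (𝓝 (q x • g x)) := by
  obtain ⟨C₁, hC₁, H⟩ := exists_shortTime_domination hq hg
  obtain ⟨r₀, hr0, Hr⟩ := H 1 one_pos
  have hqc := hq.continuous
  have hgc := hg.cont
  have hkc := continuous_heatKernel (E := E) 1
  have hI := integrable_pow_mul_exp_neg_sq (E := E) 1 (b := 1 / 16) (by norm_num)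
  simp only [one_div_mul_eq_div] at hI
  have hqx := hq.pos x
  refine tendsto_of_tendsto_comp_sq ?_
  have hlim : ∫ w : E, (q x * heatKernel 1 w) • g x = q x • g x := by
    rw [integral_smul_const, integral_const_mul, integral_heatKernel one_pos, mul_one]
  rw [← hlim]
  refine (tendsto_integral_filter_of_dominated_convergence
    (F := fun (r : ℝ) w => (q (x + r • w) * heatKernel 1 (w - r • g (x + r • w))) • g (x + r • w)) _
    (Eventually.of_forall fun r => Continuous.aestronglyMeasurable (by fun_prop)) ?_
    (hI.const_mul (C₁ * q x * Real.exp (2 * 1 * (1 + ‖x‖) ^ 2) * (C₁ * (1 + ‖x‖))))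
    (Eventually.of_forall fun w => ?_)).congr' ?_
  · filter_upwards [eventually_abs_le_nhdsGT_zero hr0] with r hr
    refine Eventually.of_forall fun w => ?_
    obtain ⟨h1, -, h3, -⟩ := Hr r hr x w
    rw [norm_smul, Real.norm_of_nonneg (mul_pos (hq.pos _) (heatKernel_pos one_pos _)).le]
    exact (mul_le_mul h1 h3 (norm_nonneg _) (by positivity)).trans_eq (by ring)
  · have h : Continuous fun r : ℝ =>
        (q (x + r • w) * heatKernel 1 (w - r • g (x + r • w))) • g (x + r • w) := by
      fun_prop
    simpa using (h.tendsto 0).mono_left nhdsWithin_le_nhds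
  · filter_upwards [self_mem_nhdsWithin] with r hr
    exact (eulerFlux_rescale hq hr x).symm

/-- The gradient of the density after a short Euler step converges to the initial gradient: the
rescaled gradient is a difference quotient in `r = √s`, whose limit is identified by the second
moments of the Gaussian. -/
theorem tendsto_eulerGrad (x : E) :
    Tendsto (fun s => eulerGrad g (densityMeasure q) s x) (𝓝[>] 0) (𝓝 (dq x)) := by
  obtain ⟨C₁, hC₁, H⟩ := exists_shortTime_domination hq hg
  obtain ⟨r₀, hr0, Hr⟩ := H 1 one_pos
  have hqc := hq.continuous
  have hgc := hg.cont
  have hus := continuous_unitScore (E := E)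
  have hI := integrable_pow_mul_exp_neg_sq (E := E) 3 (b := 1 / 16) (by norm_num)
  simp only [one_div_mul_eq_div] at hI
  have hqx := hq.pos x
  refine tendsto_of_tendsto_comp_sq ?_
  have hlim := integral_unitScore_terms (dq x) (-(g x)) (q x)
  rw [← hlim]
  set F : ℝ → E → E := fun r w => q (x + r • w) • unitScore (w - r • g (x + r • w)) with hF
  set B : E → ℝ := fun w => C₁ * q x * ((1 + ‖x‖) ^ 3 * Real.exp (2 * 1 * (1 + ‖x‖) ^ 2)) *
    ((1 + ‖w‖) ^ 3 * Real.exp (-(‖w‖ ^ 2 / 16))) with hB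
  have hBi : Integrable B := hI.const_mul _
  have hFc : ∀ r, Continuous (F r) := fun r => by fun_prop
  have hF0 : ∀ w, F 0 w = q x • unitScore w := fun w => by simp [hF]
  have hFi0 : Integrable (F 0) := by
    simp_rw [funext hF0]
    exact integrable_unitScore.smul (q x)
  have hFd : ∀ r, |r| ≤ r₀ → ∀ w, ‖F r w - F 0 w‖ ≤ B w * |r| := fun r hr w => by
    rw [hF0]
    exact (Hr r hr x w).2.2.2
  refine (tendsto_integral_filter_of_dominated_convergence
    (F := fun (r : ℝ) w => r⁻¹ • (F r w - F 0 w)) B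
    (Eventually.of_forall fun r => Continuous.aestronglyMeasurable
      (((hFc r).sub (hFc 0)).const_smul _)) ?_ hBi (Eventually.of_forall fun w => ?_)).congr' ?_
  · filter_upwards [eventually_abs_le_nhdsGT_zero hr0, self_mem_nhdsWithin] with r hr hr1
    refine Eventually.of_forall fun w => ?_
    have hr2 : 0 < |r| := abs_pos.2 (ne_of_gt hr1)
    rw [norm_smul, norm_inv, Real.norm_eq_abs, inv_mul_le_iff₀ hr2, mul_comm]
    exact hFd r hr w
  -- `g` is only continuous, but `r • g (x + r • w)` is differentiable at `0` because of the factor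
  -- `r`.
  · have h1 : HasDerivAt (fun r : ℝ => r • g (x + r • w)) (g x) 0 := by
      rw [hasDerivAt_iff_tendsto_slope_zero]
      have h : Continuous fun r : ℝ => g (x + r • w) := by fun_prop
      have h2 : Tendsto (fun r : ℝ => g (x + r • w)) (𝓝[≠] 0) (𝓝 (g x)) := by
        simpa using (h.tendsto 0).mono_left nhdsWithin_le_nhds
      refine h2.congr' ?_
      filter_upwards [self_mem_nhdsWithin] with r hr
      simp only [zero_add, zero_smul, sub_zero, smul_smul]
      rw [inv_mul_cancel₀ hr, one_smul]
    have h2 : HasDerivAt (fun r : ℝ => unitScore (w - r • g (x + r • w)))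
        (unitScoreDeriv w (-(g x))) 0 := by
      have := hasDerivAt_unitScore (h1.const_sub w)
      simpa using this
    have h3 : HasDerivAt (fun r : ℝ => q (x + r • w)) (inner ℝ (dq x) w) 0 := by
      have h4 : HasDerivAt (fun r : ℝ => x + r • w) w 0 := by
        simpa using ((hasDerivAt_id (0 : ℝ)).smul_const w).const_add x
      have h5 : HasFDerivAt q (innerSL ℝ (dq x)) (x + (0 : ℝ) • w) := by
        simpa using hq.hasFDerivAt x
      exact h5.comp_hasDerivAt 0 h4
    have h4 := (h3.smul h2).tendsto_slope_zero
    simp only [zero_add, zero_smul, sub_zero, add_zero] at h4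
    have h5 := h4.mono_left (nhdsWithin_mono (0 : ℝ) fun r (hr : r ∈ Ioi (0 : ℝ)) => ne_of_gt hr)
    rw [add_comm]
    exact h5
  · filter_upwards [self_mem_nhdsWithin, eventually_abs_le_nhdsGT_zero hr0] with r hr hr1
    have hd : Integrable fun w => F r w - F 0 w :=
      (hBi.mul_const |r|).mono' ((hFc r).sub (hFc 0)).aestronglyMeasurable
        (Eventually.of_forall (hFd r hr1))
    have h1 : Integrable (F r) := (hd.add hFi0).congr (Eventually.of_forall fun w => by simp)
    rw [eulerGrad_rescale hq hr, integral_smul, integral_sub h1 hFi0]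
    simp_rw [hF0]
    rw [integral_smul, integral_unitScore, smul_zero, sub_zero]

end

end

section

variable {E : Type*} [NormedAddCommGroup E] [InnerProductSpace ℝ E] [FiniteDimensional ℝ E]
  [MeasurableSpace E] [BorelSpace E] {g : E → E} {K : ℝ} {q : E → ℝ} {dq : E → E} {C : ℝ}

/-! ### Entropy dissipation at the initial time -/

/-- The bound `exp (δ (1 + |x|)²)` lost in the short-time estimates is absorbed by a Gaussian
moment of the initial density once `δ` is small. -/
theorem integrable_density_mul_pow_mul_exp (hq : LogLipschitzDensity q dq C) {κ : ℝ} (hκ : 0 < κ)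
    (hint : Integrable fun x => q x * Real.exp (κ * ‖x‖ ^ 2)) (M : ℕ) {δ : ℝ} (hδ : 0 ≤ δ)
    (hδκ : 4 * δ ≤ κ) :
    Integrable fun x => q x * ((1 + ‖x‖) ^ M * Real.exp (δ * (1 + ‖x‖) ^ 2)) := by
  have hqc := hq.continuous
  obtain ⟨C₁, hC₁, h1⟩ := pow_le_mul_exp_sq (half_pos hκ) M
  refine (hint.const_mul (C₁ * Real.exp (2 * δ))).mono'
    (Continuous.aestronglyMeasurable (by fun_prop)) (Eventually.of_forall fun x => ?_)
  have hqx := hq.pos x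
  rw [Real.norm_of_nonneg (by positivity)]
  have h2 : Real.exp (δ * (1 + ‖x‖) ^ 2)
      ≤ Real.exp (2 * δ) * Real.exp (κ / 2 * ‖x‖ ^ 2) := by
    rw [← Real.exp_add, Real.exp_le_exp]
    have h3 : (1 + ‖x‖) ^ 2 ≤ 2 + 2 * ‖x‖ ^ 2 := by nlinarith [sq_nonneg (1 - ‖x‖)]
    have h4 := mul_le_mul_of_nonneg_left h3 hδ
    have h5 := mul_le_mul_of_nonneg_right hδκ (sq_nonneg ‖x‖)
    linarith
  calc q x * ((1 + ‖x‖) ^ M * Real.exp (δ * (1 + ‖x‖) ^ 2))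
      ≤ q x * ((C₁ * Real.exp (κ / 2 * ‖x‖ ^ 2))
          * (Real.exp (2 * δ) * Real.exp (κ / 2 * ‖x‖ ^ 2))) := by
        gcongr
        exact h1 _ (norm_nonneg x)
    _ = C₁ * Real.exp (2 * δ) * (q x * (Real.exp (κ / 2 * ‖x‖ ^ 2)
          * Real.exp (κ / 2 * ‖x‖ ^ 2))) := by ring
    _ = _ := by rw [← Real.exp_add]; ring_nf

theorem integrable_density_mul (hq : LogLipschitzDensity q dq C) {κ : ℝ} (hκ : 0 < κ)
    (hint : Integrable fun x => q x * Real.exp (κ * ‖x‖ ^ 2)) {φ : E → ℝ} (hφ : Continuous φ)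
    {B : ℝ} {M : ℕ} (hB : ∀ x, |φ x| ≤ B * (1 + ‖x‖) ^ M) :
    Integrable fun x => q x * φ x := by
  have h := (integrable_density_mul_pow_mul_exp hq hκ hint M le_rfl (by linarith)).const_mul B
  simp only [zero_mul, Real.exp_zero, mul_one] at h
  refine h.mono' ((hq.continuous.mul hφ).aestronglyMeasurable) (Eventually.of_forall fun x => ?_)
  have hqx := hq.pos x
  rw [norm_mul, Real.norm_of_nonneg hqx.le, Real.norm_eq_abs]
  calc q x * |φ x| ≤ q x * (B * (1 + ‖x‖) ^ M) := by gcongr; exact hB x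
    _ = _ := by ring

theorem integrable_one_add_norm_pow_densityMeasure (hq : LogLipschitzDensity q dq C) {κ : ℝ}
    (hκ : 0 < κ) (hint : Integrable fun x => q x * Real.exp (κ * ‖x‖ ^ 2)) (M : ℕ) :
    Integrable (fun z => (1 + ‖z‖) ^ M) (densityMeasure q) := by
  rw [integrable_densityMeasure hq]
  exact integrable_density_mul hq hκ hint (by fun_prop) (B := 1) (M := M) fun x => by
    rw [abs_of_nonneg (by positivity), one_mul]

section

variable (hq : LogLipschitzDensity q dq C) (hg : DriftGrowth g K)
  {κ : ℝ} (hκ : 0 < κ) (hint : Integrable fun x => q x * Real.exp (κ * ‖x‖ ^ 2))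
  [IsProbabilityMeasure (densityMeasure q)]
  {u : E → ℝ} {h : E → E} {Cu : ℝ} {N : ℕ} (hu : PolyPotential u h Cu N)
include hq hg hκ hint hu

/-- The entropy is continuous from the right at the initial time, by dominated convergence. -/
theorem tendsto_integral_entropy :
    Tendsto (fun s => ∫ x, eulerDensity g (densityMeasure q) s x
        * (Real.log (eulerDensity g (densityMeasure q) s x) + u x)) (𝓝[>] 0)
      (𝓝 (∫ x, q x * (Real.log (q x) + u x))) := by
  obtain ⟨C₁, hC₁, H⟩ := exists_eulerDensity_shortTime_bounds hq hg
  obtain ⟨C₂, hC₂, hlog⟩ := hq.exists_abs_log_le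
  -- The bound involves `exp (2 δ (1 + |x|)²)`, and a Gaussian moment absorbs up to `κ / 4`.
  set δ := κ / 8 with hδ
  obtain ⟨s₀, hs₀, Hs⟩ := H δ (by positivity)
  have hCu := hu.nonneg
  have huc := hu.continuous
  set B := C₁ * (|Real.log C₁| + C₂ + 2 * δ + Cu) with hB
  refine tendsto_integral_filter_of_dominated_convergence
    (fun x => B * (q x * ((1 + ‖x‖) ^ (N + 2) * Real.exp (2 * δ * (1 + ‖x‖) ^ 2)))) ?_ ?_
    ((integrable_density_mul_pow_mul_exp hq hκ hint (N + 2) (by positivity)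
      (by linarith)).const_mul B) (Eventually.of_forall fun x => ?_)
  · filter_upwards [self_mem_nhdsWithin] with s hs
    have h1 := continuous_eulerDensity (μ := densityMeasure q) hg hs
    have h2 : ∀ x, eulerDensity g (densityMeasure q) s x ≠ 0 := fun x =>
      (eulerDensity_pos hg hs x).ne'
    exact (h1.mul ((h1.log h2).add huc)).aestronglyMeasurable
  · filter_upwards [Ioc_mem_nhdsGT hs₀] with s hs
    refine Eventually.of_forall fun x => ?_
    obtain ⟨h1, h2, -, -⟩ := Hs s hs x
    have hp := eulerDensity_pos (μ := densityMeasure q) hg hs.1 x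
    have hqx := hq.pos x
    have hx : (1 : ℝ) ≤ 1 + ‖x‖ := by linarith [norm_nonneg x]
    set W := (1 + ‖x‖) ^ 2 with hW
    have hW1 : 1 ≤ W := one_le_pow₀ hx
    have hlp : |Real.log (eulerDensity g (densityMeasure q) s x)|
        ≤ (|Real.log C₁| + C₂ + 2 * δ) * W := by
      have hl1 := Real.log_le_log (by positivity) h1
      have hl2 := Real.log_le_log hp h2
      rw [Real.log_mul (by positivity) (by positivity), Real.log_mul (by positivity) hqx.ne',
        Real.log_exp, Real.log_inv] at hl1
      rw [Real.log_mul (by positivity) (by positivity), Real.log_mul (by positivity) hqx.ne',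
        Real.log_exp] at hl2
      have h3 := abs_le.1 (hlog x)
      have h4 := le_abs_self (Real.log C₁)
      have h5 := neg_abs_le (Real.log C₁)
      have h6 : |Real.log C₁| ≤ |Real.log C₁| * W := le_mul_of_one_le_right (abs_nonneg _) hW1
      rw [abs_le]
      constructor <;> nlinarith
    have hWN : W ≤ (1 + ‖x‖) ^ (N + 2) := pow_le_pow_right₀ hx (by omega)
    have hNN : (1 + ‖x‖) ^ N ≤ (1 + ‖x‖) ^ (N + 2) := pow_le_pow_right₀ hx (by omega)
    rw [norm_mul, Real.norm_of_nonneg hp.le, Real.norm_eq_abs]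
    calc eulerDensity g (densityMeasure q) s x
          * |Real.log (eulerDensity g (densityMeasure q) s x) + u x|
        ≤ (C₁ * q x * Real.exp (2 * δ * W))
          * ((|Real.log C₁| + C₂ + 2 * δ) * (1 + ‖x‖) ^ (N + 2) + Cu * (1 + ‖x‖) ^ (N + 2)) := by
          refine mul_le_mul h2 ((abs_add_le _ _).trans (add_le_add ?_ ?_)) (abs_nonneg _)
            (by positivity)
          · exact hlp.trans (by gcongr)
          · exact (hu.abs_le x).trans (by gcongr)
      _ = _ := by rw [hB]; ring
  · have h1 := tendsto_eulerDensity hq hg x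
    exact h1.mul ((h1.log (hq.pos x).ne').add_const _)

/-- The dissipation is continuous from the right at the initial time, by dominated convergence. -/
theorem tendsto_integral_dissipation :
    Tendsto (fun s => ∫ x, (inner ℝ (eulerScore g (densityMeasure q) h s x)
        (eulerGrad g (densityMeasure q) s x + eulerFlux g (densityMeasure q) s x) : ℝ)) (𝓝[>] 0)
      (𝓝 (∫ x, inner ℝ ((q x)⁻¹ • dq x + h x) (dq x + q x • g x))) := by
  obtain ⟨C₁, hC₁, H⟩ := exists_eulerDensity_shortTime_bounds hq hg
  -- The bound involves `exp (6 δ (1 + |x|)²)`: one factor `exp (2 δ (1 + |x|)²)` each from the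
  -- inverse of the density, the gradient in the score, and the sum of gradient and flux.
  set δ := κ / 24 with hδ
  obtain ⟨s₀, hs₀, Hs⟩ := H δ (by positivity)
  have hCu := hu.nonneg
  have hhc := hu.cont
  set B := (C₁ * C₁ + Cu) * (2 * C₁) with hB
  refine tendsto_integral_filter_of_dominated_convergence
    (fun x => B * (q x * ((1 + ‖x‖) ^ (N + 6) * Real.exp (6 * δ * (1 + ‖x‖) ^ 2)))) ?_ ?_
    ((integrable_density_mul_pow_mul_exp hq hκ hint (N + 6) (by positivity)
      (by linarith)).const_mul B) (Eventually.of_forall fun x => ?_)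
  · filter_upwards [self_mem_nhdsWithin] with s hs
    have h1 := continuous_eulerDensity (μ := densityMeasure q) hg hs
    have h2 : ∀ x, eulerDensity g (densityMeasure q) s x ≠ 0 := fun x =>
      (eulerDensity_pos hg hs x).ne'
    have h3 := continuous_eulerGrad (μ := densityMeasure q) hg hs
    have h4 := aestronglyMeasurable_eulerFlux (μ := densityMeasure q) hg s
    have h5 : Continuous (eulerScore g (densityMeasure q) h s) := ((h1.inv₀ h2).smul h3).add hhc
    exact h5.aestronglyMeasurable.inner (h3.aestronglyMeasurable.add h4)
  · filter_upwards [Ioc_mem_nhdsGT hs₀] with s hs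
    refine Eventually.of_forall fun x => ?_
    obtain ⟨h1, h2, h3, h4⟩ := Hs s hs x
    have hp := eulerDensity_pos (μ := densityMeasure q) hg hs.1 x
    have hqx := hq.pos x
    have hx : (1 : ℝ) ≤ 1 + ‖x‖ := by linarith [norm_nonneg x]
    set W := (1 + ‖x‖) ^ 2 with hW
    set e := Real.exp (2 * δ * W) with he
    have he1 : 1 ≤ e := Real.one_le_exp (by positivity)
    have hS : ‖eulerScore g (densityMeasure q) h s x‖
        ≤ (C₁ * C₁ + Cu) * ((1 + ‖x‖) ^ (N + 3) * e ^ 2) := by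
      rw [eulerScore]
      have hpi : (eulerDensity g (densityMeasure q) s x)⁻¹ ≤ C₁ * (q x)⁻¹ * e := by
        rw [inv_le_comm₀ hp (by positivity)]
        convert! h1 using 1
        rw [Real.exp_neg, he]
        field_simp
      have hx3 : (1 + ‖x‖) ^ 3 ≤ (1 + ‖x‖) ^ (N + 3) := pow_le_pow_right₀ hx (by omega)
      have hxN : (1 + ‖x‖) ^ N ≤ (1 + ‖x‖) ^ (N + 3) * e ^ 2 :=
        (pow_le_pow_right₀ hx (by omega)).trans
          (le_mul_of_one_le_right (by positivity) (one_le_pow₀ he1))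
      refine (norm_add_le _ _).trans ?_
      rw [norm_smul, norm_inv, Real.norm_of_nonneg hp.le]
      calc (eulerDensity g (densityMeasure q) s x)⁻¹ * ‖eulerGrad g (densityMeasure q) s x‖ + ‖h x‖
          ≤ (C₁ * (q x)⁻¹ * e) * (C₁ * q x * ((1 + ‖x‖) ^ 3 * e)) + Cu * (1 + ‖x‖) ^ N :=
            add_le_add (mul_le_mul hpi h4 (norm_nonneg _) (by positivity)) (hu.norm_le x)
        _ = C₁ * C₁ * ((1 + ‖x‖) ^ 3 * e ^ 2) + Cu * (1 + ‖x‖) ^ N := by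
            field_simp
        _ ≤ C₁ * C₁ * ((1 + ‖x‖) ^ (N + 3) * e ^ 2) + Cu * ((1 + ‖x‖) ^ (N + 3) * e ^ 2) := by
            gcongr
        _ = _ := by ring
    have hG : ‖eulerGrad g (densityMeasure q) s x + eulerFlux g (densityMeasure q) s x‖
        ≤ 2 * C₁ * q x * ((1 + ‖x‖) ^ 3 * e) :=
      (norm_add_le _ _).trans (by linarith)
    refine (norm_inner_le_norm _ _).trans ((mul_le_mul hS hG (norm_nonneg _)
      (by positivity)).trans_eq ?_)
    have he6 : Real.exp (6 * δ * W) = e ^ 3 := by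
      rw [he, ← Real.exp_nat_mul]; congr 1; push_cast; ring
    rw [he6, hB]
    ring
  · have h1 := tendsto_eulerDensity hq hg x
    have h2 := tendsto_eulerGrad hq hg x
    have h3 := tendsto_eulerFlux hq hg x
    exact (((h1.inv₀ (hq.pos x).ne').smul h2).add_const _).inner (h2.add h3)

/-- **Entropy dissipation** along the interpolation, from the right at the initial time: the
entropy is continuous there and its derivative at positive times has a limit. -/
theorem hasDerivWithinAt_entropy_zero {f : ℝ → ℝ}
    (hf0 : f 0 = ∫ x, q x * (Real.log (q x) + u x))
    (hf : ∀ s, 0 < s → f s = ∫ x, eulerDensity g (densityMeasure q) s x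
        * (Real.log (eulerDensity g (densityMeasure q) s x) + u x)) :
    HasDerivWithinAt f (-∫ x, inner ℝ ((q x)⁻¹ • dq x + h x) (dq x + q x • g x)) (Ici 0) 0 := by
  have hμ := integrable_one_add_norm_pow_densityMeasure hq hκ hint
  have hd : ∀ s, 0 < s → HasDerivAt f (-∫ x, inner ℝ (eulerScore g (densityMeasure q) h s x)
      (eulerGrad g (densityMeasure q) s x + eulerFlux g (densityMeasure q) s x)) s := fun s hs =>
    (hasDerivAt_entropy hg hμ hs hu).congr_of_eventuallyEq <| by
      filter_upwards [lt_mem_nhds hs] with r hr using hf r hr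
  refine hasDerivWithinAt_Ici_of_tendsto_deriv (s := Ioi 0)
    (fun s hs => (hd s hs).differentiableAt.differentiableWithinAt) ?_ self_mem_nhdsWithin ?_
  · rw [ContinuousWithinAt, hf0]
    refine (tendsto_integral_entropy hq hg hκ hint hu).congr' ?_
    filter_upwards [self_mem_nhdsWithin] with s hs using (hf s hs).symm
  · refine (tendsto_integral_dissipation hq hg hκ hint hu).neg.congr' ?_
    filter_upwards [self_mem_nhdsWithin] with s hs using (hd s hs).deriv.symm

end

/-! ### The dissipation inequality -/

/-- Young's inequality with the weight that leaves `3/4` of the Fisher information. -/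
theorem real_inner_le_quarter_norm_sq_add (S v : E) :
    (inner ℝ S v : ℝ) ≤ 1 / 4 * ‖S‖ ^ 2 + ‖v‖ ^ 2 := by
  have h := sq_nonneg ‖(1 / 2 : ℝ) • S - v‖
  rw [norm_sub_sq_real, norm_smul, real_inner_smul_left, mul_pow, Real.norm_of_nonneg
    (by norm_num)] at h
  linarith

theorem norm_sub_drift_le (hg : DriftGrowth g K) {u : E → ℝ} {h : E → E} {Cu : ℝ} {N : ℕ}
    (hu : PolyPotential u h Cu N) (z x : E) :
    ‖h x - g z‖ ≤ (Cu + K) * ((1 + ‖z‖) ^ (N + 1) * (1 + ‖x‖) ^ (N + 1)) := by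
  have hK := hg.nonneg
  have hCu := hu.nonneg
  have hz : (1 : ℝ) ≤ 1 + ‖z‖ := by linarith [norm_nonneg z]
  have hx : (1 : ℝ) ≤ 1 + ‖x‖ := by linarith [norm_nonneg x]
  have h1 : (1 + ‖x‖) ^ N ≤ (1 + ‖z‖) ^ (N + 1) * (1 + ‖x‖) ^ (N + 1) :=
    (pow_le_pow_right₀ hx (Nat.le_succ N)).trans
      (le_mul_of_one_le_left (by positivity) (one_le_pow₀ hz))
  have h2 : 1 + ‖z‖ ≤ (1 + ‖z‖) ^ (N + 1) * (1 + ‖x‖) ^ (N + 1) :=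
    (le_self_pow₀ hz (by omega)).trans
      (le_mul_of_one_le_right (by positivity) (one_le_pow₀ hx))
  calc ‖h x - g z‖ ≤ Cu * (1 + ‖x‖) ^ N + K * (1 + ‖z‖) :=
        (norm_sub_le _ _).trans (add_le_add (hu.norm_le x) (hg.bound z))
    _ ≤ Cu * ((1 + ‖z‖) ^ (N + 1) * (1 + ‖x‖) ^ (N + 1))
        + K * ((1 + ‖z‖) ^ (N + 1) * (1 + ‖x‖) ^ (N + 1)) := by gcongr
    _ = _ := by ring

theorem integrable_drift_error_euler {μ : Measure E} [SFinite μ] (hg : DriftGrowth g K)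
    (hμ : ∀ M : ℕ, Integrable (fun z => (1 + ‖z‖) ^ M) μ) {s : ℝ} (hs : 0 < s) {u : E → ℝ}
    {h : E → E} {Cu : ℝ} {N : ℕ} (hu : PolyPotential u h Cu N) :
    Integrable (fun w : E × E => eulerKernel g s w.1 w.2 • ‖h w.2 - g w.1‖ ^ 2)
      (μ.prod volume) := by
  have hhc := hu.cont
  have hgc := hg.cont
  have hK := hg.nonneg
  have hCu := hu.nonneg
  refine integrable_eulerKernel_smul hg hμ hs (C := (Cu + K) ^ 2) (N := (N + 1) * 2)
    (Continuous.aestronglyMeasurable (by fun_prop)) fun z x => ?_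
  rw [Real.norm_of_nonneg (by positivity), pow_mul, pow_mul, ← mul_pow, ← mul_pow]
  gcongr
  exact norm_sub_drift_le hg hu z x

/-- The dissipation of the entropy is at most `-3/4` of the Fisher information plus the mean
squared error of the drift: `p h - E[g(X) | x] p` is the conditional expectation of `h(x) - g(X)`,
and Young's inequality `⟨S, v⟩ ≤ |S|² / 4 + |v|²` applies inside the conditional expectation. -/
theorem neg_integral_inner_eulerScore_le {μ : Measure E} [IsProbabilityMeasure μ]
    (hg : DriftGrowth g K) (hμ : ∀ M : ℕ, Integrable (fun z => (1 + ‖z‖) ^ M) μ) {s : ℝ}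
    (hs : 0 < s) {u : E → ℝ} {h : E → E} {Cu : ℝ} {N : ℕ} (hu : PolyPotential u h Cu N) :
    -∫ x, inner ℝ (eulerScore g μ h s x) (eulerGrad g μ s x + eulerFlux g μ s x)
      ≤ -(3 / 4) * (∫ x, eulerDensity g μ s x * ‖eulerScore g μ h s x‖ ^ 2)
        + ∫ w, ‖h (w.1 - s • g w.1 + √(2 * s) • w.2) - g w.1‖ ^ 2 ∂(μ.prod (stdGaussian E)) := by
  have hhc := hu.cont
  have hgc := hg.cont
  have hi := integrable_drift_error_euler hg hμ hs hu
  have he : ∫ w, ‖h (w.1 - s • g w.1 + √(2 * s) • w.2) - g w.1‖ ^ 2 ∂(μ.prod (stdGaussian E))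
      = ∫ x, ∫ z, eulerKernel g s z x • ‖h x - g z‖ ^ 2 ∂μ := by
    rw [integral_euler hg hs (Φ := fun w => ‖h w.2 - g w.1‖ ^ 2) (by fun_prop),
      integral_prod_symm _ hi]
  have hfi := integrable_eulerDensity_mul_norm_eulerScore_sq hg hμ hs hu
  rw [he]
  obtain ⟨C', hC'⟩ := exists_polyPotential_log_eulerDensity (μ := μ) hg hs hu
  have hSc := hC'.cont
  have hC'0 := hC'.nonneg
  have hK := hg.nonneg
  have hCu := hu.nonneg
  have hci : Integrable (fun w : E × E => eulerKernel g s w.1 w.2 •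
      (inner ℝ (eulerScore g μ h s w.2) (h w.2 - g w.1) : ℝ)) (μ.prod volume) := by
    refine integrable_eulerKernel_smul hg hμ hs (C := C' * (Cu + K)) (N := (N + 2) + (N + 1))
      (Continuous.aestronglyMeasurable (by fun_prop)) fun z x => ?_
    have hz : (1 : ℝ) ≤ 1 + ‖z‖ := by linarith [norm_nonneg z]
    have hx : (1 : ℝ) ≤ 1 + ‖x‖ := by linarith [norm_nonneg x]
    refine (norm_inner_le_norm _ _).trans ((mul_le_mul (hC'.norm_le x)
      (norm_sub_drift_le hg hu z x) (norm_nonneg _) (by positivity)).trans ?_)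
    calc C' * (1 + ‖x‖) ^ (N + 2) * ((Cu + K) * ((1 + ‖z‖) ^ (N + 1) * (1 + ‖x‖) ^ (N + 1)))
        = C' * (Cu + K) * ((1 + ‖z‖) ^ (N + 1) * (1 + ‖x‖) ^ ((N + 2) + (N + 1))) := by ring
      _ ≤ _ := by
        gcongr <;> omega
  -- With `S` the score, `∇p = p (S - h)`, so `∇p + J = p S - (p h - J)` for the flux `J`.
  have hpt : ∀ x, -(inner ℝ (eulerScore g μ h s x) (eulerGrad g μ s x + eulerFlux g μ s x) : ℝ)
      = -(eulerDensity g μ s x * ‖eulerScore g μ h s x‖ ^ 2)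
        + ∫ z, eulerKernel g s z x • (inner ℝ (eulerScore g μ h s x) (h x - g z) : ℝ) ∂μ :=
      fun x => by
    have hp := eulerDensity_pos (μ := μ) hg hs x
    set S := eulerScore g μ h s x with hS
    have hki := integrable_eulerKernel (μ := μ) hg hs x
    have hgi := integrable_eulerKernel_smul_drift hg hμ hs x
    have h4 : Integrable (fun z => eulerKernel g s z x • (h x - g z)) μ := by
      simp_rw [smul_sub]
      exact (hki.smul_const _).sub hgi
    have h1 : eulerGrad g μ s x = eulerDensity g μ s x • (S - h x) := by
      rw [hS, eulerScore, add_sub_cancel_right, smul_smul, mul_inv_cancel₀ hp.ne', one_smul]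
    have h2 : eulerDensity g μ s x • h x - eulerFlux g μ s x
        = ∫ z, eulerKernel g s z x • (h x - g z) ∂μ := by
      simp_rw [smul_sub]
      rw [integral_sub (hki.smul_const _) hgi, integral_smul_const]
      rfl
    have h5 : eulerGrad g μ s x + eulerFlux g μ s x
        = eulerDensity g μ s x • S - (eulerDensity g μ s x • h x - eulerFlux g μ s x) := by
      rw [h1]; module
    simp_rw [smul_eq_mul, ← real_inner_smul_right]
    rw [integral_inner h4, ← h2, h5, inner_sub_right, real_inner_smul_right,
      real_inner_self_eq_norm_sq]
    ring
  rw [← integral_neg]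
  simp_rw [hpt]
  rw [← integral_const_mul, ← integral_add (hfi.const_mul _) hi.integral_prod_right]
  refine integral_mono_ae (hfi.neg.add hci.integral_prod_right)
    ((hfi.const_mul _).add hi.integral_prod_right) ?_
  filter_upwards [hi.prod_left_ae, hci.prod_left_ae] with x hx hcx
  have hki := integrable_eulerKernel (μ := μ) hg hs x
  have h3 : ∫ z, eulerKernel g s z x • (inner ℝ (eulerScore g μ h s x) (h x - g z) : ℝ) ∂μ
      ≤ eulerDensity g μ s x * (1 / 4 * ‖eulerScore g μ h s x‖ ^ 2)
        + ∫ z, eulerKernel g s z x • ‖h x - g z‖ ^ 2 ∂μ := by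
    rw [eulerDensity, ← integral_mul_const, ← integral_add (hki.mul_const _) hx]
    refine integral_mono hcx ((hki.mul_const _).add hx) fun z => ?_
    have hk := eulerKernel_pos (g := g) hs z x
    simp only [smul_eq_mul]
    rw [← mul_add]
    exact mul_le_mul_of_nonneg_left (real_inner_le_quarter_norm_sq_add _ _) hk.le
  linarith

/-- The dissipation inequality at the initial time, where the conditional expectation is trivial. -/
theorem neg_integral_inner_score_le (hq : LogLipschitzDensity q dq C) (hg : DriftGrowth g K)
    {κ : ℝ} (hκ : 0 < κ) (hint : Integrable fun x => q x * Real.exp (κ * ‖x‖ ^ 2))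
    {u : E → ℝ} {h : E → E} {Cu : ℝ} {N : ℕ} (hu : PolyPotential u h Cu N) :
    Integrable (fun x => q x * ‖(q x)⁻¹ • dq x + h x‖ ^ 2) ∧
    Integrable (fun x => q x * ‖h x - g x‖ ^ 2) ∧
    -∫ x, inner ℝ ((q x)⁻¹ • dq x + h x) (dq x + q x • g x)
      ≤ -(3 / 4) * (∫ x, q x * ‖(q x)⁻¹ • dq x + h x‖ ^ 2) + ∫ x, q x * ‖h x - g x‖ ^ 2 := by
  have hhc := hu.cont
  have hgc := hg.cont
  have hdc := hq.cont
  have hC := hq.nonneg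
  have hK := hg.nonneg
  have hCu := hu.nonneg
  have hqi : Continuous fun x => (q x)⁻¹ := hq.continuous.inv₀ fun x => (hq.pos x).ne'
  have hSb : ∀ x, ‖(q x)⁻¹ • dq x + h x‖ ≤ (C + Cu) * (1 + ‖x‖) ^ (N + 1) := fun x => by
    have hqx := hq.pos x
    have hx : (1 : ℝ) ≤ 1 + ‖x‖ := by linarith [norm_nonneg x]
    have h1 : ‖(q x)⁻¹ • dq x‖ ≤ C * (1 + ‖x‖) := by
      rw [norm_smul, norm_inv, Real.norm_of_nonneg hqx.le, inv_mul_le_iff₀ hqx, mul_comm (q x)]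
      exact hq.norm_le x
    calc _ ≤ C * (1 + ‖x‖) + Cu * (1 + ‖x‖) ^ N :=
          (norm_add_le _ _).trans (add_le_add h1 (hu.norm_le x))
      _ ≤ C * (1 + ‖x‖) ^ (N + 1) + Cu * (1 + ‖x‖) ^ (N + 1) := by
          gcongr
          · exact le_self_pow₀ hx (by omega)
          · omega
      _ = _ := by ring
  have hEb : ∀ x, ‖h x - g x‖ ≤ (Cu + K) * (1 + ‖x‖) ^ (N + 1) := fun x => by
    have hx : (1 : ℝ) ≤ 1 + ‖x‖ := by linarith [norm_nonneg x]
    calc _ ≤ Cu * (1 + ‖x‖) ^ N + K * (1 + ‖x‖) :=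
          (norm_sub_le _ _).trans (add_le_add (hu.norm_le x) (hg.bound x))
      _ ≤ Cu * (1 + ‖x‖) ^ (N + 1) + K * (1 + ‖x‖) ^ (N + 1) := by
          gcongr
          · omega
          · exact le_self_pow₀ hx (by omega)
      _ = _ := by ring
  have hi1 : Integrable (fun x => q x * ‖(q x)⁻¹ • dq x + h x‖ ^ 2) :=
    integrable_density_mul hq hκ hint (by fun_prop) (B := (C + Cu) ^ 2) (M := (N + 1) * 2)
      fun x => by
        rw [abs_of_nonneg (by positivity), pow_mul, ← mul_pow]
        gcongr
        exact hSb x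
  have hi2 : Integrable (fun x => q x * ‖h x - g x‖ ^ 2) :=
    integrable_density_mul hq hκ hint (by fun_prop) (B := (Cu + K) ^ 2) (M := (N + 1) * 2)
      fun x => by
        rw [abs_of_nonneg (by positivity), pow_mul, ← mul_pow]
        gcongr
        exact hEb x
  have hi3 : Integrable fun x => q x * (inner ℝ ((q x)⁻¹ • dq x + h x) (h x - g x) : ℝ) :=
    integrable_density_mul hq hκ hint (by fun_prop) (B := (C + Cu) * (Cu + K))
      (M := (N + 1) + (N + 1)) fun x => by
        refine (abs_real_inner_le_norm _ _).trans ((mul_le_mul (hSb x) (hEb x) (norm_nonneg _)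
          (by positivity)).trans_eq (by ring))
  refine ⟨hi1, hi2, ?_⟩
  have hpt : ∀ x, -(inner ℝ ((q x)⁻¹ • dq x + h x) (dq x + q x • g x) : ℝ)
      = -(q x * ‖(q x)⁻¹ • dq x + h x‖ ^ 2)
        + q x * inner ℝ ((q x)⁻¹ • dq x + h x) (h x - g x) := fun x => by
    have hqx := (hq.pos x).ne'
    have h1 : dq x + q x • g x
        = q x • ((q x)⁻¹ • dq x + h x) - q x • (h x - g x) := by
      rw [smul_add, smul_smul, mul_inv_cancel₀ hqx]; module
    nth_rewrite 1 [h1]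
    rw [inner_sub_right, real_inner_smul_right, real_inner_smul_right, real_inner_self_eq_norm_sq]
    ring
  rw [← integral_neg, ← integral_const_mul, ← integral_add (hi1.const_mul _) hi2]
  refine integral_mono ((hi1.neg.add hi3).congr (Eventually.of_forall fun x => (hpt x).symm))
    ((hi1.const_mul _).add hi2) fun x => ?_
  have h1 := mul_le_mul_of_nonneg_left
    (real_inner_le_quarter_norm_sq_add ((q x)⁻¹ • dq x + h x) (h x - g x)) (hq.pos x).le
  simp only
  rw [hpt]
  linarith

end

/-! ### Relative entropy and Fisher information with respect to the target -/

section

variable {E : Type*} [NormedAddCommGroup E] [InnerProductSpace ℝ E] [FiniteDimensional ℝ E]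
  [MeasurableSpace E] [BorelSpace E] {p : E → ℝ} {dp : E → E} {C : ℝ} {u : E → ℝ}

/-- The density of `densityMeasure p` relative to the probability measure proportional to
`e^{-u}`. -/
noncomputable def relDensity (u p : E → ℝ) (x : E) : ℝ :=
  (∫ y, Real.exp (-u y)) * (p x * Real.exp (u x))

theorem integral_exp_neg_pos (hZ : Integrable fun x => Real.exp (-u x)) :
    0 < ∫ x, Real.exp (-u x) :=
  integral_exp_pos hZ

variable (hp : LogLipschitzDensity p dp C) (huc : Continuous u)
  (hZ : Integrable fun x => Real.exp (-u x))
include hp huc hZ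

theorem relDensity_pos (x : E) : 0 < relDensity u p x :=
  mul_pos (integral_exp_neg_pos hZ) (mul_pos (hp.pos x) (Real.exp_pos _))

theorem continuous_relDensity : Continuous (relDensity u p) := by
  have := hp.continuous
  unfold relDensity
  fun_prop

theorem densityMeasure_eq_withDensity_tilted :
    densityMeasure p = (volume.tilted fun x => -u x).withDensity
      fun x => ENNReal.ofReal (relDensity u p x) := by
  have hpc := hp.continuous
  have hZ0 := integral_exp_neg_pos hZ
  rw [Measure.tilted, ← withDensity_mul _ (by fun_prop)
    (continuous_relDensity hp huc hZ).measurable.ennreal_ofReal, densityMeasure]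
  congr 1
  ext x
  rw [Pi.mul_apply, ← ENNReal.ofReal_mul (by positivity), relDensity]
  congr 1
  rw [Real.exp_neg]
  have := Real.exp_pos (u x)
  field_simp

theorem rnDeriv_densityMeasure_tilted :
    (densityMeasure p).rnDeriv (volume.tilted fun x => -u x)
      =ᵐ[volume] fun x => ENNReal.ofReal (relDensity u p x) := by
  have := isProbabilityMeasure_tilted hZ
  rw [densityMeasure_eq_withDensity_tilted hp huc hZ]
  exact (absolutelyContinuous_tilted hZ).ae_eq
    (Measure.rnDeriv_withDensity _ (continuous_relDensity hp huc hZ).measurable.ennreal_ofReal)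

theorem densityMeasure_absolutelyContinuous_tilted :
    densityMeasure p ≪ volume.tilted fun x => -u x := by
  rw [densityMeasure_eq_withDensity_tilted hp huc hZ]
  exact withDensity_absolutelyContinuous _ _

/-- The log-likelihood ratio to the target, whose mean is the relative entropy. -/
theorem llr_densityMeasure_tilted :
    llr (densityMeasure p) (volume.tilted fun x => -u x) =ᵐ[densityMeasure p]
      fun x => Real.log (p x) + u x + Real.log (∫ y, Real.exp (-u y)) := by
  have h : densityMeasure p ≪ volume := withDensity_absolutelyContinuous _ _
  filter_upwards [h.ae_eq (rnDeriv_densityMeasure_tilted hp huc hZ)] with x hx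
  have hZ0 := integral_exp_neg_pos hZ
  have hpx := hp.pos x
  rw [llr, hx, ENNReal.toReal_ofReal (relDensity_pos hp huc hZ x).le, relDensity,
    Real.log_mul hZ0.ne' (by positivity), Real.log_mul hpx.ne' (by positivity), Real.log_exp]
  ring

variable [IsProbabilityMeasure (densityMeasure p)]
  (hint : Integrable fun x => p x * (Real.log (p x) + u x))
include hint

theorem klDiv_densityMeasure_tilted_ne_top :
    InformationTheory.klDiv (densityMeasure p) (volume.tilted fun x => -u x) ≠ ∞ := by
  refine InformationTheory.klDiv_ne_top (densityMeasure_absolutelyContinuous_tilted hp huc hZ) ?_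
  rw [integrable_congr (llr_densityMeasure_tilted hp huc hZ)]
  refine Integrable.add ?_ (integrable_const _)
  rw [integrable_densityMeasure hp]
  exact hint

theorem toReal_klDiv_densityMeasure_tilted :
    (InformationTheory.klDiv (densityMeasure p) (volume.tilted fun x => -u x)).toReal
      = (∫ x, p x * (Real.log (p x) + u x)) + Real.log (∫ y, Real.exp (-u y)) := by
  have := isProbabilityMeasure_tilted hZ
  rw [InformationTheory.toReal_klDiv_of_measure_eq
    (densityMeasure_absolutelyContinuous_tilted hp huc hZ) (by simp),
    integral_congr_ae (llr_densityMeasure_tilted hp huc hZ), integral_add _ (integrable_const _),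
    integral_densityMeasure hp]
  · simp
  · rw [integrable_densityMeasure hp]
    exact hint

end

section

variable {d : ℕ} {p : EuclideanSpace ℝ (Fin d) → ℝ}
  {dp : EuclideanSpace ℝ (Fin d) → EuclideanSpace ℝ (Fin d)} {C : ℝ}
  {u : EuclideanSpace ℝ (Fin d) → ℝ} {h : EuclideanSpace ℝ (Fin d) → EuclideanSpace ℝ (Fin d)}

/-- A classical continuous gradient is a weak gradient, by integration by parts against compactly
supported test functions. -/
theorem isWeakGradient_of_hasFDerivAt {F : EuclideanSpace ℝ (Fin d) → ℝ}
    {G : EuclideanSpace ℝ (Fin d) → EuclideanSpace ℝ (Fin d)}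
    (hF : ∀ x, HasFDerivAt F (innerSL ℝ (G x)) x) (hG : Continuous G) : IsWeakGradient F G := by
  have hFc : Continuous F := continuous_iff_continuousAt.2 fun x => (hF x).continuousAt
  refine ⟨hFc.locallyIntegrable, hG.locallyIntegrable, fun φ hφ hφc => ?_⟩
  have hφ1 : Continuous φ := hφ.continuous
  have hφd : Continuous (fderiv ℝ φ) := hφ.continuous_fderiv (by simp)
  have hgr : ∀ x v, inner ℝ v (gradient φ x) = fderiv ℝ φ x v := fun x v => by
    rw [real_inner_comm, gradient, InnerProductSpace.toDual_symm_apply]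
  have hgc : Continuous (gradient φ) := by
    unfold gradient
    exact (LinearIsometryEquiv.continuous _).comp hφd
  have hgs : HasCompactSupport (gradient φ) :=
    (hφc.fderiv ℝ).comp_left (g := (InnerProductSpace.toDual ℝ (EuclideanSpace ℝ (Fin d))).symm)
      (map_zero _)
  have hi1 : Integrable fun x => F x • gradient φ x :=
    (hFc.smul hgc).integrable_of_hasCompactSupport hgs.smul_left
  have hi2 : Integrable fun x => φ x • G x :=
    (hφ1.smul hG).integrable_of_hasCompactSupport hφc.smul_right
  refine ext_inner_left ℝ fun v => ?_
  rw [← integral_inner hi1, inner_neg_right, ← integral_inner hi2]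
  simp_rw [real_inner_smul_right, hgr]
  have hFd : ∀ x, fderiv ℝ F x v = inner ℝ v (G x) := fun x => by
    rw [(hF x).fderiv, innerSL_apply_apply, real_inner_comm]
  rw [integral_mul_fderiv_eq_neg_fderiv_mul_of_integrable (f := F) (g := φ) (v := v)
    _ _ _ (fun x _ => (hF x).differentiableAt)
    (fun x _ => (hφ.differentiable (by simp)).differentiableAt)]
  · congr 1
    refine integral_congr_ae (Eventually.of_forall fun x => ?_)
    simp only [hFd]
    ring
  · simp_rw [hFd]
    exact ((continuous_const.inner hG).mul hφ1).integrable_of_hasCompactSupport hφc.mul_left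
  · exact (hFc.mul (hφd.clm_apply continuous_const)).integrable_of_hasCompactSupport
      ((hφc.fderiv_apply ℝ v).mul_left)
  · exact (hFc.mul hφ1).integrable_of_hasCompactSupport hφc.mul_left

/-- The relative Fisher information is at most `∫ p |∇ log p + ∇ u|²`: the classical gradient of
`Z p e^u`, a version of the density relative to the target, is a competitor in the infimum. -/
theorem fisherInfo_densityMeasure_le (hp : LogLipschitzDensity p dp C)
    (hu : ∀ x, HasFDerivAt u (innerSL ℝ (h x)) x) (hh : Continuous h)
    (hZ : Integrable fun x => Real.exp (-u x))
    (hint : Integrable fun x => p x * ‖(p x)⁻¹ • dp x + h x‖ ^ 2) :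
    fisherInfo (target u) (densityMeasure p)
      ≤ ENNReal.ofReal (∫ x, p x * ‖(p x)⁻¹ • dp x + h x‖ ^ 2) := by
  have huc : Continuous u := continuous_iff_continuousAt.2 fun x => (hu x).continuousAt
  have hZ0 := integral_exp_neg_pos hZ
  set Z := ∫ x, Real.exp (-u x) with hZdef
  have hpc := hp.continuous
  have hdc := hp.cont
  set S : EuclideanSpace ℝ (Fin d) → EuclideanSpace ℝ (Fin d) :=
    fun x => (p x)⁻¹ • dp x + h x with hS
  have hSc : Continuous S := ((hpc.inv₀ fun x => (hp.pos x).ne').smul hdc).add hh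
  set G : EuclideanSpace ℝ (Fin d) → EuclideanSpace ℝ (Fin d) :=
    fun x => relDensity u p x • S x with hG
  have hFc := continuous_relDensity hp huc hZ
  have hF : ∀ x, HasFDerivAt (relDensity u p) (innerSL ℝ (G x)) x := fun x => by
    have h1 := ((hp.hasFDerivAt x).mul (hu x).exp).const_mul Z
    refine h1.congr_fderiv ?_
    have hpx := (hp.pos x).ne'
    ext v
    simp only [smul_apply, add_apply, innerSL_apply_apply,
      hG, hS, relDensity, real_inner_smul_left, inner_add_left, smul_eq_mul]
    field_simp
    ring
  -- The Radon–Nikodym derivative is only defined up to null sets; being a weak gradient is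
  -- insensitive to them.
  have hrn := rnDeriv_densityMeasure_tilted hp huc hZ
  have hweak := isWeakGradient_of_hasFDerivAt hF (hFc.smul hSc)
  have hae : (fun x => ((densityMeasure p).rnDeriv (target u) x).toReal)
      =ᵐ[volume] relDensity u p := by
    filter_upwards [hrn] with x hx
    rw [target, hx, ENNReal.toReal_ofReal (relDensity_pos hp huc hZ x).le]
  have hweak' : IsWeakGradient (fun x => ((densityMeasure p).rnDeriv (target u) x).toReal) G := by
    refine ⟨hweak.1.congr hae.symm, hweak.2.1, fun φ hφ hφc => ?_⟩
    rw [← hweak.2.2 φ hφ hφc]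
    refine integral_congr_ae ?_
    filter_upwards [hae] with x hx
    rw [hx]
  refine (iInf₂_le G ⟨densityMeasure_absolutelyContinuous_tilted hp huc hZ, hweak'⟩).trans ?_
  rw [target, lintegral_tilted, ofReal_integral_eq_lintegral_ofReal hint
    (Eventually.of_forall fun x => mul_nonneg (hp.pos x).le (by positivity))]
  refine le_of_eq (lintegral_congr_ae ?_)
  filter_upwards [hrn] with x hx
  have hFx := relDensity_pos hp huc hZ x
  rw [hx, ← ENNReal.ofReal_div_of_pos hFx, ← ENNReal.ofReal_mul (by positivity)]
  congr 1
  have hpx := hp.pos x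
  change _ = p x * ‖S x‖ ^ 2
  rw [hG, norm_smul, Real.norm_of_nonneg hFx.le, ← hZdef, mul_pow, pow_two (relDensity u p x),
    mul_assoc, mul_div_cancel_left₀ _ hFx.ne', relDensity, ← hZdef, Real.exp_neg]
  have := Real.exp_pos (u x)
  field_simp

end

/-! ### The potential and the tamed drift -/

section

variable {d : ℕ} {u : EuclideanSpace ℝ (Fin d) → ℝ}

theorem hasFDerivAt_innerSL_gradient (hu : ContDiff ℝ 2 u) (x : EuclideanSpace ℝ (Fin d)) :
    HasFDerivAt u (innerSL ℝ (gradient u x)) x :=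
  ((hu.differentiable (by norm_num)).differentiableAt (x := x)).hasGradientAt.hasFDerivAt

theorem continuous_gradient (hu : ContDiff ℝ 2 u) : Continuous (gradient u) := by
  unfold gradient
  exact (LinearIsometryEquiv.continuous _).comp (hu.continuous_fderiv (by norm_num))

variable {L' l' A a b L l : ℝ} (hdrift : DriftAssumption (gradient u) L' l' A a b L l)
include hdrift

/-- The gradient grows like a power of the norm by assumption, hence so does the potential. -/
theorem exists_polyPotential (hu : ContDiff ℝ 2 u) :
    ∃ (C : ℝ) (N : ℕ), PolyPotential u (gradient u) C N := by
  obtain ⟨n, hn⟩ := exists_nat_ge (2 * l)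
  have hL := hdrift.L_pos
  have hl := hdrift.l_pos
  have hb : ∀ x, ‖gradient u x‖ ≤ 2 * L * (1 + ‖x‖) ^ n := fun x => by
    have hx : (1 : ℝ) ≤ 1 + ‖x‖ := by linarith [norm_nonneg x]
    have h1 : ‖x‖ ^ (2 * l) ≤ (1 + ‖x‖) ^ n := by
      rw [← Real.rpow_natCast]
      exact (Real.rpow_le_rpow (norm_nonneg x) (by linarith) (by positivity)).trans
        (Real.rpow_le_rpow_of_exponent_le hx hn)
    have h2 := (le_max_left _ _).trans (hdrift.polyJacobian x)
    have h3 := one_le_pow₀ hx (n := n)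
    nlinarith
  refine ⟨|u 0| + 2 * L, n + 1, hasFDerivAt_innerSL_gradient hu, continuous_gradient hu,
    fun x => ?_, fun x => ?_⟩
  · have hx : (1 : ℝ) ≤ 1 + ‖x‖ := by linarith [norm_nonneg x]
    have h := (convex_closedBall (0 : EuclideanSpace ℝ (Fin d))
        ‖x‖).norm_image_sub_le_of_norm_hasFDerivWithin_le
      (f := u) (C := 2 * L * (1 + ‖x‖) ^ n) (x := 0) (y := x)
      (fun y _ => (hasFDerivAt_innerSL_gradient hu y).hasFDerivWithinAt) (fun y hy => ?_)
      (Metric.mem_closedBall_self (norm_nonneg x)) (by simp)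
    · rw [sub_zero, Real.norm_eq_abs] at h
      have h1 := abs_sub_abs_le_abs_sub (u x) (u 0)
      have h2 : |u 0| ≤ |u 0| * (1 + ‖x‖) ^ (n + 1) :=
        le_mul_of_one_le_right (abs_nonneg _) (one_le_pow₀ hx)
      have h3 : 2 * L * (1 + ‖x‖) ^ n * ‖x‖ ≤ 2 * L * (1 + ‖x‖) ^ (n + 1) := by
        rw [pow_succ, ← mul_assoc]
        gcongr
        linarith
      linarith
    · rw [innerSL_apply_norm]
      refine (hb y).trans ?_
      have : ‖y‖ ≤ ‖x‖ := by simpa using hy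
      gcongr
  · have hx : (1 : ℝ) ≤ 1 + ‖x‖ := by linarith [norm_nonneg x]
    refine (hb x).trans ?_
    gcongr
    · linarith [abs_nonneg (u 0)]
    · omega

/-- Weak dissipativity with `a ≥ 1` makes the potential grow at least linearly: beyond the radius
`max 1 (2 b / A)` its radial derivative is at least `A / 2`. -/
theorem exists_linear_le_potential (hu : ContDiff ℝ 2 u) :
    ∃ c₀ : ℝ, ∀ x, A / 2 * ‖x‖ - c₀ ≤ u x := by
  have hA := hdrift.A_pos
  have hb := hdrift.b_pos
  set R : ℝ := max 1 (2 * b / A) with hR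
  have hR1 : 1 ≤ R := le_max_left _ _
  have hRb : 2 * b ≤ A * R := by
    have := le_max_right 1 (2 * b / A)
    rw [div_le_iff₀ hA] at this
    linarith
  obtain ⟨x₀, -, hx₀⟩ := (isCompact_closedBall (0 : EuclideanSpace ℝ (Fin d)) R).exists_isMinOn
    ⟨0, by simp; linarith⟩ hu.continuous.continuousOn
  refine ⟨A / 2 * R - u x₀, fun x => ?_⟩
  rcases le_total ‖x‖ R with hx | hx
  · have h1 : u x₀ ≤ u x := hx₀ (by simpa using hx)
    nlinarith
  · have hx0 : 0 < ‖x‖ := by linarith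
    set e := (‖x‖)⁻¹ • x with he
    have hen : ‖e‖ = 1 := by rw [he, norm_smul, norm_inv, norm_norm, inv_mul_cancel₀ hx0.ne']
    have hxe : ‖x‖ • e = x := by rw [he, smul_smul, mul_inv_cancel₀ hx0.ne', one_smul]
    have hder : ∀ r : ℝ, HasDerivAt (fun r : ℝ => u (r • e) - A / 2 * r)
        (inner ℝ (gradient u (r • e)) e - A / 2) r := fun r => by
      have h1 : HasDerivAt (fun r : ℝ => r • e) e r := by
        simpa using (hasDerivAt_id r).smul_const e
      have h2 := (hasFDerivAt_innerSL_gradient hu (r • e)).comp_hasDerivAt r h1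
      have h3 := (hasDerivAt_id r).const_mul (A / 2)
      rw [mul_one] at h3
      exact HasDerivAt.fun_sub h2 h3
    -- Dissipativity gives `r ⟨∇u(r e), e⟩ ≥ A r^a - b ≥ A r - A R / 2 ≥ A r / 2` for `r ≥ R`.
    have hmono : MonotoneOn (fun r : ℝ => u (r • e) - A / 2 * r) (Ici R) := by
      refine monotoneOn_of_deriv_nonneg (convex_Ici R)
        (fun r _ => (hder r).continuousAt.continuousWithinAt)
        (fun r _ => (hder r).differentiableAt.differentiableWithinAt) fun r hr => ?_
      rw [interior_Ici] at hr
      rw [(hder r).deriv]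
      have hr1 : R < r := hr
      have hr0 : 0 < r := by linarith
      have h1 := hdrift.weakDissipative (r • e)
      rw [real_inner_smul_right, norm_smul, hen, mul_one, Real.norm_of_nonneg hr0.le] at h1
      have h2 : r ≤ r ^ a := by
        have := Real.rpow_le_rpow_of_exponent_le (by linarith : (1 : ℝ) ≤ r) hdrift.one_le_a
        rwa [Real.rpow_one] at this
      have h3 : A * r ≤ A * r ^ a := by gcongr
      have h4 : A * R ≤ A * r := by gcongr
      have h5 : r * (A / 2) ≤ r * inner ℝ (gradient u (r • e)) e := by linarith
      have := le_of_mul_le_mul_left h5 hr0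
      linarith
    have h1 := hmono (mem_Ici.2 le_rfl) (mem_Ici.2 hx) hx
    simp only [hxe] at h1
    have h2 : u x₀ ≤ u (R • e) := hx₀ (by
      rw [mem_closedBall_zero_iff, norm_smul, hen, mul_one, Real.norm_of_nonneg (by linarith)])
    linarith

/-- The target is normalizable, since the potential grows at least linearly. -/
theorem integrable_exp_neg_potential (hu : ContDiff ℝ 2 u) :
    Integrable fun x => Real.exp (-u x) := by
  obtain ⟨c₀, hc₀⟩ := exists_linear_le_potential hdrift hu
  have hA := hdrift.A_pos
  have huc := hu.continuous
  set D := Module.finrank ℝ (EuclideanSpace ℝ (Fin d))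
  set n := D + 1
  refine ((integrable_inv_one_add_norm_pow (E := EuclideanSpace ℝ (Fin d))).const_mul
    (Real.exp (c₀ + A / 2) * ((n.factorial : ℝ) / (A / 2) ^ n))).mono'
    (Continuous.aestronglyMeasurable (by fun_prop)) (Eventually.of_forall fun x => ?_)
  have hx : 0 ≤ ‖x‖ := norm_nonneg x
  rw [Real.norm_of_nonneg (Real.exp_pos _).le]
  have h1 := Real.pow_div_factorial_le_exp (A / 2 * (1 + ‖x‖)) (by positivity) n
  have h2 : (A / 2 * (1 + ‖x‖)) ^ n / n.factorial * Real.exp (-(A / 2 * (1 + ‖x‖))) ≤ 1 := by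
    rw [Real.exp_neg, ← div_eq_mul_inv, div_le_one (Real.exp_pos _)]
    exact h1
  have h3 : Real.exp (-u x) ≤ Real.exp (c₀ + A / 2) * Real.exp (-(A / 2 * (1 + ‖x‖))) := by
    rw [← Real.exp_add, Real.exp_le_exp]
    have := hc₀ x
    linarith
  refine h3.trans ?_
  rw [mul_assoc]
  gcongr
  rw [← div_eq_mul_inv, le_div_iff₀ (by positivity), le_div_iff₀ (by positivity)]
  rw [mul_pow, div_mul_eq_mul_div, div_le_iff₀ (by positivity)] at h2
  linarith

/-- The tamed drift has at most linear growth: the radial field is `Cstar`-Lipschitz and vanishes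
at `0`, and the taming factor turns the growth `|x|^(2l)` of the gradient into a constant. -/
theorem driftGrowth_tamedDrift (hu : ContDiff ℝ 2 u) {Cstar : ℝ}
    (hCstar : ∀ x : EuclideanSpace ℝ (Fin d), ‖fderiv ℝ (radialField (d := d) a) x‖ ≤ Cstar)
    {lam : ℝ} (hlam : 0 < lam) :
    DriftGrowth (tamedDrift (gradient u) A a l lam)
      (2 * A * Cstar + L * (1 + (√lam)⁻¹)) := by
  have hA := hdrift.A_pos
  have hl := hdrift.l_pos
  have hL := hdrift.L_pos
  have hC0 : 0 ≤ Cstar := (norm_nonneg _).trans (hCstar 0)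
  have hbase : ∀ x : EuclideanSpace ℝ (Fin d), (1 + ‖x‖ ^ 2) ^ (1 - a / 2) ≠ 0 := fun x =>
    (Real.rpow_pos_of_pos (by positivity) _).ne'
  have hRd : Differentiable ℝ (radialField (d := d) a) := by
    intro x
    have h1 : DifferentiableAt ℝ (fun x : EuclideanSpace ℝ (Fin d) => 1 + ‖x‖ ^ 2) x :=
      (differentiableAt_const _).add (differentiableAt_id.norm_sq ℝ)
    have h2 := h1.rpow_const (p := 1 - a / 2) (Or.inl (by positivity))
    exact (h2.inv (hbase x)).smul differentiableAt_id
  have hRc := hRd.continuous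
  have hRb : ∀ x, ‖radialField a x‖ ≤ Cstar * ‖x‖ := fun x => by
    have h := convex_univ.norm_image_sub_le_of_norm_fderiv_le (f := radialField (d := d) a)
      (C := Cstar) (x := 0) (y := x) (fun y _ => hRd y) (fun y _ => hCstar y) trivial trivial
    simpa [radialField] using h
  have hsl : 0 < √lam := Real.sqrt_pos.2 hlam
  have hden : ∀ x : EuclideanSpace ℝ (Fin d), 0 < 1 + √lam * ‖x‖ ^ (2 * l) := fun x => by
    positivity
  have hpc : Continuous fun x : EuclideanSpace ℝ (Fin d) => ‖x‖ ^ (2 * l) :=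
    continuous_norm.rpow_const fun x => Or.inr (by positivity)
  constructor
  · have hi : Continuous fun x : EuclideanSpace ℝ (Fin d) => (1 + √lam * ‖x‖ ^ (2 * l))⁻¹ :=
      (by fun_prop : Continuous fun x : EuclideanSpace ℝ (Fin d) =>
        1 + √lam * ‖x‖ ^ (2 * l)).inv₀ fun x => (hden x).ne'
    have hhc := continuous_gradient hu
    unfold tamedDrift
    fun_prop
  · intro x
    set t := ‖x‖ ^ (2 * l) with ht
    have ht0 : 0 ≤ t := by positivity
    have hx := norm_nonneg x
    have h1 : ‖gradient u x‖ ≤ L * (1 + t) := (le_max_left _ _).trans (hdrift.polyJacobian x)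
    have h2 : (1 + √lam * t)⁻¹ * (1 + t) ≤ 1 + (√lam)⁻¹ := by
      rw [inv_mul_le_iff₀ (hden x)]
      have h3 : (1 + √lam * t) * (1 + (√lam)⁻¹)
          = 1 + t * (√lam * (√lam)⁻¹) + √lam * t + (√lam)⁻¹ := by ring
      rw [h3, mul_inv_cancel₀ hsl.ne']
      have : 0 ≤ √lam * t := by positivity
      have : 0 ≤ (√lam)⁻¹ := by positivity
      linarith
    have h4 : (1 + √lam * t)⁻¹ ≤ 1 := inv_le_one_of_one_le₀ (by nlinarith)
    have h5 : ‖A • radialField a x‖ ≤ A * (Cstar * ‖x‖) := by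
      rw [norm_smul, Real.norm_of_nonneg hA.le]
      gcongr
      exact hRb x
    have h6 : 0 < (1 + √lam * t)⁻¹ := inv_pos.2 (hden x)
    calc ‖tamedDrift (gradient u) A a l lam x‖
        ≤ ‖A • radialField a x‖ + (1 + √lam * t)⁻¹ * (‖gradient u x‖ + ‖A • radialField a x‖) := by
          refine (norm_add_le _ _).trans ?_
          rw [norm_smul (1 + √lam * ‖x‖ ^ (2 * l))⁻¹, ← ht, Real.norm_of_nonneg h6.le]
          gcongr
          exact norm_sub_le _ _
      _ ≤ A * (Cstar * ‖x‖) + ((1 + √lam * t)⁻¹ * (L * (1 + t)) + 1 * (A * (Cstar * ‖x‖))) := by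
          rw [mul_add]
          gcongr
      _ = 2 * A * Cstar * ‖x‖ + L * ((1 + √lam * t)⁻¹ * (1 + t)) := by ring
      _ ≤ 2 * A * Cstar * (1 + ‖x‖) + L * ((1 + (√lam)⁻¹) * (1 + ‖x‖)) := by
          refine add_le_add (mul_le_mul_of_nonneg_left (by linarith) (by positivity))
            (mul_le_mul_of_nonneg_left ?_ hL.le)
          exact h2.trans (le_mul_of_one_le_right (by positivity) (by linarith))
      _ = _ := by ring

end

/-! ### Brownian increments -/

theorem iIndepFun_bool {Ω α : Type*} [MeasurableSpace Ω] [MeasurableSpace α] {P : Measure Ω}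
    [IsProbabilityMeasure P] {X : Bool → Ω → α} (h : IndepFun (X true) (X false) P) :
    iIndepFun X P := by
  rw [iIndepFun_iff_measure_inter_preimage_eq_mul]
  intro S sets hs
  have h1 := h.measure_inter_preimage_eq_mul
  have hS : S = ∅ ∨ S = {true} ∨ S = {false} ∨ S = {true, false} := by
    clear hs
    revert S
    decide
  rcases hS with rfl | rfl | rfl | rfl
  · simp
  · simp
  · simp
  · rw [Finset.set_biInter_insert, Finset.set_biInter_singleton, Finset.prod_insert (by simp),
      Finset.prod_singleton]
    exact h1 _ _ (hs _ (by simp)) (hs _ (by simp))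

section

variable {d : ℕ} {Ω : Type*} [MeasurableSpace Ω] {P : Measure Ω}
  {B : ℝ≥0 → Ω → EuclideanSpace ℝ (Fin d)}

/-- A vector of independent centred Gaussian coordinates of variance `v` is `√v` times a standard
Gaussian vector. -/
theorem map_toLp_pi_gaussianReal {v : ℝ≥0} :
    (Measure.pi fun _ : Fin d => gaussianReal 0 v).map (WithLp.toLp 2)
      = (stdGaussian (EuclideanSpace ℝ (Fin d))).map fun w => √(v : ℝ) • w := by
  have h1 : (gaussianReal 0 1).map (fun x => √(v : ℝ) * x) = gaussianReal 0 v := by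
    rw [gaussianReal_map_const_mul, mul_zero, mul_one]
    congr 1
    ext
    simp
  rw [← map_pi_eq_stdGaussian, Measure.map_map (by fun_prop) (by fun_prop), ← h1,
    ← Measure.pi_map_pi (fun _ => by fun_prop), Measure.map_map (by fun_prop) (by fun_prop)]
  rfl

/-- The coordinates of `B` are independent and have the finite-dimensional laws of a real Brownian
motion, and `B` is measurable at every time. Path continuity plays no role for the laws considered
here and is not part of the structure. -/
structure IsMeasurableBrownian (B : ℝ≥0 → Ω → EuclideanSpace ℝ (Fin d)) (P : Measure Ω) :
    Prop where
  meas : ∀ t, Measurable (B t)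
  coord : ∀ i : Fin d, IsPreBrownianReal (fun t ω => B t ω i) P
  indep : iIndepFun (fun (i : Fin d) (ω : Ω) (t : ℝ≥0) => B t ω i) P

theorem IsBrownianMotion.aemeasurable (hB : IsBrownianMotion B P) (t : ℝ≥0) :
    AEMeasurable (B t) P := by
  have h : AEMeasurable (fun ω => (fun i => B t ω i : Fin d → ℝ)) P :=
    aemeasurable_pi_lambda _ fun i => (hB.coord i).toIsPreBrownianReal.aemeasurable t
  exact (WithLp.measurable_toLp 2 _).comp_aemeasurable h

/-- A Brownian motion and an independent initial condition have modifications that are measurable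
at every time. This makes the sigma-algebra generated by the past available, since only almost
everywhere measurability is assumed of the original process. -/
theorem IsBrownianMotion.exists_measurable [IsProbabilityMeasure P] (hB : IsBrownianMotion B P)
    {θ₀ : Ω → EuclideanSpace ℝ (Fin d)} (hθ₀ : AEMeasurable θ₀ P)
    (hindep : IndepFun θ₀ (fun ω t => B t ω) P) :
    ∃ (B' : ℝ≥0 → Ω → EuclideanSpace ℝ (Fin d)) (θ₀' : Ω → EuclideanSpace ℝ (Fin d)),
      IsMeasurableBrownian B' P ∧ Measurable θ₀' ∧ (∀ t, B t =ᵐ[P] B' t) ∧ θ₀ =ᵐ[P] θ₀' ∧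
      IndepFun θ₀' (fun ω t => B' t ω) P := by
  have hm := hB.aemeasurable
  have he : ∀ t, B t =ᵐ[P] (hm t).mk (B t) := fun t => (hm t).ae_eq_mk
  have hei : ∀ (i : Fin d) t, (fun ω => B t ω i) =ᵐ[P] fun ω => (hm t).mk (B t) ω i := fun i t => by
    filter_upwards [he t] with ω hω
    rw [hω]
  refine ⟨fun t => (hm t).mk (B t), hθ₀.mk θ₀, ⟨fun t => (hm t).measurable_mk, fun i => ?_, ?_⟩,
    hθ₀.measurable_mk, he, hθ₀.ae_eq_mk, ?_⟩
  · exact (hB.coord i).toIsPreBrownianReal.congr (hei i)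
  · exact iIndepFun.process_congr (X := fun i t ω => B t ω i) hB.indep hei
  · exact ProbabilityTheory.IndepFun.congr (ProbabilityTheory.IndepFun.process_congr_right (X := B)
      hindep he) hθ₀.ae_eq_mk Filter.EventuallyEq.rfl

variable [IsProbabilityMeasure P] (hB : IsMeasurableBrownian B P) {s t : ℝ≥0} (hst : s ≤ t)
include hB hst

/-- Increments of `B` are centred Gaussian with covariance `t - s` times the identity. -/
theorem IsMeasurableBrownian.map_sub :
    P.map (fun ω => B t ω - B s ω)
      = (stdGaussian (EuclideanSpace ℝ (Fin d))).map fun w => √((t : ℝ) - s) • w := by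
  have hmi : ∀ (i : Fin d) r, Measurable fun ω => B r ω i := fun i r =>
    (measurable_pi_apply i).comp ((WithLp.measurable_ofLp 2 _).comp (hB.meas r))
  have h1 : iIndepFun (fun (i : Fin d) ω => B t ω i - B s ω i) P :=
    hB.indep.comp (fun _ f => f t - f s) fun _ => by fun_prop
  have h2 := (iIndepFun_iff_map_fun_eq_pi_map
    (fun i => ((hmi i t).sub (hmi i s)).aemeasurable)).1 h1
  have h3 : ∀ i : Fin d, P.map (fun ω => B t ω i - B s ω i) = gaussianReal 0 (t - s) := fun i => by
    have h := ((hB.coord i).hasLaw_sub t s).map_eq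
    convert! h using 2
    rw [← NNReal.coe_inj, coe_nndist, NNReal.coe_sub hst]
    exact (abs_of_nonneg (sub_nonneg.2 (NNReal.coe_le_coe.2 hst))).symm
  replace h2 := h2.trans (congrArg Measure.pi (funext h3))
  rw [← NNReal.coe_sub hst, ← map_toLp_pi_gaussianReal, ← h2,
    Measure.map_map (by fun_prop) (measurable_pi_lambda _ fun i => (hmi i t).sub (hmi i s))]
  rfl

/-- Increments of `B` after time `s` are independent of `B` up to time `s`. -/
theorem IsMeasurableBrownian.indepFun_past_sub :
    IndepFun (fun ω (r : Iic s) => B r ω) (fun ω => B t ω - B s ω) P := by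
  have hmi : ∀ (i : Fin d) r, Measurable fun ω => B r ω i := fun i r =>
    (measurable_pi_apply i).comp ((WithLp.measurable_ofLp 2 _).comp (hB.meas r))
  -- The past and the future of each coordinate, both indexed by `ℝ≥0`.
  set X : Fin d → Bool → Ω → ℝ≥0 → ℝ := fun i j ω r =>
    bif j then B (s + r) ω i - B s ω i else B (min r s) ω i with hX
  have hXm : ∀ i j, Measurable (X i j) := fun i j => by
    refine measurable_pi_lambda _ fun r => ?_
    cases j
    · exact hmi i _
    · exact (hmi i _).sub (hmi i _)
  have h1 : iIndepFun (fun i ω => (X i · ω)) P := by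
    refine hB.indep.comp (fun _ (f : ℝ≥0 → ℝ) (j : Bool) (r : ℝ≥0) =>
      bif j then f (s + r) - f s else f (min r s)) fun _ => ?_
    refine measurable_pi_lambda _ fun j => measurable_pi_lambda _ fun r => ?_
    cases j
    · exact measurable_pi_apply _
    · exact (measurable_pi_apply _).sub (measurable_pi_apply _)
  have h2 : ∀ i, iIndepFun (X i) P := fun i => by
    refine iIndepFun_bool ?_
    exact ((hB.coord i).indepFun_shift s).comp (φ := id)
      (ψ := fun (f : Iic s → ℝ) (r : ℝ≥0) => f ⟨min r s, mem_Iic.2 (min_le_right r s)⟩)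
      measurable_id
      (measurable_pi_lambda _ fun r =>
        measurable_pi_apply (⟨min r s, mem_Iic.2 (min_le_right r s)⟩ : Iic s))
  -- The processes `X i j` are jointly independent over coordinates and past or future, so the past
  -- of all coordinates is independent of their future.
  have h3 := (iIndepFun_uncurry' hXm h1 h2).indepFun_finset (Finset.univ ×ˢ {false})
    (Finset.univ ×ˢ {true}) (by rw [Finset.disjoint_product]; right; simp) fun p => hXm p.1 p.2
  have h4 := h3.comp
    (φ := fun f (r : Iic s) => WithLp.toLp 2 fun i : Fin d => f ⟨(i, false), by simp⟩ r)
    (ψ := fun f => WithLp.toLp 2 fun i : Fin d => f ⟨(i, true), by simp⟩ (t - s))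
    (measurable_pi_lambda _ fun r => (WithLp.measurable_toLp 2 _).comp
      (measurable_pi_lambda _ fun i => (measurable_pi_apply _).comp (measurable_pi_apply _)))
    ((WithLp.measurable_toLp 2 _).comp
      (measurable_pi_lambda _ fun i => (measurable_pi_apply _).comp (measurable_pi_apply _)))
  convert! h4 using 1
  · ext ω r i
    simp [hX, min_eq_left (show (r : ℝ≥0) ≤ s from r.2)]
  · ext ω i
    simp [hX, add_tsub_cancel_of_le hst]

/-- The initial condition together with the past of `B` is independent of future increments. -/
theorem IsMeasurableBrownian.indepFun_init_past_sub {θ₀ : Ω → EuclideanSpace ℝ (Fin d)}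
    (hθ₀ : Measurable θ₀) (hindep : IndepFun θ₀ (fun ω t => B t ω) P) :
    IndepFun (fun ω => (θ₀ ω, fun (r : Iic s) => B r ω)) (fun ω => B t ω - B s ω) P := by
  have hY : Measurable fun ω (r : Iic s) => B r ω := measurable_pi_lambda _ fun r => hB.meas r
  have hZ : Measurable fun ω => B t ω - B s ω := (hB.meas t).sub (hB.meas s)
  have h1 := hB.indepFun_past_sub hst
  have h2 : IndepFun θ₀ (fun ω => ((fun (r : Iic s) => B r ω), B t ω - B s ω)) P :=
    hindep.comp (φ := id) (ψ := fun f : ℝ≥0 → EuclideanSpace ℝ (Fin d) =>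
      ((fun r : Iic s => f r), f t - f s)) measurable_id (by fun_prop)
  have h3 : IndepFun θ₀ (fun ω (r : Iic s) => B r ω) P := h2.comp measurable_id measurable_fst
  rw [indepFun_iff_map_prod_eq_prod_map_map hY.aemeasurable hZ.aemeasurable] at h1
  rw [indepFun_iff_map_prod_eq_prod_map_map hθ₀.aemeasurable (hY.prodMk hZ).aemeasurable] at h2
  rw [indepFun_iff_map_prod_eq_prod_map_map hθ₀.aemeasurable hY.aemeasurable] at h3
  rw [indepFun_iff_map_prod_eq_prod_map_map (hθ₀.prodMk hY).aemeasurable hZ.aemeasurable, h3]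
  rw [h1] at h2
  have h4 := congrArg (Measure.map MeasurableEquiv.prodAssoc.symm) h2
  rw [Measure.map_map (by fun_prop) (hθ₀.prodMk (hY.prodMk hZ)), ← Measure.prodAssoc_prod,
    MeasurableEquiv.map_symm_map] at h4
  exact h4

end

section

variable {d : ℕ} {Ω : Type*} [MeasurableSpace Ω] {P : Measure Ω}
  {B B' : ℝ≥0 → Ω → EuclideanSpace ℝ (Fin d)} {θ₀ θ₀' : Ω → EuclideanSpace ℝ (Fin d)}
  {g : EuclideanSpace ℝ (Fin d) → EuclideanSpace ℝ (Fin d)} {lam : ℝ}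

/-! ### The law of the interpolation -/

theorem iterates_ae_eq (hB : ∀ t, B t =ᵐ[P] B' t) (hθ₀ : θ₀ =ᵐ[P] θ₀') (k : ℕ) :
    iterates g lam θ₀ (noise lam B) k =ᵐ[P] iterates g lam θ₀' (noise lam B') k := by
  induction k with
  | zero => exact hθ₀
  | succ k ih =>
    filter_upwards [ih, hB (((k + 1 : ℕ) : ℝ) * lam).toNNReal,
      hB ((((k + 1 : ℕ) : ℝ) - 1) * lam).toNNReal] with ω h1 h2 h3
    simp only [iterates, noise, h1, h2, h3]

theorem interpolation_ae_eq (hB : ∀ t, B t =ᵐ[P] B' t) (hθ₀ : θ₀ =ᵐ[P] θ₀') (t : ℝ) :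
    interpolation g lam θ₀ B t =ᵐ[P] interpolation g lam θ₀' B' t := by
  filter_upwards [iterates_ae_eq (g := g) (lam := lam) hB hθ₀ ⌊t / lam⌋₊, hB t.toNNReal,
    hB (⌊t / lam⌋₊ * lam).toNNReal] with ω h1 h2 h3
  simp only [interpolation, h1, h2, h3]

/-- The `k`-th iterate is a measurable function of the initial condition and of the path of `B` up
to time `kλ`. -/
theorem measurable_comap_iterates (hg : Measurable g) (hlam : 0 ≤ lam) {s : ℝ≥0} (k : ℕ)
    (hk : (k * lam).toNNReal ≤ s) :
    Measurable[MeasurableSpace.comap (fun ω => (θ₀ ω, fun (r : Iic s) => B r ω)) inferInstance]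
      (iterates g lam θ₀ (noise lam B) k) := by
  set m := MeasurableSpace.comap (fun ω => (θ₀ ω, fun (r : Iic s) => B r ω)) inferInstance with hm
  have h0 : Measurable[m] fun ω => (θ₀ ω, fun (r : Iic s) => B r ω) := comap_measurable _
  have hBm : ∀ r ≤ s, Measurable[m] (B r) := fun r hr =>
    (measurable_pi_apply (⟨r, hr⟩ : Iic s)).comp (measurable_snd.comp h0)
  induction k with
  | zero => exact measurable_fst.comp h0
  | succ k ih =>
    have hle1 : ((k : ℝ) * lam) ≤ ((k + 1 : ℕ) : ℝ) * lam := by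
      push_cast
      nlinarith
    have h1 := ih ((Real.toNNReal_le_toNNReal hle1).trans hk)
    have h2 := hBm _ hk
    have h3 := hBm (((((k + 1 : ℕ) : ℝ) - 1) * lam).toNNReal)
      ((Real.toNNReal_le_toNNReal (by nlinarith)).trans hk)
    exact (h1.sub ((hg.comp h1).const_smul lam)).add
      (((h2.sub h3).const_smul (√lam)⁻¹).const_smul (√(2 * lam)))

variable [IsProbabilityMeasure P]

theorem IsMeasurableBrownian.measurable_iterates (hB : IsMeasurableBrownian B P)
    (hθ₀ : Measurable θ₀) (hg : Measurable g) (hlam : 0 ≤ lam) (k : ℕ) :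
    Measurable (iterates g lam θ₀ (noise lam B) k) :=
  (measurable_comap_iterates hg hlam k le_rfl).mono
    (Measurable.comap_le (hθ₀.prodMk (measurable_pi_lambda _ fun r => hB.meas r))) le_rfl

theorem IsMeasurableBrownian.map_interpolation (hB : IsMeasurableBrownian B P)
    (hθ₀ : Measurable θ₀) (hindep : IndepFun θ₀ (fun ω t => B t ω) P) (hg : Measurable g)
    (hlam : 0 < lam) (k : ℕ) {t : ℝ} (ht : t ∈ Icc (k * lam) ((k + 1) * lam)) :
    P.map (fun ω => (interpolation g lam θ₀ B (k * lam) ω, interpolation g lam θ₀ B t ω))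
      = ((P.map (interpolation g lam θ₀ B (k * lam))).prod (stdGaussian _)).map fun w =>
        (w.1, w.1 - (t - k * lam) • g w.1 + √(2 * (t - k * lam)) • w.2) := by
  have hkl : (0 : ℝ) ≤ k * lam := by positivity
  have ht0 : 0 ≤ t := hkl.trans ht.1
  have hts : 0 ≤ t - k * lam := sub_nonneg.2 ht.1
  have hst : (k * lam).toNNReal ≤ t.toNNReal := Real.toNNReal_le_toNNReal ht.1
  have hXe : interpolation g lam θ₀ B (k * lam) = iterates g lam θ₀ (noise lam B) k :=
    funext fun ω => interpolation_grid hlam k ω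
  have hX := hB.measurable_iterates hθ₀ hg hlam.le k
  have hD : Measurable fun ω => B t.toNNReal ω - B (k * lam).toNNReal ω :=
    (hB.meas _).sub (hB.meas _)
  have hind : IndepFun (iterates g lam θ₀ (noise lam B) k)
      (fun ω => B t.toNNReal ω - B (k * lam).toNNReal ω) P := by
    have h1 := hB.indepFun_init_past_sub hst hθ₀ hindep
    rw [IndepFun_iff_Indep] at h1 ⊢
    exact indep_of_indep_of_le_left h1 (measurable_comap_iterates hg hlam.le k le_rfl).comap_le
  have h1 := (indepFun_iff_map_prod_eq_prod_map_map hX.aemeasurable hD.aemeasurable).1 hind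
  have h2 := hB.map_sub hst
  rw [Real.coe_toNNReal _ ht0, Real.coe_toNNReal _ hkl] at h2
  have hF : Measurable fun w : EuclideanSpace ℝ (Fin d) × EuclideanSpace ℝ (Fin d) =>
      (w.1, w.1 - (t - k * lam) • g w.1 + √2 • w.2) := by fun_prop
  have h3 : (fun ω => (interpolation g lam θ₀ B (k * lam) ω, interpolation g lam θ₀ B t ω))
      = (fun w : EuclideanSpace ℝ (Fin d) × EuclideanSpace ℝ (Fin d) =>
        (w.1, w.1 - (t - k * lam) • g w.1 + √2 • w.2)) ∘ fun ω =>
          (iterates g lam θ₀ (noise lam B) k ω, B t.toNNReal ω - B (k * lam).toNNReal ω) := by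
    ext1 ω
    rw [interpolation_eq hlam k ht, hXe]
    rfl
  have : IsProbabilityMeasure (P.map (iterates g lam θ₀ (noise lam B) k)) :=
    Measure.isProbabilityMeasure_map hX.aemeasurable
  rw [h3, ← Measure.map_map hF (hX.prodMk hD), h1, h2, hXe]
  have h4 := Measure.map_prod_map (P.map (iterates g lam θ₀ (noise lam B) k))
    (stdGaussian (EuclideanSpace ℝ (Fin d))) measurable_id
    (by fun_prop : Measurable fun w : EuclideanSpace ℝ (Fin d) => √(t - k * lam) • w)
  rw [Measure.map_id] at h4
  rw [h4, Measure.map_map hF (by fun_prop)]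
  congr 1
  ext1 w
  simp only [Function.comp, Prod.map_fst, Prod.map_snd, id, smul_smul]
  rw [Real.sqrt_mul (by norm_num)]

/-- The joint law of the interpolation at the last grid time and at the current time is that of one
Euler step with Gaussian noise. -/
theorem IsBrownianMotion.map_interpolation (hB : IsBrownianMotion B P)
    (hθ₀ : AEMeasurable θ₀ P) (hindep : IndepFun θ₀ (fun ω t => B t ω) P) (hg : Measurable g)
    (hlam : 0 < lam) (k : ℕ) {t : ℝ} (ht : t ∈ Icc (k * lam) ((k + 1) * lam)) :
    P.map (fun ω => (interpolation g lam θ₀ B (k * lam) ω, interpolation g lam θ₀ B t ω))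
      = ((P.map (interpolation g lam θ₀ B (k * lam))).prod (stdGaussian _)).map fun w =>
        (w.1, w.1 - (t - k * lam) • g w.1 + √(2 * (t - k * lam)) • w.2) := by
  obtain ⟨B', θ₀', hB', hθ₀', he, he0, hind⟩ := hB.exists_measurable hθ₀ hindep
  have h1 := fun t => interpolation_ae_eq (g := g) (lam := lam) he he0 t
  rw [Measure.map_congr (h1 (k * lam)), ← hB'.map_interpolation hθ₀' hind hg hlam k ht]
  exact Measure.map_congr ((h1 _).prodMk (h1 t))

theorem IsBrownianMotion.aemeasurable_interpolation (hB : IsBrownianMotion B P)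
    (hθ₀ : AEMeasurable θ₀ P) (hindep : IndepFun θ₀ (fun ω t => B t ω) P) (hg : Measurable g)
    (hlam : 0 ≤ lam) (t : ℝ) : AEMeasurable (interpolation g lam θ₀ B t) P := by
  obtain ⟨B', θ₀', hB', hθ₀', he, he0, -⟩ := hB.exists_measurable hθ₀ hindep
  refine ⟨interpolation g lam θ₀' B' t, ?_, interpolation_ae_eq he he0 t⟩
  have h1 := hB'.measurable_iterates hθ₀' hg hlam ⌊t / lam⌋₊
  have h2 := hB'.meas t.toNNReal
  have h3 := hB'.meas (⌊t / lam⌋₊ * lam).toNNReal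
  unfold interpolation
  fun_prop

end

/-! ### Regularity of the one-step laws -/

section

variable {E : Type*} [NormedAddCommGroup E] [InnerProductSpace ℝ E] [FiniteDimensional ℝ E]
  [MeasurableSpace E] [BorelSpace E] {g : E → E} {K s : ℝ} {μ : Measure E}

theorem driftGrowth_zero : DriftGrowth (fun _ : E => (0 : E)) 0 :=
  ⟨continuous_const, fun x => by simp⟩

/-- The density after an Euler step is a Gaussian mixture, so its logarithmic gradient grows at most
linearly, whatever the initial law. -/
theorem logLipschitzDensity_eulerDensity [IsProbabilityMeasure μ] (hg : DriftGrowth g K)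
    (hs : 0 < s) :
    ∃ C, LogLipschitzDensity (eulerDensity g μ s) (eulerGrad g μ s) C := by
  obtain ⟨C, -, hC⟩ := exists_norm_eulerGrad_le (μ := μ) hg hs
  exact ⟨C, eulerDensity_pos hg hs, hasFDerivAt_eulerDensity hg hs, continuous_eulerGrad hg hs, hC⟩

/-- The law of `X - s g(X) + √(2s) ξ`, with `X` of law `μ` and `ξ` independent standard Gaussian. -/
noncomputable def eulerLaw (g : E → E) (s : ℝ) (μ : Measure E) : Measure E :=
  (μ.prod (stdGaussian E)).map fun w => w.1 - s • g w.1 + √(2 * s) • w.2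

theorem eulerLaw_eq_densityMeasure [IsProbabilityMeasure μ] (hg : DriftGrowth g K) (hs : 0 < s) :
    eulerLaw g s μ = densityMeasure (eulerDensity g μ s) := by
  have hgc := hg.cont
  have hKc := continuous_eulerKernel hg s
  have h1 := congrArg (Measure.map Prod.snd) (map_euler_eq_withDensity (μ := μ) hg hs)
  rw [Measure.map_map measurable_snd (Continuous.measurable (by fun_prop))] at h1
  refine h1.trans ?_
  ext A hA
  rw [Measure.map_apply measurable_snd hA, withDensity_apply _ (measurable_snd hA),
    densityMeasure, withDensity_apply _ hA,
    show (Prod.snd ⁻¹' A : Set (E × E)) = univ ×ˢ A by ext; simp,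
    ← Measure.prod_restrict, Measure.restrict_univ,
    lintegral_prod_symm _ (hKc.measurable.ennreal_ofReal.aemeasurable)]
  refine lintegral_congr fun x => ?_
  rw [eulerDensity, ofReal_integral_eq_lintegral_ofReal (integrable_eulerKernel hg hs x)
    (Eventually.of_forall fun z => (eulerKernel_pos hs z x).le)]

theorem isProbabilityMeasure_eulerLaw [IsProbabilityMeasure μ] (hg : DriftGrowth g K) (s : ℝ) :
    IsProbabilityMeasure (eulerLaw g s μ) := by
  have hgc := hg.cont
  exact Measure.isProbabilityMeasure_map (Continuous.aemeasurable (by fun_prop))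

/-- An Euler step with drift of linear growth preserves the finiteness of some Gaussian moment. -/
theorem exists_integrable_exp_sq_eulerLaw [IsProbabilityMeasure μ] (hg : DriftGrowth g K)
    (hμ : ∃ c : ℝ, 0 < c ∧ Integrable (fun x => Real.exp (c * ‖x‖ ^ 2)) μ) (hs : 0 ≤ s) :
    ∃ c : ℝ, 0 < c ∧ Integrable (fun x => Real.exp (c * ‖x‖ ^ 2)) (eulerLaw g s μ) := by
  have hgc := hg.cont
  have hK := hg.nonneg
  obtain ⟨c₁, hc₁, h1⟩ := hμ
  obtain ⟨c₂, hc₂, h2⟩ := IsGaussian.exists_integrable_exp_sq (stdGaussian E)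
  set D : ℝ := 1 + s * K with hD
  set r : ℝ := √(2 * s) with hr
  have hr0 : 0 ≤ r := Real.sqrt_nonneg _
  have hD1 : 1 ≤ D := by have : 0 ≤ s * K := by positivity
                         linarith
  -- By `(a + b + c)² ≤ 3 (a² + b² + c²)` the squared norm after the step splits into a part in the
  -- start and a part in the noise.
  set c : ℝ := min (c₁ / (3 * D ^ 2)) (c₂ / (3 * (r ^ 2 + 1))) with hc
  have hc0 : 0 < c := lt_min (by positivity) (by positivity)
  have hcc1 : c * (3 * D ^ 2) ≤ c₁ := (le_div_iff₀ (by positivity)).1 (min_le_left _ _)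
  have hcc2 : c * (3 * (r ^ 2 + 1)) ≤ c₂ := (le_div_iff₀ (by positivity)).1 (min_le_right _ _)
  refine ⟨c, hc0, ?_⟩
  rw [eulerLaw, integrable_map_measure (Continuous.aestronglyMeasurable (by fun_prop))
    (Continuous.aemeasurable (by fun_prop))]
  refine ((h1.mul_prod h2).const_mul (Real.exp (c * (3 * D ^ 2)))).mono'
    (Continuous.aestronglyMeasurable (by fun_prop)) (Eventually.of_forall fun w => ?_)
  simp only [Function.comp]
  rw [Real.norm_of_nonneg (Real.exp_pos _).le, ← Real.exp_add, ← Real.exp_add, Real.exp_le_exp]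
  have h3 : ‖w.1 - s • g w.1 + r • w.2‖ ≤ D * ‖w.1‖ + D + r * ‖w.2‖ := by
    refine (norm_add_le _ _).trans (add_le_add ((norm_sub_le _ _).trans ?_) ?_)
    · rw [norm_smul, Real.norm_of_nonneg hs]
      have := mul_le_mul_of_nonneg_left (hg.bound w.1) hs
      rw [hD]
      linarith
    · rw [norm_smul, Real.norm_of_nonneg hr0]
  have hw1 := norm_nonneg w.1
  have hw2 := norm_nonneg w.2
  have h4 : ‖w.1 - s • g w.1 + r • w.2‖ ^ 2
      ≤ 3 * D ^ 2 * ‖w.1‖ ^ 2 + 3 * D ^ 2 + 3 * (r ^ 2 + 1) * ‖w.2‖ ^ 2 := by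
    calc _ ≤ (D * ‖w.1‖ + D + r * ‖w.2‖) ^ 2 := by gcongr
      _ ≤ 3 * (D * ‖w.1‖) ^ 2 + 3 * D ^ 2 + 3 * (r * ‖w.2‖) ^ 2 := by
        nlinarith [sq_nonneg (D * ‖w.1‖ - D), sq_nonneg (D * ‖w.1‖ - r * ‖w.2‖),
          sq_nonneg (D - r * ‖w.2‖)]
      _ ≤ _ := by
        have := sq_nonneg ‖w.2‖
        nlinarith
  have h5 := mul_le_mul_of_nonneg_left h4 hc0.le
  have h6 := mul_le_mul_of_nonneg_right hcc1 (sq_nonneg ‖w.1‖)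
  have h7 := mul_le_mul_of_nonneg_right hcc2 (sq_nonneg ‖w.2‖)
  linarith

end

open scoped Matrix in
/-- A nondegenerate Gaussian law is an Euler step with zero drift from a Gaussian law with slightly
smaller covariance. -/
theorem exists_multivariateGaussian_eq_eulerLaw {d : ℕ} (m : EuclideanSpace ℝ (Fin d))
    {S : Matrix (Fin d) (Fin d) ℝ} (hS : S.PosDef) :
    ∃ (τ : ℝ) (S' : Matrix (Fin d) (Fin d) ℝ), 0 < τ ∧
      multivariateGaussian m S = eulerLaw (fun _ => 0) τ (multivariateGaussian m S') := by
  have hpd := Matrix.posDef_iff_dotProduct_mulVec.1 hS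
  -- The smallest value of the quadratic form of `S` on the unit sphere; in dimension `0` any `ε`
  -- will do.
  obtain ⟨ε, hε, hle⟩ : ∃ ε : ℝ, 0 < ε ∧ ∀ x : EuclideanSpace ℝ (Fin d),
      ε * ‖x‖ ^ 2 ≤ x ⬝ᵥ S *ᵥ x := by
    have hf : Continuous fun x : EuclideanSpace ℝ (Fin d) => (x ⬝ᵥ S *ᵥ x : ℝ) := by
      have h1 : Continuous fun x : EuclideanSpace ℝ (Fin d) => (x : Fin d → ℝ) :=
        PiLp.continuous_ofLp 2 _
      exact h1.dotProduct (continuous_const.matrix_mulVec h1)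
    rcases (Metric.sphere (0 : EuclideanSpace ℝ (Fin d)) 1).eq_empty_or_nonempty with h | h
    · refine ⟨1, one_pos, fun x => ?_⟩
      have hx : x = 0 := by
        by_contra hx
        have hx0 : ‖x‖ ≠ 0 := norm_ne_zero_iff.2 hx
        have : (‖x‖)⁻¹ • x ∈ Metric.sphere (0 : EuclideanSpace ℝ (Fin d)) 1 := by
          rw [mem_sphere_zero_iff_norm, norm_smul, norm_inv, norm_norm, inv_mul_cancel₀ hx0]
        rw [h] at this
        exact this
      simp [hx]
    · obtain ⟨x₀, hx₀, hmin⟩ := (isCompact_sphere _ _).exists_isMinOn h hf.continuousOn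
      rw [mem_sphere_zero_iff_norm] at hx₀
      refine ⟨x₀ ⬝ᵥ S *ᵥ x₀, ?_, fun x => ?_⟩
      · refine hpd.2 (x := x₀) fun h0 => ?_
        have : x₀ = 0 := by ext i; exact congrFun h0 i
        rw [this, norm_zero] at hx₀
        exact zero_ne_one hx₀
      · rcases eq_or_ne x 0 with rfl | hx
        · simp
        have hx0 : ‖x‖ ≠ 0 := norm_ne_zero_iff.2 hx
        have h1 := hmin (show (‖x‖)⁻¹ • x ∈ Metric.sphere (0 : EuclideanSpace ℝ (Fin d)) 1 by
          rw [mem_sphere_zero_iff_norm, norm_smul, norm_inv, norm_norm, inv_mul_cancel₀ hx0])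
        simp only [mem_ofPred_eq, WithLp.ofLp_smul, Matrix.mulVec_smul, smul_dotProduct,
          dotProduct_smul, smul_eq_mul] at h1
        have h2 := mul_le_mul_of_nonneg_right h1 (sq_nonneg ‖x‖)
        refine h2.trans_eq ?_
        field_simp
  have hsub : (S - ε • (1 : Matrix (Fin d) (Fin d) ℝ)).PosSemidef := by
    refine Matrix.PosSemidef.of_dotProduct_mulVec_nonneg
      (hpd.1.sub (by simp [Matrix.IsHermitian])) fun x => ?_
    have h1 := hle (WithLp.toLp 2 x)
    rw [EuclideanSpace.real_norm_sq_eq] at h1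
    simp only [star_trivial, Matrix.sub_mulVec, Matrix.smul_mulVec, Matrix.one_mulVec,
      dotProduct_sub, dotProduct_smul, smul_eq_mul, sub_nonneg]
    refine le_trans (le_of_eq ?_) h1
    simp [dotProduct, pow_two]
  refine ⟨ε / 2, S - ε • 1, by positivity, ?_⟩
  have hconv : eulerLaw (fun _ => 0) (ε / 2) (multivariateGaussian m (S - ε • 1))
      = (multivariateGaussian m (S - ε • 1)).conv
        ((stdGaussian (EuclideanSpace ℝ (Fin d))).map fun w => √ε • w) := by
    have h1 := Measure.map_prod_map (multivariateGaussian m (S - ε • 1))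
      (stdGaussian (EuclideanSpace ℝ (Fin d))) measurable_id
      (by fun_prop : Measurable fun w : EuclideanSpace ℝ (Fin d) => √ε • w)
    rw [Measure.map_id] at h1
    rw [Measure.conv, h1, Measure.map_map (by fun_prop) (by fun_prop), eulerLaw]
    congr 1
    ext1 w
    simp [Function.comp, mul_div_cancel₀]
  have : IsProbabilityMeasure ((stdGaussian (EuclideanSpace ℝ (Fin d))).map fun w => √ε • w) :=
    Measure.isProbabilityMeasure_map (by fun_prop)
  have := isProbabilityMeasure_eulerLaw (μ := multivariateGaussian m (S - ε • 1))
    driftGrowth_zero (ε / 2)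
  refine Measure.ext_of_charFun ?_
  ext x
  rw [hconv, charFun_conv, charFun_map_smul, charFun_multivariateGaussian hS.posSemidef,
    charFun_multivariateGaussian hsub, charFun_stdGaussian, ← Complex.exp_add]
  congr 1
  rw [norm_smul, ← Complex.ofReal_pow, mul_pow, Real.norm_of_nonneg (Real.sqrt_nonneg _),
    Real.sq_sqrt hε.le,
    EuclideanSpace.real_norm_sq_eq]
  simp only [Matrix.sub_mulVec, Matrix.smul_mulVec, Matrix.one_mulVec, dotProduct_sub,
    dotProduct_smul, smul_eq_mul]
  have : (x : Fin d → ℝ) ⬝ᵥ (x : Fin d → ℝ) = ∑ i, x i ^ 2 := by simp [dotProduct, pow_two]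
  rw [this]
  push_cast
  ring

/-! ### Entropy dissipation for one Euler step -/

section

variable {d : ℕ} {q : EuclideanSpace ℝ (Fin d) → ℝ}
  {dq : EuclideanSpace ℝ (Fin d) → EuclideanSpace ℝ (Fin d)} {C K : ℝ}
  {g h : EuclideanSpace ℝ (Fin d) → EuclideanSpace ℝ (Fin d)} {u : EuclideanSpace ℝ (Fin d) → ℝ}

theorem eulerLaw_zero {μ : Measure (EuclideanSpace ℝ (Fin d))} [SFinite μ] :
    eulerLaw g 0 μ = μ := by
  simp only [eulerLaw, zero_smul, sub_zero, mul_zero, Real.sqrt_zero, add_zero]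
  exact Measure.fst_prod

theorem fisherInfo_densityMeasure_ne_top_and_neg_le (hq : LogLipschitzDensity q dq C)
    (hu : ∀ x, HasFDerivAt u (innerSL ℝ (h x)) x) (hh : Continuous h)
    (hZ : Integrable fun x => Real.exp (-u x))
    (hint : Integrable fun x => q x * ‖(q x)⁻¹ • dq x + h x‖ ^ 2) :
    fisherInfo (target u) (densityMeasure q) ≠ ∞ ∧
      -(3 / 4) * (∫ x, q x * ‖(q x)⁻¹ • dq x + h x‖ ^ 2)
        ≤ -(3 / 4) * (fisherInfo (target u) (densityMeasure q)).toReal := by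
  have hle := fisherInfo_densityMeasure_le hq hu hh hZ hint
  have h0 : 0 ≤ ∫ x, q x * ‖(q x)⁻¹ • dq x + h x‖ ^ 2 :=
    integral_nonneg fun x => mul_nonneg (hq.pos x).le (by positivity)
  have h1 := ENNReal.toReal_mono ENNReal.ofReal_ne_top hle
  rw [ENNReal.toReal_ofReal h0] at h1
  exact ⟨ne_top_of_le_ne_top ENNReal.ofReal_ne_top hle, by linarith⟩

variable (hq : LogLipschitzDensity q dq C) (hg : DriftGrowth g K)
  {κ : ℝ} (hκ : 0 < κ) (hint : Integrable fun x => q x * Real.exp (κ * ‖x‖ ^ 2))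
  [IsProbabilityMeasure (densityMeasure q)] {Cu : ℝ} {N : ℕ} (hu : PolyPotential u h Cu N)
  (hZ : Integrable fun x => Real.exp (-u x))
include hq hg hκ hint hu hZ

theorem relEntropy_eulerLaw {s : ℝ} (hs : 0 < s) :
    relEntropy (target u) (eulerLaw g s (densityMeasure q)) ≠ ∞ ∧
    (relEntropy (target u) (eulerLaw g s (densityMeasure q))).toReal
      = (∫ x, eulerDensity g (densityMeasure q) s x
          * (Real.log (eulerDensity g (densityMeasure q) s x) + u x))
        + Real.log (∫ y, Real.exp (-u y)) := by
  have hμ := integrable_one_add_norm_pow_densityMeasure hq hκ hint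
  obtain ⟨C', hp⟩ := logLipschitzDensity_eulerDensity (μ := densityMeasure q) hg hs
  have hlaw := eulerLaw_eq_densityMeasure (μ := densityMeasure q) hg hs
  have hprob := isProbabilityMeasure_eulerLaw (μ := densityMeasure q) hg s
  have hi := integrable_eulerDensity_mul_log hg hμ hs hu
  rw [hlaw] at hprob ⊢
  exact ⟨klDiv_densityMeasure_tilted_ne_top hp hu.continuous hZ hi,
    toReal_klDiv_densityMeasure_tilted hp hu.continuous hZ hi⟩

theorem integrable_density_mul_log :
    Integrable fun x => q x * (Real.log (q x) + u x) := by
  obtain ⟨C', hC', hlog⟩ := hq.exists_abs_log_le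
  have hqc := hq.continuous
  have huc := hu.continuous
  have hCu := hu.nonneg
  refine integrable_density_mul hq hκ hint
    ((hqc.log fun x => (hq.pos x).ne').add huc) (B := C' + Cu) (M := N + 2) fun x => ?_
  have hx : (1 : ℝ) ≤ 1 + ‖x‖ := by linarith [norm_nonneg x]
  calc |Real.log (q x) + u x| ≤ C' * (1 + ‖x‖) ^ 2 + Cu * (1 + ‖x‖) ^ N :=
        (abs_add_le _ _).trans (add_le_add (hlog x) (hu.abs_le x))
    _ ≤ C' * (1 + ‖x‖) ^ (N + 2) + Cu * (1 + ‖x‖) ^ (N + 2) := by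
        gcongr <;> omega
    _ = _ := by ring

theorem relEntropy_densityMeasure :
    relEntropy (target u) (densityMeasure q) ≠ ∞ ∧
    (relEntropy (target u) (densityMeasure q)).toReal
      = (∫ x, q x * (Real.log (q x) + u x)) + Real.log (∫ y, Real.exp (-u y)) := by
  have hi := integrable_density_mul_log hq hg hκ hint hu hZ
  exact ⟨klDiv_densityMeasure_tilted_ne_top hq hu.continuous hZ hi,
    toReal_klDiv_densityMeasure_tilted hq hu.continuous hZ hi⟩

/-- The entropy inequality along one Euler step of arbitrary length `s ≥ 0`. For `s > 0` the
derivative is two-sided; at `s = 0` it is the derivative from the right. -/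
theorem entropy_dissipation_eulerLaw {s : ℝ} (hs : 0 ≤ s) :
    relEntropy (target u) (eulerLaw g s (densityMeasure q)) ≠ ∞ ∧
    fisherInfo (target u) (eulerLaw g s (densityMeasure q)) ≠ ∞ ∧
    Integrable (fun w => ‖h (w.1 - s • g w.1 + √(2 * s) • w.2) - g w.1‖ ^ 2)
      ((densityMeasure q).prod (stdGaussian (EuclideanSpace ℝ (Fin d)))) ∧
    ∃ D : ℝ, HasDerivWithinAt
        (fun r => (relEntropy (target u) (eulerLaw g r (densityMeasure q))).toReal) D (Ici 0) s ∧
      D ≤ -(3 / 4) * (fisherInfo (target u) (eulerLaw g s (densityMeasure q))).toReal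
        + ∫ w, ‖h (w.1 - s • g w.1 + √(2 * s) • w.2) - g w.1‖ ^ 2
            ∂((densityMeasure q).prod (stdGaussian (EuclideanSpace ℝ (Fin d)))) := by
  have hμ := integrable_one_add_norm_pow_densityMeasure hq hκ hint
  have hhc := hu.cont
  have hgc := hg.cont
  rcases hs.eq_or_lt with rfl | hs
  · obtain ⟨hi1, hi2, hle⟩ := neg_integral_inner_score_le hq hg hκ hint hu
    obtain ⟨hfin, hval⟩ := relEntropy_densityMeasure hq hg hκ hint hu hZ
    obtain ⟨hfi, hfle⟩ :=
      fisherInfo_densityMeasure_ne_top_and_neg_le hq hu.hasFDerivAt hhc hZ hi1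
    have hi3 : Integrable (fun x => ‖h x - g x‖ ^ 2) (densityMeasure q) := by
      rw [integrable_densityMeasure hq]
      exact hi2
    have he : ∫ w, ‖h w.1 - g w.1‖ ^ 2
        ∂((densityMeasure q).prod (stdGaussian (EuclideanSpace ℝ (Fin d))))
        = ∫ x, q x * ‖h x - g x‖ ^ 2 := by
      rw [integral_fun_fst (fun x => ‖h x - g x‖ ^ 2), integral_densityMeasure hq]
      simp
    rw [eulerLaw_zero]
    simp only [zero_smul, sub_zero, mul_zero, Real.sqrt_zero, add_zero]
    refine ⟨hfin, hfi, hi3.comp_fst _,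
      -∫ x, inner ℝ ((q x)⁻¹ • dq x + h x) (dq x + q x • g x), ?_, ?_⟩
    · have h1 := hasDerivWithinAt_entropy_zero hq hg hκ hint hu
        (f := fun r => (relEntropy (target u) (eulerLaw g r (densityMeasure q))).toReal
          - Real.log (∫ y, Real.exp (-u y)))
        (by rw [eulerLaw_zero, hval, add_sub_cancel_right])
        (fun r hr => by
          rw [(relEntropy_eulerLaw hq hg hκ hint hu hZ hr).2, add_sub_cancel_right])
      simpa using h1.add_const (Real.log (∫ y, Real.exp (-u y)))
    · rw [he]
      linarith
  · have hle := neg_integral_inner_eulerScore_le hg hμ hs hu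
    obtain ⟨C', hp⟩ := logLipschitzDensity_eulerDensity (μ := densityMeasure q) hg hs
    have hlaw := eulerLaw_eq_densityMeasure (μ := densityMeasure q) hg hs
    obtain ⟨hfi, hfle⟩ := fisherInfo_densityMeasure_ne_top_and_neg_le hp hu.hasFDerivAt hhc hZ
      (integrable_eulerDensity_mul_norm_eulerScore_sq hg hμ hs hu)
    refine ⟨(relEntropy_eulerLaw hq hg hκ hint hu hZ hs).1, hlaw ▸ hfi,
      (integrable_euler_iff hg hs (Φ := fun w => ‖h w.2 - g w.1‖ ^ 2) (by fun_prop)).2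
        (integrable_drift_error_euler hg hμ hs hu),
      -∫ x, inner ℝ (eulerScore g (densityMeasure q) h s x)
        (eulerGrad g (densityMeasure q) s x + eulerFlux g (densityMeasure q) s x), ?_, ?_⟩
    · refine HasDerivAt.hasDerivWithinAt ?_
      refine ((hasDerivAt_entropy hg hμ hs hu).add_const
        (Real.log (∫ y, Real.exp (-u y)))).congr_of_eventuallyEq ?_
      filter_upwards [lt_mem_nhds hs] with r hr
      exact (relEntropy_eulerLaw hq hg hκ hint hu hZ hr).2
    · rw [hlaw]
      exact hle.trans (add_le_add hfle le_rfl)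

end

/-! ### The laws at the grid times -/

section

variable {d : ℕ} {Ω : Type*} [MeasurableSpace Ω] {P : Measure Ω} [IsProbabilityMeasure P]
  {B : ℝ≥0 → Ω → EuclideanSpace ℝ (Fin d)} {θ₀ : Ω → EuclideanSpace ℝ (Fin d)}
  {g : EuclideanSpace ℝ (Fin d) → EuclideanSpace ℝ (Fin d)} {K lam : ℝ}

theorem map_interpolation_eq_eulerLaw (hB : IsBrownianMotion B P) (hθ₀ : AEMeasurable θ₀ P)
    (hindep : IndepFun θ₀ (fun ω t => B t ω) P) (hg : DriftGrowth g K)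
    (hlam : 0 < lam) (k : ℕ) {t : ℝ} (ht : t ∈ Icc (k * lam) ((k + 1) * lam)) :
    P.map (interpolation g lam θ₀ B t)
      = eulerLaw g (t - k * lam) (P.map (interpolation g lam θ₀ B (k * lam))) := by
  have hgc := hg.cont
  have hgm := hgc.measurable
  have h1 := hB.aemeasurable_interpolation hθ₀ hindep hgm hlam.le (k * lam)
  have h2 := hB.aemeasurable_interpolation hθ₀ hindep hgm hlam.le t
  have h3 := congrArg (Measure.map Prod.snd) (hB.map_interpolation hθ₀ hindep hgm hlam k ht)
  rw [AEMeasurable.map_map_of_aemeasurable measurable_snd.aemeasurable (h1.prodMk h2),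
    Measure.map_map measurable_snd (Continuous.measurable (by fun_prop))] at h3
  exact h3

/-- At grid times the law of the scheme has a density whose logarithmic gradient grows at most
linearly, and Gaussian moments. The density is regular because the law is itself the result of an
Euler step: the previous step of the scheme, or a step with zero drift from a slightly narrower
Gaussian at time `0`. -/
theorem exists_density_interpolation_grid (hB : IsBrownianMotion B P)
    {m : EuclideanSpace ℝ (Fin d)} {S : Matrix (Fin d) (Fin d) ℝ} (hS : S.PosDef)
    (hθ₀ : HasLaw θ₀ (multivariateGaussian m S) P)
    (hindep : IndepFun θ₀ (fun ω t => B t ω) P) (hg : DriftGrowth g K) (hlam : 0 < lam) (k : ℕ) :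
    ∃ (q : EuclideanSpace ℝ (Fin d) → ℝ) (dq : EuclideanSpace ℝ (Fin d) → EuclideanSpace ℝ (Fin d))
      (C κ : ℝ), LogLipschitzDensity q dq C ∧ 0 < κ ∧
        (Integrable fun x => q x * Real.exp (κ * ‖x‖ ^ 2)) ∧
        P.map (interpolation g lam θ₀ B (k * lam)) = densityMeasure q := by
  have hgm := hg.cont.measurable
  have hprob : ∀ t, IsProbabilityMeasure (P.map (interpolation g lam θ₀ B t)) := fun t =>
    Measure.isProbabilityMeasure_map
      (hB.aemeasurable_interpolation hθ₀.aemeasurable hindep hgm hlam.le t)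
  have hzero : P.map (interpolation g lam θ₀ B ((0 : ℕ) * lam)) = multivariateGaussian m S := by
    have : interpolation g lam θ₀ B ((0 : ℕ) * lam) = θ₀ :=
      funext fun ω => interpolation_grid hlam 0 ω
    rw [this, hθ₀.map_eq]
  have hsucc : ∀ j : ℕ, P.map (interpolation g lam θ₀ B ((j + 1 : ℕ) * lam))
      = eulerLaw g lam (P.map (interpolation g lam θ₀ B (j * lam))) := fun j => by
    rw [map_interpolation_eq_eulerLaw hB hθ₀.aemeasurable hindep hg hlam j
      (t := (j + 1 : ℕ) * lam) (by push_cast; exact ⟨by nlinarith, le_rfl⟩)]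
    congr 1
    push_cast
    ring
  -- Fernique's theorem at time `0`, and induction over the steps.
  have hexp : ∀ j : ℕ, ∃ c : ℝ, 0 < c ∧ Integrable (fun x => Real.exp (c * ‖x‖ ^ 2))
      (P.map (interpolation g lam θ₀ B (j * lam))) := fun j => by
    induction j with
    | zero =>
      rw [hzero]
      exact IsGaussian.exists_integrable_exp_sq _
    | succ j ih =>
      rw [hsucc]
      exact exists_integrable_exp_sq_eulerLaw hg ih hlam.le
  obtain ⟨q, dq, C, hq, hlaw⟩ : ∃ (q : EuclideanSpace ℝ (Fin d) → ℝ)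
      (dq : EuclideanSpace ℝ (Fin d) → EuclideanSpace ℝ (Fin d)) (C : ℝ),
      LogLipschitzDensity q dq C ∧
        P.map (interpolation g lam θ₀ B (k * lam)) = densityMeasure q := by
    rcases k with - | j
    · obtain ⟨τ, S', hτ, h1⟩ := exists_multivariateGaussian_eq_eulerLaw m hS
      obtain ⟨C, hC⟩ := logLipschitzDensity_eulerDensity (μ := multivariateGaussian m S')
        driftGrowth_zero hτ
      exact ⟨_, _, C, hC, by rw [hzero, h1, eulerLaw_eq_densityMeasure driftGrowth_zero hτ]⟩
    · obtain ⟨C, hC⟩ := logLipschitzDensity_eulerDensity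
        (μ := P.map (interpolation g lam θ₀ B (j * lam))) hg hlam
      exact ⟨_, _, C, hC, by rw [hsucc, eulerLaw_eq_densityMeasure hg hlam]⟩
  obtain ⟨κ, hκ, hi⟩ := hexp k
  rw [hlaw, integrable_densityMeasure hq] at hi
  exact ⟨q, dq, C, κ, hq, hκ, hi, hlaw⟩

end

end TamedLangevin

/-! ### The differential inequality for the relative entropy -/

theorem mainTheorem9 {d : ℕ}
    -- the potential, its gradient and the constants
    (u : EuclideanSpace ℝ (Fin d) → ℝ) (hu : ContDiff ℝ 2 u)
    (L' l' A a b L l : ℝ)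
    (hdrift : TamedLangevin.DriftAssumption (gradient u) L' l' A a b L l)
    -- the step size; `Cstar` is a bound on the Jacobian of `x / (1 + |x|²)^{1 - a/2}`
    (Cstar : ℝ)
    (hCstar : ∀ x : EuclideanSpace ℝ (Fin d),
      ‖fderiv ℝ (TamedLangevin.radialField (d := d) a) x‖ ≤ Cstar)
    (lam : ℝ) (hlam : 0 < lam)
    (hlam_max : lam < 1 / (4 * (2 * A * Cstar + 2 * L + 1) ^ 2))
    -- the Brownian motion and the independent Gaussian initial condition
    {Ω : Type*} [MeasurableSpace Ω] (P : Measure Ω) [IsProbabilityMeasure P]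
    (B : ℝ≥0 → Ω → EuclideanSpace ℝ (Fin d)) (hB : TamedLangevin.IsBrownianMotion B P)
    (θ₀ : Ω → EuclideanSpace ℝ (Fin d))
    (m : EuclideanSpace ℝ (Fin d)) (S : Matrix (Fin d) (Fin d) ℝ) (hS : S.PosDef)
    (hθ₀ : HasLaw θ₀ (multivariateGaussian m S) P)
    (hindep : IndepFun θ₀ (fun ω t => B t ω) P)
    -- the tamed drift, the interpolation and its marginals
    (hl : EuclideanSpace ℝ (Fin d) → EuclideanSpace ℝ (Fin d))
    (hhl : hl = TamedLangevin.tamedDrift (gradient u) A a l lam)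
    (θ : ℝ → Ω → EuclideanSpace ℝ (Fin d))
    (hθ : θ = TamedLangevin.interpolation hl lam θ₀ B)
    (k : ℕ) (t : ℝ) (ht : t ∈ Icc (k * lam) ((k + 1) * lam)) :
    TamedLangevin.relEntropy (TamedLangevin.target u) (P.map (θ t)) ≠ ∞ ∧
    TamedLangevin.fisherInfo (TamedLangevin.target u) (P.map (θ t)) ≠ ∞ ∧
    Integrable (fun ω => ‖gradient u (θ t ω) - hl (θ (k * lam) ω)‖ ^ 2) P ∧
    ∃ D : ℝ,
      HasDerivWithinAt
        (fun s => (TamedLangevin.relEntropy (TamedLangevin.target u) (P.map (θ s))).toReal)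
        D (Icc (k * lam) ((k + 1) * lam)) t ∧
      D ≤ - (3 / 4) * (TamedLangevin.fisherInfo (TamedLangevin.target u) (P.map (θ t))).toReal
        + ∫ ω, ‖gradient u (θ t ω) - hl (θ (k * lam) ω)‖ ^ 2 ∂P := by
  subst hhl hθ
  have hg := TamedLangevin.driftGrowth_tamedDrift hdrift hu hCstar hlam
  set g := TamedLangevin.tamedDrift (gradient u) A a l lam
  obtain ⟨Cu, N, hpot⟩ := TamedLangevin.exists_polyPotential hdrift hu
  have hZ := TamedLangevin.integrable_exp_neg_potential hdrift hu
  obtain ⟨q, dq, C, κ, hq, hκ, hint, hlaw⟩ :=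
    TamedLangevin.exists_density_interpolation_grid hB hS hθ₀ hindep hg hlam k
  have hgm := hg.cont.measurable
  have hgc := hg.cont
  have hhc := hpot.cont
  have hm := hB.aemeasurable_interpolation hθ₀.aemeasurable hindep hgm hlam.le
  have hprob : IsProbabilityMeasure (TamedLangevin.densityMeasure q) :=
    hlaw ▸ Measure.isProbabilityMeasure_map (hm _)
  have hmarg : ∀ r ∈ Icc (k * lam) ((k + 1) * lam),
      P.map (TamedLangevin.interpolation g lam θ₀ B r)
        = TamedLangevin.eulerLaw g (r - k * lam) (TamedLangevin.densityMeasure q) := fun r hr => by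
    rw [TamedLangevin.map_interpolation_eq_eulerLaw hB hθ₀.aemeasurable hindep hg hlam k hr, hlaw]
  obtain ⟨h1, h2, h3, D, hD, hle⟩ :=
    TamedLangevin.entropy_dissipation_eulerLaw hq hg hκ hint hpot hZ (sub_nonneg.2 ht.1)
  -- The squared drift error is a function of the joint law at the times `kλ` and `t`.
  have hjoint := hB.map_interpolation hθ₀.aemeasurable hindep hgm hlam k ht
  rw [hlaw] at hjoint
  have hΦ : Continuous fun w : EuclideanSpace ℝ (Fin d) × EuclideanSpace ℝ (Fin d) =>
      ‖gradient u w.2 - g w.1‖ ^ 2 := by fun_prop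
  have hF : Measurable fun w : EuclideanSpace ℝ (Fin d) × EuclideanSpace ℝ (Fin d) =>
      (w.1, w.1 - (t - k * lam) • g w.1 + √(2 * (t - k * lam)) • w.2) := by fun_prop
  have hpair := (hm (k * lam)).prodMk (hm t)
  have hint_err : Integrable (fun ω => ‖gradient u (TamedLangevin.interpolation g lam θ₀ B t ω)
      - g (TamedLangevin.interpolation g lam θ₀ B (k * lam) ω)‖ ^ 2) P := by
    have h4 := (integrable_map_measure hΦ.aestronglyMeasurable hF.aemeasurable).2 h3
    rw [← hjoint] at h4
    exact (integrable_map_measure hΦ.aestronglyMeasurable hpair).1 h4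
  have herr : ∫ ω, ‖gradient u (TamedLangevin.interpolation g lam θ₀ B t ω)
      - g (TamedLangevin.interpolation g lam θ₀ B (k * lam) ω)‖ ^ 2 ∂P
      = ∫ w, ‖gradient u (w.1 - (t - k * lam) • g w.1 + √(2 * (t - k * lam)) • w.2) - g w.1‖ ^ 2
        ∂((TamedLangevin.densityMeasure q).prod (stdGaussian (EuclideanSpace ℝ (Fin d)))) := by
    rw [← integral_map hpair hΦ.aestronglyMeasurable, hjoint,
      integral_map hF.aemeasurable hΦ.aestronglyMeasurable]
  rw [hmarg t ht, herr]
  refine ⟨h1, h2, hint_err, D, ?_, hle⟩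
  -- The step size is `r = t - kλ`, and `Icc (kλ) ((k + 1)λ)` is mapped into `Ici 0`.
  have hshift : HasDerivWithinAt (fun r : ℝ => r - k * lam) 1
      (Icc (k * lam) ((k + 1) * lam)) t := ((hasDerivAt_id t).sub_const _).hasDerivWithinAt
  have hcomp := hD.comp t hshift fun r hr => sub_nonneg.2 hr.1
  rw [mul_one] at hcomp
  exact hcomp.congr (fun r hr => by rw [hmarg r hr]; rfl) (by rw [hmarg t ht]; rfl)
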